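/- **Setting.** *Stamps* are $aCR, aCW, aCAS, aMF, aWT$ and, for each node $n$, $nlR_n, nrW_n, narR_n, nrR_n, nlW_n, nF_n, gF_n$. The *stamp order* $\mathsf{sto}$ relates: $aCR, aCAS, aMF, aWT$ and each $gF_n$ to every stamp; $aCW$ to every stamp except $aCR, aWT$; and, for equal node index, $nlR$ to $nlR,nrW,narR,nrR,nlW,nF,gF$; $nrW$ to $nrW,narR,nrR,nlW,gF$; $narR$ to $nrW,narR,nrR,nlW,nF,gF$; $nrR$ to $nlW,nF,gF$; $nlW$ to $nlW,gF$; $nF$ to $nlR,nrW,narR,nrR,nlW,nF,gF$; and nothing else. There are finitely many threads. Threads, memory locations and node locks each reside on a node. Values carry a distinguished value $0$ and a commutative addition. An *event* is a tuple of a thread, an identifier, a method call and an output value. An *execution* $G=(E,po,stmp,so,hb)$ consists of a set of events, a relation $po$ on $E$ that is a disjoint union of strict total orders, one per thread, a non-empty set $stmp(e)$ of stamps for each $e\in E$, and relations $so\subseteq hb$ on the set $SE=\{(e,a): e\in E, a\in stmp(e)\}$ of *subevents*, where $hb$ is transitive and contains $ppo=\{((e_1,a_1),(e_2,a_2))\in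 SE^2 : (e_1,e_2)\in po,\ (a_1,a_2)\in \mathsf{sto}\}$. A *library* $L$ consists of a set of method calls, the set of locations accessed by each call, and a set of $L$-consistent executions. For a set $\Lambda$ of libraries, $G$ is *$\Lambda$-consistent* if $hb$ is irreflexive, every event calls a method of some $L\in\Lambda$, the restriction $G|_L$ to the events of $L$ is $L$-consistent for every $L\in\Lambda$, and $so=\bigcup_{L\in\Lambda} so|_L$. Sequential programs are generated by values, method calls, $\mathtt{let}$ (with arbitrary continuation functions), loops and breaks; a concurrent program is a family of sequential programs, one per thread. Its *plain executions* are the pairs $(E,po)$ with final values $v$ (one per thread) obtained by unfolding the program of each thread to termination, with arbitrary outputs of the calls. $\mathsf{outcome}_\Lambda(p)$ is the set of all $v$ for which there is a $\Lambda$-consistent execution $G$ whose $(E,po)$ is a plain execution of $p$ with final values $v$. Methods without a result return a fixed unit value. For sets $R,W$ of read and write subevents with locations and values $v_R,v_W$, a *reads-from* relation $rf\subseteq W\times R$ relates subevents with equal location and $v_W(w)=v_R(r)$, each $r$ has at most one $rf$-predecessor, and $v_R(r)=0$ if it has none; a *modification order* $mo$ is a union of strict total orders on the writes to each location; *reads-before*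 is $rb=\{(r,w)\in R\times W : r\neq w,\ loc(r)=loc(w),\ (r,w)\in rf^{-1};mo \text{ or } r \text{ has no } rf\text{-predecessor}\}$. **The RDMA library** $\mathrm{RDMA}^{wait}_{rmw}$. Stamps of the calls, by a thread $t$: $\mathtt{Write}(x,v)$: $\{aCW\}$; $\mathtt{Read}(x)$: $\{aCR\}$; $\mathtt{CAS}(x,v_1,v_2)$: $\{aCAS\}$ if its output is $v_1$, else $\{aMF,aCR\}$; $\mathtt{Mfence}$: $\{aMF\}$; $\mathtt{Get}(x,y,d)$ (local $x$, $y$ on node $n$): $\{nrR_n,nlW_n\}$; $\mathtt{Put}(x,y,d)$ ($x$ on node $n$, local $y$): $\{nlR_n,nrW_n\}$; $\mathtt{Wait}(d)$: $\{aWT\}$; $\mathtt{Rfence}(n)$: $\{nF_n\}$; $\mathtt{RCAS}(x,y,v_1,v_2,d)$ (local $x$, $y$ on node $n$): $\{narR_n,nlW_n\}$ (failure) or $\{narR_n,nrW_n,nlW_n\}$ (success); $\mathtt{RFAA}(x,y,v,d)$: $\{narR_n,nrW_n,nlW_n\}$. The locations of $\mathtt{Write},\mathtt{Read},\mathtt{CAS}$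 and those marked local are on the node of $t$. Read subevents have stamp $aCR,aCAS,nlR,narR,nrR$; write subevents $aCW,aCAS,nlW,nrW$. Subevents $nrR,narR$ and $nrW$ access the remote location (for RCAS/RFAA, $y$), and $nlR,nlW$ the local one. $G$ is consistent if there are $v_R,v_W,rf,mo$ as above and relations $nfo,rao$ on subevents such that: $v_R$ of a $\mathtt{Read}$ or $\mathtt{CAS}$ is its output, and $v_W$ of a $\mathtt{Write}$ or of a successful $\mathtt{CAS}$ is the value to be written; the values of the subevents $nlR,nrW$ of a Put, $nrR,nlW$ of a Get, and $narR,nlW$ of an RCAS or RFAA agree; a failed RCAS has $v_R(narR)\neq v_1$, a successful one $v_R(narR)=v_1$, $v_W(nrW)=v_2$; an RFAA has $v_W(nrW)=v_R(narR)+v$; $nfo$ orders, one way or the other, any two subevents of the same thread with stamps $nlR_n,nlW_n$, or $nrR_n,nrW_n$, or $narR_n,nrW_n$; $rao$ is a union over nodes $n$ of strict total orders on the $narR_n$ subevents of RCAS and RFAA calls towards $n$; the relation $ib$ is irreflexive; and $$so = iso\cup rfe\cup pfg\cup nfo\cup rb\cup mo\cup rao\cup ([nrW];iso^{-1};rao)\cup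 [Inst];ib .$$ Here $iso$ relates subevents of one event: $aMF$ to $aCR$ for CAS, $nrR_n$ to $nlW_n$ for Get, $nlR_n$ to $nrW_n$ for Put, and $narR_n$ to $nlW_n$ and $nrW_n$ for RCAS and RFAA; $pfg$ (resp. $pfp$) relates $nlW$ (resp. $nrW$) subevents to $po$-later $aWT$ subevents with the same work identifier $d$; $rfi$ is the part of $rf$ from $aCW$ to $po$-later $aCR$ and $rfe=rf\setminus rfi$; $rbi$ is the part of $rb$ from $aCR$ to $aCW$ subevents of the same thread; $ippo$ is $ppo$ together with the $po$-pairs from $aCW$ to $aCR$ or $aWT$ and from $nrW_n$ or $nlW_n$ to $nF_n$; $ib=(ippo\cup iso\cup rf\cup pfg\cup pfp\cup nfo\cup rbi)^+$; $Inst$ is the set of subevents with stamp other than $aCW,nlW,nrW$. **The node lock library**, with methods $\mathtt{Acq}(l),\mathtt{Rel}(l)$. Locks are used in a *well-formed* fashion in a plain execution if, for each $l$ and with $po$ restricted to the events on $l$, every acquisition is immediately followed by a release and every release is immediately preceded by an acquisition. If this fails, every behaviour is allowed. Otherwise, with $n$ the node of $l$, acquisitions have stamps $\{aMF\}$ and releases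 $\{nF_n,nrW_n\}$, and $so$ consists, for each $l$, of the pairs from $nF_n$ to $nrW_n$ of one release, and of the pairs from the $nrW_n$ subevent of a release to the $aMF$ subevent of each acquisition that follows the acquisition matching this release in $lo_l$, for some strict total orders $lo_l$ on the acquisitions of $l$. **The sequentially consistent library** $\mathrm{RDMA}^{sc}_{rmw}$, with methods $\mathtt{Write}_{sc}(x,v),\mathtt{Read}_{sc}(x),\mathtt{CAS}_{sc}(x,v_1,v_2),\mathtt{FAA}_{sc}(x,v)$. All events have stamps $\{aMF\}$. Reads are all events but $\mathtt{Write}_{sc}$, writes all events but $\mathtt{Read}_{sc}$ and failed $\mathtt{CAS}_{sc}$ (output different from $v_1$). $G$ is consistent if there are $v_R,v_W,rf,mo$ as above with $v_R$ the output, $v_W=v$ for $\mathtt{Write}_{sc}$, $v_W=v_2$ for successful $\mathtt{CAS}_{sc}$, $v_W=v+v_R$ for $\mathtt{FAA}_{sc}$, and $so=po\cup rf\cup mo\cup rb$. **The implementation** $I$. Each abstract location $x$ has an RDMA location $\bar x$ and a node lock $l_x$ on the same node; each thread $t$ has, on its own node, a location $r_t$ and a location $p_x^t$ for each $x$; all these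 RDMA locations are distinct; $d_t,d'_t$ are arbitrary work identifiers. Thread $t$ runs - $\mathtt{Write}_{sc}(x,v)$ as $\mathtt{Acq}(l_x);\mathtt{Write}(p_x^t,v);\mathtt{Put}(\bar x,p_x^t,d'_t);\mathtt{Rel}(l_x)$; - $\mathtt{Read}_{sc}(x)$ as $\mathtt{Acq}(l_x);\mathtt{Get}(r_t,\bar x,d_t);\mathtt{Rel}(l_x);\mathtt{Wait}(d_t);\mathtt{Read}(r_t)$; - $\mathtt{CAS}_{sc}(x,v_1,v_2)$ and $\mathtt{FAA}_{sc}(x,v)$ likewise, with $\mathtt{RCAS}(r_t,\bar x,v_1,v_2,d_t)$, respectively $\mathtt{RFAA}(r_t,\bar x,v,d_t)$, in place of $\mathtt{Get}$. **Theorem.** The implementation $I$ of $\mathrm{RDMA}^{sc}_{rmw}$ is sound. That is, let $\Lambda$ consist of the RDMA library, the node lock library and any set of further libraries whose method sets are disjoint from each other and from those of the three libraries above. Let $p$ be a concurrent program over $\Lambda\cup\{\mathrm{RDMA}^{sc}_{rmw}\}$ whose accessed locations (locks included) are disjoint from those accessed by $I$, and let $I(p)$ be $p$ with each call of an $\mathrm{RDMA}^{sc}_{rmw}$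 method by thread $t$ replaced by its implementation for $t$. If node locks are used in a well-formed fashion in all plain executions of $p$, then $$\mathsf{outcome}_\Lambda(I(p))\subseteq \mathsf{outcome}_{\Lambda\cup\{\mathrm{RDMA}^{sc}_{rmw}\}}(p).$$ More generally, without this assumption on $p$, the final values $v$ of every $\Lambda$-consistent execution of $I(p)$ in which node locks are used in a well-formed fashion are in $\mathsf{outcome}_{\Lambda\cup\{\mathrm{RDMA}^{sc}_{rmw}\}}(p)$. -/

import Mathlib

namespace Mowgli

/-! ## Stamps and the stamp order -/

/-- The stamps. The last seven are families indexed by a node. -/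
inductive Stamp (Node : Type*) where
  /-- CPU read -/
  | aCR
  /-- CPU write -/
  | aCW
  /-- successful CPU compare-and-swap -/
  | aCAS
  /-- memory fence -/
  | aMF
  /-- wait -/
  | aWT
  /-- NIC local read -/
  | nlR (n : Node)
  /-- NIC remote write -/
  | nrW (n : Node)
  /-- NIC atomic remote read -/
  | narR (n : Node)
  /-- NIC remote read -/
  | nrR (n : Node)
  /-- NIC local write -/
  | nlW (n : Node)
  /-- NIC remote fence -/
  | nF (n : Node)
  /-- global fence -/
  | gF (n : Node)

/-- The stamp order: `sto a b` says that a subevent with stamp `a` is ordered before any subevent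
with stamp `b` of an event that is later in program order. -/
def Stamp.sto {Node : Type*} : Stamp Node → Stamp Node → Prop
  | .aCR, _ => True
  | .aCW, .aCR => False
  | .aCW, .aWT => False
  | .aCW, _ => True
  | .aCAS, _ => True
  | .aMF, _ => True
  | .aWT, _ => True
  | .gF _, _ => True
  | .nlR n, .nlR m => n = m
  | .nlR n, .nrW m => n = m
  | .nlR n, .narR m => n = m
  | .nlR n, .nrR m => n = m
  | .nlR n, .nlW m => n = m
  | .nlR n, .nF m => n = m
  | .nlR n, .gF m => n = m
  | .nrW n, .nrW m => n = m
  | .nrW n, .narR m => n = m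
  | .nrW n, .nrR m => n = m
  | .nrW n, .nlW m => n = m
  | .nrW n, .gF m => n = m
  | .narR n, .nrW m => n = m
  | .narR n, .narR m => n = m
  | .narR n, .nrR m => n = m
  | .narR n, .nlW m => n = m
  | .narR n, .nF m => n = m
  | .narR n, .gF m => n = m
  | .nrR n, .nlW m => n = m
  | .nrR n, .nF m => n = m
  | .nrR n, .gF m => n = m
  | .nlW n, .nlW m => n = m
  | .nlW n, .gF m => n = m
  | .nF n, .nlR m => n = m
  | .nF n, .nrW m => n = m
  | .nF n, .narR m => n = m
  | .nF n, .nrR m => n = m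
  | .nF n, .nlW m => n = m
  | .nF n, .nF m => n = m
  | .nF n, .gF m => n = m
  | _, _ => False

/-! ## Events and executions -/

section Framework

/-- An event: thread, identifier, method call (method name with its arguments), output. -/
@[ext] structure Event (Tid Call Val : Type*) where
  thread : Tid
  id : ℕ
  call : Call
  out : Val

/-- A subevent: an event together with a stamp. -/
abbrev SubEvent (Tid Call Val Node : Type*) := Event Tid Call Val × Stamp Node

/-- The data of a plain execution: a set of events and the program order. -/
@[ext] structure Plain (Tid Call Val : Type*) where
  E : Set (Event Tid Call Val)
  po : Event Tid Call Val → Event Tid Call Val → Prop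

/-- The data of an execution: events, program order, stamps, synchronisation order,
happens-before. -/
@[ext] structure Exec (Tid Call Val Node : Type*) extends Plain Tid Call Val where
  stmp : Event Tid Call Val → Set (Stamp Node)
  so : SubEvent Tid Call Val Node → SubEvent Tid Call Val Node → Prop
  hb : SubEvent Tid Call Val Node → SubEvent Tid Call Val Node → Prop

variable {Tid Call Val Node ALoc : Type*}

/-- `po` is a disjoint union of strict total orders, one for each thread. -/
def Plain.IsPlain (G : Plain Tid Call Val) : Prop :=
  (∀ e₁ e₂, G.po e₁ e₂ → e₁ ∈ G.E ∧ e₂ ∈ G.E ∧ e₁.thread = e₂.thread) ∧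
  (∀ e, ¬ G.po e e) ∧
  (∀ e₁ e₂ e₃, G.po e₁ e₂ → G.po e₂ e₃ → G.po e₁ e₃) ∧
  (∀ e₁ ∈ G.E, ∀ e₂ ∈ G.E, e₁.thread = e₂.thread → e₁ ≠ e₂ → G.po e₁ e₂ ∨ G.po e₂ e₁)

/-- The set of subevents of an execution. -/
def Exec.SE (G : Exec Tid Call Val Node) : Set (SubEvent Tid Call Val Node) :=
  {s | s.1 ∈ G.E ∧ s.2 ∈ G.stmp s.1}

/-- Preserved program order. -/
def Exec.ppo (G : Exec Tid Call Val Node) (s₁ s₂ : SubEvent Tid Call Val Node) : Prop :=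
  s₁ ∈ G.SE ∧ s₂ ∈ G.SE ∧ G.po s₁.1 s₂.1 ∧ Stamp.sto s₁.2 s₂.2

/-- `G` is an execution. Irreflexivity of `hb` is stated in `Consistent`. -/
def Exec.IsExec (G : Exec Tid Call Val Node) : Prop :=
  G.toPlain.IsPlain ∧
  (∀ e ∈ G.E, (G.stmp e).Nonempty) ∧
  (∀ s₁ s₂, G.hb s₁ s₂ → s₁ ∈ G.SE ∧ s₂ ∈ G.SE) ∧
  (∀ s₁ s₂ s₃, G.hb s₁ s₂ → G.hb s₂ s₃ → G.hb s₁ s₃) ∧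
  (∀ s₁ s₂, G.so s₁ s₂ → G.hb s₁ s₂) ∧
  (∀ s₁ s₂, G.ppo s₁ s₂ → G.hb s₁ s₂)

/-- Restriction of an execution to the events that call a method in `M`. -/
def Exec.restrict (G : Exec Tid Call Val Node) (M : Set Call) : Exec Tid Call Val Node where
  E := {e | e ∈ G.E ∧ e.call ∈ M}
  po e₁ e₂ := G.po e₁ e₂ ∧ e₁.call ∈ M ∧ e₂.call ∈ M
  stmp e := {a | a ∈ G.stmp e ∧ e ∈ G.E ∧ e.call ∈ M}
  so s₁ s₂ := G.so s₁ s₂ ∧ s₁.1.call ∈ M ∧ s₂.1.call ∈ M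
  hb s₁ s₂ := G.hb s₁ s₂ ∧ s₁.1.call ∈ M ∧ s₂.1.call ∈ M

/-! ## Libraries and consistency -/

/-- A library: its method calls, the locations accessed by a call, its consistent executions. -/
structure Library (Tid Call Val Node ALoc : Type*) where
  methods : Set Call
  loc : Call → Set ALoc
  cons : Set (Exec Tid Call Val Node)

/-- Consistency of an execution with respect to a set of libraries. -/
def Consistent (Λ : Set (Library Tid Call Val Node ALoc)) (G : Exec Tid Call Val Node) : Prop :=
  G.IsExec ∧
  (∀ L ∈ Λ, G.restrict L.methods ∈ L.cons) ∧
  (∀ e ∈ G.E, ∃ L ∈ Λ, e.call ∈ L.methods) ∧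
  (∀ s₁ s₂, G.so s₁ s₂ ↔ ∃ L ∈ Λ, (G.restrict L.methods).so s₁ s₂) ∧
  (∀ s, ¬ G.hb s s)

/-! ## Programs and their plain semantics -/

/-- Sequential programs. -/
inductive SeqProg (Call Val : Type*) where
  | val (v : Val)
  | call (c : Call)
  | letIn (p : SeqProg Call Val) (f : Val → SeqProg Call Val)
  | loop (p : SeqProg Call Val)
  | brk (k : ℕ+) (v : Val)

/-- Sequencing, dropping the value of the first program. -/
def SeqProg.seq (p q : SeqProg Call Val) : SeqProg Call Val := .letIn p (fun _ => q)

/-- The empty plain execution. -/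
def Plain.empty : Plain Tid Call Val := ⟨∅, fun _ _ => False⟩

/-- The plain execution with a single event. -/
def Plain.single (e : Event Tid Call Val) : Plain Tid Call Val := ⟨{e}, fun _ _ => False⟩

/-- Sequential composition of plain executions. -/
def Plain.comp (G₁ G₂ : Plain Tid Call Val) : Plain Tid Call Val where
  E := G₁.E ∪ G₂.E
  po e₁ e₂ := G₁.po e₁ e₂ ∨ G₂.po e₁ e₂ ∨ (e₁ ∈ G₁.E ∧ e₂ ∈ G₂.E)

/-- Parallel composition of a family of plain executions. -/
def Plain.par (G : Tid → Plain Tid Call Val) : Plain Tid Call Val where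
  E := {e | ∃ t, e ∈ (G t).E}
  po e₁ e₂ := ∃ t, (G t).po e₁ e₂

/-- `Sem t p (v, k) G`: run by thread `t`, the program `p` may unfold into the method calls `G`,
ending with value `v` and break number `k`. Outputs of calls are arbitrary here. -/
inductive Sem (t : Tid) : SeqProg Call Val → Val × ℕ → Plain Tid Call Val → Prop
  | val (v : Val) : Sem t (.val v) (v, 0) Plain.empty
  | brk (k : ℕ+) (v : Val) : Sem t (.brk k v) (v, k) Plain.empty
  | call (c : Call) (i : ℕ) (v : Val) : Sem t (.call c) (v, 0) (Plain.single ⟨t, i, c, v⟩)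
  | letIn {p : SeqProg Call Val} {f : Val → SeqProg Call Val} {v : Val} {r : Val × ℕ}
      {G₁ G₂ : Plain Tid Call Val} : Sem t p (v, 0) G₁ → Sem t (f v) r G₂ →
      Disjoint G₁.E G₂.E → Sem t (.letIn p f) r (G₁.comp G₂)
  | letBrk {p : SeqProg Call Val} {f : Val → SeqProg Call Val} {v : Val} {k : ℕ}
      {G₁ : Plain Tid Call Val} : Sem t p (v, k) G₁ → k ≠ 0 → Sem t (.letIn p f) (v, k) G₁
  | loopStep {p : SeqProg Call Val} {v : Val} {r : Val × ℕ} {G₁ G₂ : Plain Tid Call Val} :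
      Sem t p (v, 0) G₁ → Sem t (.loop p) r G₂ → Disjoint G₁.E G₂.E →
      Sem t (.loop p) r (G₁.comp G₂)
  | loopExit {p : SeqProg Call Val} {v : Val} {k : ℕ} {G : Plain Tid Call Val} :
      Sem t p (v, k + 1) G → Sem t (.loop p) (v, k) G

/-- Concurrent programs: one sequential program for each thread. -/
abbrev Prog (Tid Call Val : Type*) := Tid → SeqProg Call Val

/-- Plain semantics of concurrent programs: each thread terminates with break number `0`. -/
def ConcSem (p : Prog Tid Call Val) (v : Tid → Val) (G : Plain Tid Call Val) : Prop :=
  ∃ H : Tid → Plain Tid Call Val, (∀ t, Sem t (p t) (v t, 0) (H t)) ∧ G = Plain.par H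

/-- The outcomes of a program: the output values of its consistent executions. -/
def outcome (Λ : Set (Library Tid Call Val Node ALoc)) (p : Prog Tid Call Val) :
    Set (Tid → Val) :=
  {v | ∃ G : Exec Tid Call Val Node, Consistent Λ G ∧ ConcSem p v G.toPlain}

/-! ## Implementations -/

open Classical in
/-- Replace each call of a method in `M`, in a program of thread `t`, by its implementation. -/
noncomputable def SeqProg.implement (I : Tid → Call → SeqProg Call Val) (M : Set Call) (t : Tid) :
    SeqProg Call Val → SeqProg Call Val
  | .val v => .val v
  | .call c => if c ∈ M then I t c else .call c
  | .letIn p f => .letIn (p.implement I M t) (fun v => (f v).implement I M t)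
  | .loop p => .loop (p.implement I M t)
  | .brk k v => .brk k v

/-- The implemented concurrent program. -/
noncomputable def implement (I : Tid → Call → SeqProg Call Val)
    (L : Library Tid Call Val Node ALoc) (p : Prog Tid Call Val) : Prog Tid Call Val :=
  fun t => (p t).implement I L.methods t

/-- Locations accessed by the events of a plain execution over the libraries `Λ`. -/
def Plain.locs (Λ : Set (Library Tid Call Val Node ALoc)) (G : Plain Tid Call Val) : Set ALoc :=
  {x | ∃ e ∈ G.E, ∃ L ∈ Λ, e.call ∈ L.methods ∧ x ∈ L.loc e.call}

/-- Locations that a program over the libraries `Λ` can access. -/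
def progLoc (Λ : Set (Library Tid Call Val Node ALoc)) (p : Prog Tid Call Val) : Set ALoc :=
  {x | ∃ v G, ConcSem p v G ∧ x ∈ G.locs Λ}

/-- Locations that an implementation of `L` over the libraries `Λ` can access. -/
def implLoc (Λ : Set (Library Tid Call Val Node ALoc)) (L : Library Tid Call Val Node ALoc)
    (I : Tid → Call → SeqProg Call Val) : Set ALoc :=
  {x | ∃ t, ∃ c ∈ L.methods, ∃ r G, Sem t (I t c) r G ∧ x ∈ G.locs Λ}

end Framework

/-! ## The method calls of the three libraries -/

/-- Method calls of the RDMA library with waits and remote read-modify-writes. -/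
inductive RCall (Node Loc Val Wid : Type*) where
  | write (x : Loc) (v : Val)
  | read (x : Loc)
  | cas (x : Loc) (v₁ v₂ : Val)
  | mfence
  /-- copy the remote location `y` into the local location `x` -/
  | get (x y : Loc) (d : Wid)
  /-- copy the local location `y` into the remote location `x` -/
  | put (x y : Loc) (d : Wid)
  | wait (d : Wid)
  | rfence (n : Node)
  /-- compare-and-swap on the remote location `y`, old value written to the local location `x` -/
  | rcas (x y : Loc) (v₁ v₂ : Val) (d : Wid)
  /-- fetch-and-add on the remote location `y`, old value written to the local location `x` -/
  | rfaa (x y : Loc) (v : Val) (d : Wid)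

/-- Method calls of the node lock library. -/
inductive NCall (Lock : Type*) where
  | acq (l : Lock)
  | rel (l : Lock)

/-- Method calls of the sequentially consistent library. -/
inductive SCall (SLoc Val : Type*) where
  | write (x : SLoc) (v : Val)
  | read (x : SLoc)
  | cas (x : SLoc) (v₁ v₂ : Val)
  | faa (x : SLoc) (v : Val)

/-- All method calls; `other` are the calls of further libraries. -/
inductive Call (Node Loc Lock SLoc Val Wid Other : Type*) where
  | rdma (c : RCall Node Loc Val Wid)
  | nlock (c : NCall Lock)
  | sc (c : SCall SLoc Val)
  | other (o : Other)

/-- All locations: RDMA locations, node locks, abstract locations of the sequentially consistent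
library, and locations of further libraries. -/
inductive ALoc (Loc Lock SLoc OLoc : Type*) where
  | rdma (x : Loc)
  | lock (l : Lock)
  | sc (x : SLoc)
  | other (o : OLoc)

/-- The network: the node of each thread, RDMA location and node lock; and the value returned by
methods without a result. -/
structure Network (Tid Node Loc Lock Val : Type*) where
  threadNode : Tid → Node
  locNode : Loc → Node
  lockNode : Lock → Node
  unit : Val

section Memory

/-! ## Reads and writes -/

variable {S ALoc Val : Type*}

/-- Strict total order on a set. -/
def StrictTotalOn (A : Set S) (r : S → S → Prop) : Prop :=
  (∀ a b, r a b → a ∈ A ∧ b ∈ A) ∧ (∀ a, ¬ r a a) ∧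
  (∀ a b c, r a b → r b c → r a c) ∧ (∀ a ∈ A, ∀ b ∈ A, a ≠ b → r a b ∨ r b a)

/-- The constraints on reads-from and modification order, for read subevents `R`, write subevents
`W`, their locations, and the values read and written. -/
def RfMoWF [Zero Val] (R W : Set S) (loc : S → Set ALoc) (vR vW : S → Val)
    (rf mo : S → S → Prop) : Prop :=
  (∀ w r, rf w r → w ∈ W ∧ r ∈ R ∧ loc w = loc r ∧ vW w = vR r) ∧
  (∀ w₁ w₂ r, rf w₁ r → rf w₂ r → w₁ = w₂) ∧
  (∀ r ∈ R, (∀ w, ¬ rf w r) → vR r = 0) ∧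
  (∃ mox : ALoc → S → S → Prop,
    (∀ x, StrictTotalOn {w | w ∈ W ∧ loc w = {x}} (mox x)) ∧
    (∀ w₁ w₂, mo w₁ w₂ ↔ ∃ x, mox x w₁ w₂))

/-- Reads-before. -/
def readsBefore (R W : Set S) (loc : S → Set ALoc) (rf mo : S → S → Prop) (r w : S) : Prop :=
  r ∈ R ∧ w ∈ W ∧ ((∃ w₀, rf w₀ r ∧ mo w₀ w) ∨ (∀ w₀, ¬ rf w₀ r)) ∧ loc r = loc w ∧ r ≠ w

end Memory

section Libraries

variable {Tid Node Loc Lock SLoc Val Wid Other OLoc : Type*}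

/-! ## The RDMA library -/

/-- Locations of a call. -/
def RCall.loc : RCall Node Loc Val Wid → Set Loc
  | .write x _ => {x}
  | .read x => {x}
  | .cas x _ _ => {x}
  | .mfence => ∅
  | .get x y _ => {x, y}
  | .put x y _ => {x, y}
  | .wait _ => ∅
  | .rfence _ => ∅
  | .rcas x y _ _ _ => {x, y}
  | .rfaa x y _ _ => {x, y}

/-- Locations of a subevent. -/
def RCall.subLoc : RCall Node Loc Val Wid → Stamp Node → Set Loc
  | .write x _, _ => {x}
  | .read x, _ => {x}
  | .cas x _ _, _ => {x}
  | .get _ y _, .nrR _ => {y}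
  | .get x _ _, .nlW _ => {x}
  | .put _ y _, .nlR _ => {y}
  | .put x _ _, .nrW _ => {x}
  | .rcas _ y _ _ _, .narR _ => {y}
  | .rcas _ y _ _ _, .nrW _ => {y}
  | .rcas x _ _ _ _, .nlW _ => {x}
  | .rfaa _ y _ _, .narR _ => {y}
  | .rfaa _ y _ _, .nrW _ => {y}
  | .rfaa x _ _ _, .nlW _ => {x}
  | _, _ => ∅

/-- The work identifier of a call, if any. -/
def RCall.wid : RCall Node Loc Val Wid → Option Wid
  | .get _ _ d => some d
  | .put _ _ d => some d
  | .wait d => some d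
  | .rcas _ _ _ _ d => some d
  | .rfaa _ _ _ d => some d
  | _ => none

/-- The location that a call by a thread of node `n` needs to be local is on node `n`. -/
def RCall.addressed (N : Network Tid Node Loc Lock Val) (n : Node) :
    RCall Node Loc Val Wid → Prop
  | .write x _ => N.locNode x = n
  | .read x => N.locNode x = n
  | .cas x _ _ => N.locNode x = n
  | .mfence => True
  | .get x _ _ => N.locNode x = n
  | .put _ y _ => N.locNode y = n
  | .wait _ => True
  | .rfence _ => True
  | .rcas x _ _ _ _ => N.locNode x = n
  | .rfaa x _ _ _ => N.locNode x = n

/-- Calls without a result return the unit value. -/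
def RCall.typed (N : Network Tid Node Loc Lock Val) : RCall Node Loc Val Wid → Val → Prop
  | .read _, _ => True
  | .cas _ _ _, _ => True
  | _, v => v = N.unit

/-- The valid sets of stamps of a call with a given output. -/
def RCall.stamps (N : Network Tid Node Loc Lock Val) :
    RCall Node Loc Val Wid → Val → Set (Set (Stamp Node))
  | .write _ _, _ => {{.aCW}}
  | .read _, _ => {{.aCR}}
  | .cas _ v₁ _, v => {A | (v₁ ≠ v ∧ A = {.aMF, .aCR}) ∨ (v₁ = v ∧ A = {.aCAS})}
  | .mfence, _ => {{.aMF}}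
  | .get _ y _, _ => {{.nrR (N.locNode y), .nlW (N.locNode y)}}
  | .put x _ _, _ => {{.nlR (N.locNode x), .nrW (N.locNode x)}}
  | .wait _, _ => {{.aWT}}
  | .rfence n, _ => {{.nF n}}
  | .rcas _ y _ _ _, _ =>
      {{.narR (N.locNode y), .nlW (N.locNode y)},
       {.narR (N.locNode y), .nrW (N.locNode y), .nlW (N.locNode y)}}
  | .rfaa _ y _ _, _ => {{.narR (N.locNode y), .nrW (N.locNode y), .nlW (N.locNode y)}}

namespace Rdma

/-- Executions over all method calls, and their events and subevents. -/
abbrev Ev (Tid Node Loc Lock SLoc Val Wid Other : Type*) :=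
  Event Tid (Call Node Loc Lock SLoc Val Wid Other) Val

abbrev SEv (Tid Node Loc Lock SLoc Val Wid Other : Type*) :=
  SubEvent Tid (Call Node Loc Lock SLoc Val Wid Other) Val Node

abbrev Ex (Tid Node Loc Lock SLoc Val Wid Other : Type*) :=
  Exec Tid (Call Node Loc Lock SLoc Val Wid Other) Val Node

/-- Read subevents. -/
def reads (G : Ex Tid Node Loc Lock SLoc Val Wid Other) :
    Set (SEv Tid Node Loc Lock SLoc Val Wid Other) :=
  {s | s ∈ G.SE ∧ (s.2 = .aCR ∨ s.2 = .aCAS ∨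
    ∃ n, s.2 = .nlR n ∨ s.2 = .narR n ∨ s.2 = .nrR n)}

/-- Write subevents. -/
def writes (G : Ex Tid Node Loc Lock SLoc Val Wid Other) :
    Set (SEv Tid Node Loc Lock SLoc Val Wid Other) :=
  {s | s ∈ G.SE ∧ (s.2 = .aCW ∨ s.2 = .aCAS ∨ ∃ n, s.2 = .nlW n ∨ s.2 = .nrW n)}

/-- Instantaneous subevents. -/
def inst (G : Ex Tid Node Loc Lock SLoc Val Wid Other) :
    Set (SEv Tid Node Loc Lock SLoc Val Wid Other) :=
  {s | s ∈ G.SE ∧ s.2 ≠ .aCW ∧ ∀ n, s.2 ≠ .nlW n ∧ s.2 ≠ .nrW n}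

/-- Locations of a subevent of the RDMA library. -/
def loc (s : SEv Tid Node Loc Lock SLoc Val Wid Other) : Set Loc :=
  match s.1.call with
  | .rdma c => c.subLoc s.2
  | _ => ∅

/-- Events of the same thread in program order that carry the same work identifier. -/
def poWid (G : Ex Tid Node Loc Lock SLoc Val Wid Other)
    (e₁ e₂ : Ev Tid Node Loc Lock SLoc Val Wid Other) : Prop :=
  G.po e₁ e₂ ∧ ∃ c₁ c₂ d, e₁.call = .rdma c₁ ∧ e₂.call = .rdma c₂ ∧
    c₁.wid = some d ∧ c₂.wid = some d

/-- The remote read-modify-writes towards `n`. -/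
def IsRrmw (N : Network Tid Node Loc Lock Val) (n : Node)
    (e : Ev Tid Node Loc Lock SLoc Val Wid Other) : Prop :=
  (∃ x y v₁ v₂ d, e.call = .rdma (.rcas x y v₁ v₂ d) ∧ N.locNode y = n) ∨
  (∃ x y v d, e.call = .rdma (.rfaa x y v d) ∧ N.locNode y = n)

/-- The auxiliary functions and relations of an RDMA execution: values read and written,
reads-from, modification order, NIC flush order, remote atomic order. -/
structure Witness (Tid Node Loc Lock SLoc Val Wid Other : Type*) where
  vR : SEv Tid Node Loc Lock SLoc Val Wid Other → Val
  vW : SEv Tid Node Loc Lock SLoc Val Wid Other → Val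
  rf : SEv Tid Node Loc Lock SLoc Val Wid Other → SEv Tid Node Loc Lock SLoc Val Wid Other → Prop
  mo : SEv Tid Node Loc Lock SLoc Val Wid Other → SEv Tid Node Loc Lock SLoc Val Wid Other → Prop
  nfo : SEv Tid Node Loc Lock SLoc Val Wid Other → SEv Tid Node Loc Lock SLoc Val Wid Other → Prop
  rao : SEv Tid Node Loc Lock SLoc Val Wid Other → SEv Tid Node Loc Lock SLoc Val Wid Other → Prop

/-- Well-formedness of the auxiliary functions and relations. -/
structure Witness.WF [Zero Val] [Add Val] (N : Network Tid Node Loc Lock Val)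
    (G : Ex Tid Node Loc Lock SLoc Val Wid Other)
    (X : Witness Tid Node Loc Lock SLoc Val Wid Other) : Prop where
  vR_read : ∀ s ∈ reads G, ∀ x, s.1.call = .rdma (.read x) → X.vR s = s.1.out
  vR_cas : ∀ s ∈ reads G, ∀ x v₁ v₂, s.1.call = .rdma (.cas x v₁ v₂) → X.vR s = s.1.out
  vW_write : ∀ s ∈ writes G, ∀ x v, s.1.call = .rdma (.write x v) → X.vW s = v
  vW_cas : ∀ s ∈ writes G, ∀ x v, s.1.call = .rdma (.cas x s.1.out v) → X.vW s = v
  copy_put : ∀ e n, (e, .nlR n) ∈ G.SE → (e, .nrW n) ∈ G.SE → X.vR (e, .nlR n) = X.vW (e, .nrW n)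
  copy_get : ∀ e n, (e, .nrR n) ∈ G.SE → (e, .nlW n) ∈ G.SE → X.vR (e, .nrR n) = X.vW (e, .nlW n)
  copy_rmw : ∀ e n, (e, .narR n) ∈ G.SE → (e, .nlW n) ∈ G.SE →
    X.vR (e, .narR n) = X.vW (e, .nlW n)
  rf_mo : RfMoWF (reads G) (writes G) loc X.vR X.vW X.rf X.mo
  nfo_mem : ∀ s₁ s₂, X.nfo s₁ s₂ → s₁ ∈ G.SE ∧ s₂ ∈ G.SE
  nfo_local : ∀ e₁ e₂ n, (e₁, .nlR n) ∈ G.SE → (e₂, .nlW n) ∈ G.SE → e₁.thread = e₂.thread →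
    X.nfo (e₁, .nlR n) (e₂, .nlW n) ∨ X.nfo (e₂, .nlW n) (e₁, .nlR n)
  nfo_remote : ∀ e₁ e₂ n, (e₁, .nrR n) ∈ G.SE → (e₂, .nrW n) ∈ G.SE → e₁.thread = e₂.thread →
    X.nfo (e₁, .nrR n) (e₂, .nrW n) ∨ X.nfo (e₂, .nrW n) (e₁, .nrR n)
  nfo_atomic : ∀ e₁ e₂ n, (e₁, .narR n) ∈ G.SE → (e₂, .nrW n) ∈ G.SE → e₁.thread = e₂.thread →
    X.nfo (e₁, .narR n) (e₂, .nrW n) ∨ X.nfo (e₂, .nrW n) (e₁, .narR n)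
  rcas_fail : ∀ e ∈ G.E, ∀ x y v₁ v₂ d, e.call = .rdma (.rcas x y v₁ v₂ d) →
    G.stmp e = {.narR (N.locNode y), .nlW (N.locNode y)} →
    X.vR (e, .narR (N.locNode y)) ≠ v₁
  rcas_succ : ∀ e ∈ G.E, ∀ x y v₁ v₂ d, e.call = .rdma (.rcas x y v₁ v₂ d) →
    G.stmp e = {.narR (N.locNode y), .nrW (N.locNode y), .nlW (N.locNode y)} →
    X.vR (e, .narR (N.locNode y)) = v₁ ∧ X.vW (e, .nrW (N.locNode y)) = v₂
  rfaa : ∀ e ∈ G.E, ∀ x y v d, e.call = .rdma (.rfaa x y v d) →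
    X.vW (e, .nrW (N.locNode y)) = X.vR (e, .narR (N.locNode y)) + v
  rao_total : ∃ raon : Node → SEv Tid Node Loc Lock SLoc Val Wid Other →
      SEv Tid Node Loc Lock SLoc Val Wid Other → Prop,
    (∀ n, StrictTotalOn {s | s ∈ G.SE ∧ s.2 = .narR n ∧ IsRrmw N n s.1} (raon n)) ∧
    (∀ s₁ s₂, X.rao s₁ s₂ ↔ ∃ n, raon n s₁ s₂)

section Relations

variable (G : Ex Tid Node Loc Lock SLoc Val Wid Other)
  (X : Witness Tid Node Loc Lock SLoc Val Wid Other)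
  (s₁ s₂ : SEv Tid Node Loc Lock SLoc Val Wid Other)

/-- Reads-before. -/
def rb : Prop := readsBefore (reads G) (writes G) loc X.rf X.mo s₁ s₂

/-- Internal reads-before. -/
def rbi : Prop :=
  s₁.2 = .aCR ∧ s₂.2 = .aCW ∧ (G.po s₁.1 s₂.1 ∨ G.po s₂.1 s₁.1) ∧ rb G X s₁ s₂

/-- Internal reads-from. -/
def rfi : Prop := s₁.2 = .aCW ∧ s₂.2 = .aCR ∧ G.po s₁.1 s₂.1 ∧ X.rf s₁ s₂

/-- External reads-from. -/
def rfe : Prop := X.rf s₁ s₂ ∧ ¬ rfi G X s₁ s₂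

/-- Synchronisation of a NIC local write with a later wait. -/
def pfg : Prop :=
  s₁ ∈ G.SE ∧ s₂ ∈ G.SE ∧ (∃ n, s₁.2 = .nlW n) ∧ s₂.2 = .aWT ∧ poWid G s₁.1 s₂.1

/-- Synchronisation of a NIC remote write with a later wait. -/
def pfp : Prop :=
  s₁ ∈ G.SE ∧ s₂ ∈ G.SE ∧ (∃ n, s₁.2 = .nrW n) ∧ s₂.2 = .aWT ∧ poWid G s₁.1 s₂.1

/-- Internal synchronisation order: between subevents of the same event. -/
def iso : Prop :=
  s₁ ∈ G.SE ∧ s₂ ∈ G.SE ∧ s₁.1 = s₂.1 ∧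
  (((∃ x v₁ v₂, s₁.1.call = .rdma (.cas x v₁ v₂)) ∧ s₁.2 = .aMF ∧ s₂.2 = .aCR) ∨
   ((∃ x y d, s₁.1.call = .rdma (.get x y d)) ∧ ∃ n, s₁.2 = .nrR n ∧ s₂.2 = .nlW n) ∨
   ((∃ x y d, s₁.1.call = .rdma (.put x y d)) ∧ ∃ n, s₁.2 = .nlR n ∧ s₂.2 = .nrW n) ∨
   (((∃ x y v₁ v₂ d, s₁.1.call = .rdma (.rcas x y v₁ v₂ d)) ∨
      (∃ x y v d, s₁.1.call = .rdma (.rfaa x y v d))) ∧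
    ∃ n, s₁.2 = .narR n ∧ (s₂.2 = .nlW n ∨ s₂.2 = .nrW n)))

/-- Program order whose starting points are preserved. -/
def ippo : Prop :=
  G.ppo s₁ s₂ ∨
  (s₁ ∈ G.SE ∧ s₂ ∈ G.SE ∧ G.po s₁.1 s₂.1 ∧
    ((s₁.2 = .aCW ∧ (s₂.2 = .aCR ∨ s₂.2 = .aWT)) ∨
     ∃ n, (s₁.2 = .nrW n ∨ s₁.2 = .nlW n) ∧ s₂.2 = .nF n))

/-- Issued-before. -/
def ib : Prop :=
  Relation.TransGen (fun a b => ippo G a b ∨ iso G a b ∨ X.rf a b ∨ pfg G a b ∨ pfp G a b ∨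
    X.nfo a b ∨ rbi G X a b) s₁ s₂

/-- The synchronisation order that the RDMA library prescribes. -/
def soSpec : Prop :=
  iso G s₁ s₂ ∨ rfe G X s₁ s₂ ∨ pfg G s₁ s₂ ∨ X.nfo s₁ s₂ ∨ rb G X s₁ s₂ ∨ X.mo s₁ s₂ ∨
  X.rao s₁ s₂ ∨
  ((∃ n, s₁.2 = .nrW n) ∧ ∃ s, iso G s s₁ ∧ X.rao s s₂) ∨
  (s₁ ∈ inst G ∧ ib G X s₁ s₂)

end Relations

/-- Consistency for the RDMA library. -/
def Cons [Zero Val] [Add Val] (N : Network Tid Node Loc Lock Val)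
    (G : Ex Tid Node Loc Lock SLoc Val Wid Other) : Prop :=
  (∀ e ∈ G.E, ∃ c, e.call = .rdma c ∧ c.addressed N (N.threadNode e.thread) ∧
    c.typed N e.out ∧ G.stmp e ∈ c.stamps N e.out) ∧
  ∃ X : Witness Tid Node Loc Lock SLoc Val Wid Other, X.WF N G ∧
    (∀ s, ¬ ib G X s s) ∧ (∀ s₁ s₂, G.so s₁ s₂ ↔ soSpec G X s₁ s₂)

end Rdma

/-- The RDMA library with waits and remote read-modify-writes. -/
def rdmaLib [Zero Val] [Add Val] (N : Network Tid Node Loc Lock Val) :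
    Library Tid (Call Node Loc Lock SLoc Val Wid Other) Val Node (ALoc Loc Lock SLoc OLoc) where
  methods := Set.range Call.rdma
  loc := fun
    | .rdma c => ALoc.rdma '' c.loc
    | _ => ∅
  cons := {G | Rdma.Cons N G}

/-! ## The node lock library -/

namespace NLock

/-- The acquisitions of the lock `l`. -/
def acqs (G : Plain Tid (Call Node Loc Lock SLoc Val Wid Other) Val) (l : Lock) :
    Set (Rdma.Ev Tid Node Loc Lock SLoc Val Wid Other) :=
  {e | e ∈ G.E ∧ e.call = .nlock (.acq l)}

/-- The releases of the lock `l`. -/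
def rels (G : Plain Tid (Call Node Loc Lock SLoc Val Wid Other) Val) (l : Lock) :
    Set (Rdma.Ev Tid Node Loc Lock SLoc Val Wid Other) :=
  {e | e ∈ G.E ∧ e.call = .nlock (.rel l)}

/-- Immediate program order between the node lock events on `l`. -/
def immPo (G : Plain Tid (Call Node Loc Lock SLoc Val Wid Other) Val) (l : Lock)
    (e₁ e₂ : Rdma.Ev Tid Node Loc Lock SLoc Val Wid Other) : Prop :=
  e₁ ∈ acqs G l ∪ rels G l ∧ e₂ ∈ acqs G l ∪ rels G l ∧ G.po e₁ e₂ ∧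
    ¬ ∃ e ∈ acqs G l ∪ rels G l, G.po e₁ e ∧ G.po e e₂

/-- Node locks are used in a well-formed fashion: in program order, the next event on a lock after
an acquisition is a release, and the last event on a lock before a release is an acquisition. -/
def LockWF (G : Plain Tid (Call Node Loc Lock SLoc Val Wid Other) Val) : Prop :=
  ∀ l, (∀ a ∈ acqs G l, ∃ r ∈ rels G l, immPo G l a r) ∧
    (∀ r ∈ rels G l, ∃ a ∈ acqs G l, immPo G l a r)

/-- Consistency for the node lock library. Any behaviour is allowed for executions that are not
lock-well-formed. -/
def Cons (N : Network Tid Node Loc Lock Val)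
    (G : Rdma.Ex Tid Node Loc Lock SLoc Val Wid Other) : Prop :=
  LockWF G.toPlain →
    (∀ e ∈ G.E, e.out = N.unit ∧ ∃ l,
      (e.call = .nlock (.acq l) ∧ G.stmp e = {.aMF}) ∨
      (e.call = .nlock (.rel l) ∧ G.stmp e = {.nF (N.lockNode l), .nrW (N.lockNode l)})) ∧
    ∃ lo : Lock → Rdma.Ev Tid Node Loc Lock SLoc Val Wid Other →
        Rdma.Ev Tid Node Loc Lock SLoc Val Wid Other → Prop,
      (∀ l, StrictTotalOn (acqs G.toPlain l) (lo l)) ∧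
      ∀ s₁ s₂, G.so s₁ s₂ ↔ ∃ l,
        (s₁.1 ∈ rels G.toPlain l ∧ s₂.1 = s₁.1 ∧
          s₁.2 = .nF (N.lockNode l) ∧ s₂.2 = .nrW (N.lockNode l)) ∨
        (s₁.2 = .nrW (N.lockNode l) ∧ s₂.2 = .aMF ∧
          ∃ a, immPo G.toPlain l a s₁.1 ∧ lo l a s₂.1)

end NLock

/-- The node lock library. -/
def nlockLib (N : Network Tid Node Loc Lock Val) :
    Library Tid (Call Node Loc Lock SLoc Val Wid Other) Val Node (ALoc Loc Lock SLoc OLoc) where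
  methods := Set.range Call.nlock
  loc := fun
    | .nlock (.acq l) => {.lock l}
    | .nlock (.rel l) => {.lock l}
    | _ => ∅
  cons := {G | NLock.Cons N G}

/-! ## The sequentially consistent library -/

/-- The location of a call. -/
def SCall.loc : SCall SLoc Val → SLoc
  | .write x _ => x
  | .read x => x
  | .cas x _ _ => x
  | .faa x _ => x

namespace SC

/-- Read subevents: all but those of writes. -/
def reads (G : Rdma.Ex Tid Node Loc Lock SLoc Val Wid Other) :
    Set (Rdma.SEv Tid Node Loc Lock SLoc Val Wid Other) :=
  {s | s.1 ∈ G.E ∧ s.2 = .aMF ∧ ¬ ∃ x v, s.1.call = .sc (.write x v)}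

/-- Write subevents: all but those of reads and of failed compare-and-swaps. -/
def writes (G : Rdma.Ex Tid Node Loc Lock SLoc Val Wid Other) :
    Set (Rdma.SEv Tid Node Loc Lock SLoc Val Wid Other) :=
  {s | s.1 ∈ G.E ∧ s.2 = .aMF ∧ (¬ ∃ x, s.1.call = .sc (.read x)) ∧
    ¬ ∃ x v₁ v₂, s.1.call = .sc (.cas x v₁ v₂) ∧ v₁ ≠ s.1.out}

/-- Location of a subevent. -/
def loc (s : Rdma.SEv Tid Node Loc Lock SLoc Val Wid Other) : Set SLoc :=
  match s.1.call with
  | .sc c => {c.loc}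
  | _ => ∅

/-- Consistency for the sequentially consistent library. -/
def Cons [Zero Val] [Add Val] (N : Network Tid Node Loc Lock Val)
    (G : Rdma.Ex Tid Node Loc Lock SLoc Val Wid Other) : Prop :=
  (∀ e ∈ G.E, (∃ c, e.call = .sc c) ∧ G.stmp e = {.aMF} ∧
    ∀ x v, e.call = .sc (.write x v) → e.out = N.unit) ∧
  ∃ (vR vW : Rdma.SEv Tid Node Loc Lock SLoc Val Wid Other → Val)
    (rf mo : Rdma.SEv Tid Node Loc Lock SLoc Val Wid Other →
      Rdma.SEv Tid Node Loc Lock SLoc Val Wid Other → Prop),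
    (∀ s ∈ reads G, vR s = s.1.out) ∧
    (∀ s ∈ writes G,
      (∀ x v, s.1.call = .sc (.write x v) → vW s = v) ∧
      (∀ x v, s.1.call = .sc (.cas x s.1.out v) → vW s = v) ∧
      (∀ x v, s.1.call = .sc (.faa x v) → vW s = v + s.1.out)) ∧
    RfMoWF (reads G) (writes G) loc vR vW rf mo ∧
    ∀ s₁ s₂, G.so s₁ s₂ ↔
      ((s₁ ∈ G.SE ∧ s₂ ∈ G.SE ∧ G.po s₁.1 s₂.1) ∨ rf s₁ s₂ ∨ mo s₁ s₂ ∨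
        readsBefore (reads G) (writes G) loc rf mo s₁ s₂)

end SC

/-- The sequentially consistent library. -/
def scLib [Zero Val] [Add Val] (N : Network Tid Node Loc Lock Val) :
    Library Tid (Call Node Loc Lock SLoc Val Wid Other) Val Node (ALoc Loc Lock SLoc OLoc) where
  methods := Set.range Call.sc
  loc := fun
    | .sc c => {.sc c.loc}
    | _ => ∅
  cons := {G | SC.Cons N G}

/-! ## The implementation of the sequentially consistent library -/

/-- The resources of the implementation: for each abstract location `x` an RDMA location `data x`
and a node lock `lock x` on the same node; for each thread `t` a private location `res t` for the
values it reads, and private locations `tmp x t` for the values it puts; and arbitrary work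
identifiers. The RDMA locations are pairwise distinct. -/
structure Alloc (N : Network Tid Node Loc Lock Val) (SLoc Wid : Type*) where
  data : SLoc → Loc
  lock : SLoc → Lock
  res : Tid → Loc
  tmp : SLoc → Tid → Loc
  wid : Tid → Wid
  putWid : Tid → Wid
  lock_node : ∀ x, N.lockNode (lock x) = N.locNode (data x)
  res_node : ∀ t, N.locNode (res t) = N.threadNode t
  tmp_node : ∀ x t, N.locNode (tmp x t) = N.threadNode t
  data_inj : Function.Injective data
  res_inj : Function.Injective res
  tmp_inj : ∀ x t x' t', tmp x t = tmp x' t' → x = x' ∧ t = t'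
  data_ne_res : ∀ x t, data x ≠ res t
  data_ne_tmp : ∀ x y t, data x ≠ tmp y t
  res_ne_tmp : ∀ t x t', res t ≠ tmp x t'

/-- The implementation of the sequentially consistent library. -/
def scImpl {N : Network Tid Node Loc Lock Val} (A : Alloc N SLoc Wid) (t : Tid) :
    Call Node Loc Lock SLoc Val Wid Other →
      SeqProg (Call Node Loc Lock SLoc Val Wid Other) Val
  | .sc (.write x v) =>
      .seq (.call (.nlock (.acq (A.lock x)))) <|
      .seq (.call (.rdma (.write (A.tmp x t) v))) <|
      .seq (.call (.rdma (.put (A.data x) (A.tmp x t) (A.putWid t)))) <|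
      .call (.nlock (.rel (A.lock x)))
  | .sc (.read x) =>
      .seq (.call (.nlock (.acq (A.lock x)))) <|
      .seq (.call (.rdma (.get (A.res t) (A.data x) (A.wid t)))) <|
      .seq (.call (.nlock (.rel (A.lock x)))) <|
      .seq (.call (.rdma (.wait (A.wid t)))) <|
      .call (.rdma (.read (A.res t)))
  | .sc (.cas x v₁ v₂) =>
      .seq (.call (.nlock (.acq (A.lock x)))) <|
      .seq (.call (.rdma (.rcas (A.res t) (A.data x) v₁ v₂ (A.wid t)))) <|
      .seq (.call (.nlock (.rel (A.lock x)))) <|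
      .seq (.call (.rdma (.wait (A.wid t)))) <|
      .call (.rdma (.read (A.res t)))
  | .sc (.faa x v) =>
      .seq (.call (.nlock (.acq (A.lock x)))) <|
      .seq (.call (.rdma (.rfaa (A.res t) (A.data x) v (A.wid t)))) <|
      .seq (.call (.nlock (.rel (A.lock x)))) <|
      .seq (.call (.rdma (.wait (A.wid t)))) <|
      .call (.rdma (.read (A.res t)))
  | c => .call c

end Libraries

end Mowgli

open Mowgli

namespace Mowgli

/-! ## Plain executions of programs -/

section Plain

variable {Tid Call Val : Type*}

/-! An execution of the implementation is folded into an execution of `p`. By induction on the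
program (`Sem.abstract`), its events split into blocks, one for each abstract event, and program
order between distinct blocks is the abstract program order (`Refines`). It remains to equip the
abstract plain execution with a synchronisation order and a happens-before that all libraries
accept; this is `absExec`.

An abstract SC call is represented by its lock acquisition. Both carry the single stamp `aMF`, so
happens-before can be pulled back along `firstEvent`: it then contains preserved program order, and
transitivity and irreflexivity are inherited. The substantial claim is that the synchronisation
prescribed by the SC library holds between acquisitions (`Concrete.scSo_hb`). Reads-from,
modification order and reads-before are pulled back from the accesses to `A.data x`, where they are
concrete synchronisation edges. The lock orders the critical sections of one location totally, from
the `nrW` of a release to the `aMF` of an acquisition, and the protected subevents of an access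
precede its release (`hb_acc_rel`). An edge between two accesses against this order would close a
cycle, so every such edge is matched by one between the acquisitions (`hb_acq_of_hb_acc`).

Values are determined by `rf_of_hb`: a read must read from a write that happens before it when every
other write to the location is before that write or after the read. Applied to the private location
`A.res t`, where the wait completes the NIC local write, this identifies the output of a call with
the value its access reads (`vR_acc`). Applied to `A.tmp x t`, it shows that a put sends the
intended value (`vW_acc_write`); no wait is needed there, because the next write to `A.tmp x t`
follows an acquisition of the same lock. The success of a compare-and-swap can then be read off from
its stamps (`acc_nrW_cas`).

For the client part, disjointness of locations means that no client read reads from the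
implementation. Hence restricting the RDMA witness to client events creates no new reads-before
edges, and the restricted relations stay inside the original ones (`IsRestriction.soSpec`). Lock
orders are restricted likewise (`nlock_cons`), and further libraries see literally the same
execution (`other_restrict`). `mem_outcome` assembles these facts. Well-formed use of locks by the
client passes to the implementation (`Layout.lockWF`), which reduces the first claim of the theorem
to the second. -/

theorem Plain.IsPlain.left_mem {G : Plain Tid Call Val} (h : G.IsPlain) {e₁ e₂}
    (hp : G.po e₁ e₂) : e₁ ∈ G.E := (h.1 _ _ hp).1

theorem Plain.IsPlain.right_mem {G : Plain Tid Call Val} (h : G.IsPlain) {e₁ e₂}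
    (hp : G.po e₁ e₂) : e₂ ∈ G.E := (h.1 _ _ hp).2.1

theorem Plain.IsPlain.trans {G : Plain Tid Call Val} (h : G.IsPlain) {e₁ e₂ e₃}
    (hp : G.po e₁ e₂) (hq : G.po e₂ e₃) : G.po e₁ e₃ := h.2.2.1 _ _ _ hp hq

theorem Plain.IsPlain.ne {G : Plain Tid Call Val} (h : G.IsPlain) {e₁ e₂}
    (hp : G.po e₁ e₂) : e₁ ≠ e₂ := by
  rintro rfl; exact h.2.1 _ hp

theorem Plain.isPlain_empty : (Plain.empty : Plain Tid Call Val).IsPlain := by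
  simp [Plain.IsPlain, Plain.empty]

theorem Plain.isPlain_single (e : Event Tid Call Val) : (Plain.single e).IsPlain := by
  simp only [Plain.IsPlain, Plain.single, Set.mem_singleton_iff]
  refine ⟨by simp, by simp, by simp, ?_⟩
  rintro _ rfl _ rfl _ h
  exact absurd rfl h

theorem Plain.IsPlain.comp {G₁ G₂ : Plain Tid Call Val} {t : Tid} (h₁ : G₁.IsPlain)
    (h₂ : G₂.IsPlain) (ht₁ : ∀ e ∈ G₁.E, e.thread = t) (ht₂ : ∀ e ∈ G₂.E, e.thread = t)
    (hd : Disjoint G₁.E G₂.E) : (G₁.comp G₂).IsPlain := by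
  have hd' : ∀ e, e ∈ G₁.E → e ∈ G₂.E → False := fun e h h' => Set.disjoint_left.1 hd h h'
  refine ⟨?_, ?_, ?_, ?_⟩
  · rintro e₁ e₂ (h | h | ⟨h, h'⟩)
    · obtain ⟨a, b, c⟩ := h₁.1 _ _ h
      exact ⟨Or.inl a, Or.inl b, c⟩
    · obtain ⟨a, b, c⟩ := h₂.1 _ _ h
      exact ⟨Or.inr a, Or.inr b, c⟩
    · exact ⟨Or.inl h, Or.inr h', by rw [ht₁ _ h, ht₂ _ h']⟩
  · rintro e (h | h | ⟨h, h'⟩)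
    · exact h₁.2.1 _ h
    · exact h₂.2.1 _ h
    · exact hd' _ h h'
  · rintro a b c (h | h | ⟨h, h'⟩) (k | k | ⟨k, k'⟩)
    · exact Or.inl (h₁.trans h k)
    · exact (hd' _ (h₁.right_mem h) (h₂.left_mem k)).elim
    · exact Or.inr (Or.inr ⟨h₁.left_mem h, k'⟩)
    · exact (hd' _ (h₁.left_mem k) (h₂.right_mem h)).elim
    · exact Or.inr (Or.inl (h₂.trans h k))
    · exact (hd' _ k (h₂.right_mem h)).elim
    · exact (hd' _ (h₁.left_mem k) h').elim
    · exact Or.inr (Or.inr ⟨h, h₂.right_mem k⟩)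
    · exact (hd' _ k h').elim
  · rintro a (ha | ha) b (hb | hb) hab hne
    · exact (h₁.2.2.2 a ha b hb hab hne).imp Or.inl Or.inl
    · exact Or.inl (Or.inr (Or.inr ⟨ha, hb⟩))
    · exact Or.inr (Or.inr (Or.inr ⟨hb, ha⟩))
    · exact (h₂.2.2.2 a ha b hb hab hne).imp (Or.inr ∘ Or.inl) (Or.inr ∘ Or.inl)

theorem Sem.isPlain {t : Tid} {p : SeqProg Call Val} {r : Val × ℕ} {G : Plain Tid Call Val}
    (h : Sem t p r G) : (∀ e ∈ G.E, e.thread = t) ∧ G.IsPlain := by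
  induction h with
  | val v => exact ⟨by simp [Plain.empty], Plain.isPlain_empty⟩
  | brk k v => exact ⟨by simp [Plain.empty], Plain.isPlain_empty⟩
  | call c i v => exact ⟨by simp [Plain.single], Plain.isPlain_single _⟩
  | letIn _ _ hd ih₁ ih₂ =>
    exact ⟨fun e he => he.elim (ih₁.1 e) (ih₂.1 e), ih₁.2.comp ih₂.2 ih₁.1 ih₂.1 hd⟩
  | letBrk _ _ ih => exact ih
  | loopStep _ _ hd ih₁ ih₂ =>
    exact ⟨fun e he => he.elim (ih₁.1 e) (ih₂.1 e), ih₁.2.comp ih₂.2 ih₁.1 ih₂.1 hd⟩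
  | loopExit _ ih => exact ih

theorem Plain.IsPlain.par {H : Tid → Plain Tid Call Val} (h : ∀ t, (H t).IsPlain)
    (ht : ∀ t, ∀ e ∈ (H t).E, e.thread = t) : (Plain.par H).IsPlain := by
  refine ⟨?_, ?_, ?_, ?_⟩
  · rintro e₁ e₂ ⟨t, hp⟩
    obtain ⟨a, b, c⟩ := (h t).1 _ _ hp
    exact ⟨⟨t, a⟩, ⟨t, b⟩, c⟩
  · rintro e ⟨t, hp⟩
    exact (h t).2.1 _ hp
  · rintro a b c ⟨t, hp⟩ ⟨t', hq⟩
    obtain rfl : t = t' := by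
      rw [← ht _ _ ((h t).right_mem hp), ← ht _ _ ((h t').left_mem hq)]
    exact ⟨t, (h t).trans hp hq⟩
  · rintro a ⟨t, ha⟩ b ⟨t', hb⟩ hab hne
    obtain rfl : t = t' := by rw [← ht _ _ ha, ← ht _ _ hb, hab]
    exact ((h t).2.2.2 a ha b hb hab hne).imp (fun h => ⟨t, h⟩) (fun h => ⟨t, h⟩)

theorem ConcSem.isPlain {p : Prog Tid Call Val} {v : Tid → Val} {G : Plain Tid Call Val}
    (h : ConcSem p v G) : G.IsPlain := by
  obtain ⟨H, hH, rfl⟩ := h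
  exact Plain.IsPlain.par (fun t => (hH t).isPlain.2) (fun t => (hH t).isPlain.1)

theorem Sem.call_inv {t : Tid} {c : Call} {r : Val × ℕ} {G : Plain Tid Call Val}
    (h : Sem t (.call c) r G) : ∃ i v, r = (v, 0) ∧ G = Plain.single ⟨t, i, c, v⟩ := by
  cases h with
  | call c i v => exact ⟨i, v, rfl, rfl⟩

theorem Sem.seq_call_inv {t : Tid} {c : Call} {q : SeqProg Call Val} {r : Val × ℕ}
    {G : Plain Tid Call Val} (h : Sem t (.seq (.call c) q) r G) :
    ∃ i v G', Sem t q r G' ∧ G = (Plain.single ⟨t, i, c, v⟩).comp G' := by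
  cases h with
  | letIn h₁ h₂ hd =>
    obtain ⟨i, v, -, rfl⟩ := h₁.call_inv
    exact ⟨i, v, _, h₂, rfl⟩
  | letBrk h₁ hk =>
    obtain ⟨i, v, hr, -⟩ := h₁.call_inv
    exact absurd (Prod.ext_iff.1 hr).2 hk

end Plain

/-! ## Abstraction of the executions of the implementation -/

section Refinement

variable {Tid Node Loc Lock SLoc Val Wid Other OLoc : Type*}
  {N : Network Tid Node Loc Lock Val}

/-- The RDMA call by which the implementation accesses the data of an abstract location. -/
def SCall.access (A : Alloc N SLoc Wid) (t : Tid) : SCall SLoc Val → RCall Node Loc Val Wid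
  | .write x _ => .put (A.data x) (A.tmp x t) (A.putWid t)
  | .read x => .get (A.res t) (A.data x) (A.wid t)
  | .cas x v₁ v₂ => .rcas (A.res t) (A.data x) v₁ v₂ (A.wid t)
  | .faa x v => .rfaa (A.res t) (A.data x) v (A.wid t)

/-- Calls of the sequentially consistent library that write without reading. -/
def SCall.IsWrite (c : SCall SLoc Val) : Prop := ∃ x v, c = .write x v

/-- The last event of the implementation of an event of the sequentially consistent library. -/
def lastEvent (A : Alloc N SLoc Wid) (e : Rdma.Ev Tid Node Loc Lock SLoc Val Wid Other) :
    Rdma.Ev Tid Node Loc Lock SLoc Val Wid Other :=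
  match e.call with
  | .sc (.write x _) => { e with call := .nlock (.rel (A.lock x)) }
  | .sc _ => { e with call := .rdma (.read (A.res e.thread)) }
  | _ => e

/-- `B` is the set of events of `P` that implement the abstract event `e`. -/
structure Block (A : Alloc N SLoc Wid)
    (P : Plain Tid (Call Node Loc Lock SLoc Val Wid Other) Val)
    (e : Rdma.Ev Tid Node Loc Lock SLoc Val Wid Other)
    (B : Set (Rdma.Ev Tid Node Loc Lock SLoc Val Wid Other)) : Prop where
  client : (∀ c, e.call ≠ .sc c) → B = {e}
  write : ∀ x v, e.call = .sc (.write x v) → ∃ a w m,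
    a.call = .nlock (.acq (A.lock x)) ∧ w.call = .rdma (.write (A.tmp x e.thread) v) ∧
    m.call = .rdma ((SCall.write x v).access A e.thread) ∧
    P.po a w ∧ P.po w m ∧ P.po m (lastEvent A e) ∧ B = {a, w, m, lastEvent A e}
  fetch : ∀ c, e.call = .sc c → ¬ c.IsWrite → ∃ a m r q,
    a.call = .nlock (.acq (A.lock c.loc)) ∧ m.call = .rdma (c.access A e.thread) ∧
    r.call = .nlock (.rel (A.lock c.loc)) ∧ q.call = .rdma (.wait (A.wid e.thread)) ∧
    P.po a m ∧ P.po m r ∧ P.po r q ∧ P.po q (lastEvent A e) ∧ B = {a, m, r, q, lastEvent A e}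

/-- The execution `P` of the implementation refines the abstract execution `P'`; `R` relates each
event to the abstract event that it implements. -/
structure Refines (A : Alloc N SLoc Wid)
    (P P' : Plain Tid (Call Node Loc Lock SLoc Val Wid Other) Val)
    (R : Rdma.Ev Tid Node Loc Lock SLoc Val Wid Other →
      Rdma.Ev Tid Node Loc Lock SLoc Val Wid Other → Prop) : Prop where
  left_mem : ∀ e e', R e e' → e ∈ P.E
  right_mem : ∀ e e', R e e' → e' ∈ P'.E
  total : ∀ e ∈ P.E, ∃ e', R e e'
  unique : ∀ e e₁ e₂, R e e₁ → R e e₂ → e₁ = e₂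
  po_iff : ∀ e₁ e₂ e₁' e₂', R e₁ e₁' → R e₂ e₂' → e₁' ≠ e₂' → (P.po e₁ e₂ ↔ P'.po e₁' e₂')
  block : ∀ e' ∈ P'.E, Block A P e' {e | R e e'}

variable {A : Alloc N SLoc Wid} {P P' Q : Plain Tid (Call Node Loc Lock SLoc Val Wid Other) Val}

theorem Block.mono {e : Rdma.Ev Tid Node Loc Lock SLoc Val Wid Other} {B}
    (h : Block A P e B) (hpo : ∀ e₁ e₂, P.po e₁ e₂ → Q.po e₁ e₂) : Block A Q e B where
  client := h.client
  write x v he := by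
    obtain ⟨a, w, m, h₁, h₂, h₃, h₄, h₅, h₆, h₇⟩ := h.write x v he
    exact ⟨a, w, m, h₁, h₂, h₃, hpo _ _ h₄, hpo _ _ h₅, hpo _ _ h₆, h₇⟩
  fetch c he hc := by
    obtain ⟨a, m, r, q, h₁, h₂, h₃, h₄, h₅, h₆, h₇, h₈, h₉⟩ := h.fetch c he hc
    exact ⟨a, m, r, q, h₁, h₂, h₃, h₄, hpo _ _ h₅, hpo _ _ h₆, hpo _ _ h₇, hpo _ _ h₈, h₉⟩

theorem Block.last_mem {e : Rdma.Ev Tid Node Loc Lock SLoc Val Wid Other} {B}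
    (h : Block A P e B) : lastEvent A e ∈ B := by
  by_cases hc : ∀ c, e.call ≠ .sc c
  · rw [h.client hc, Set.mem_singleton_iff, lastEvent]
    split <;> simp_all
  · push Not at hc
    obtain ⟨c, hc⟩ := hc
    by_cases hw : c.IsWrite
    · obtain ⟨x, v, rfl⟩ := hw
      obtain ⟨a, w, m, -, -, -, -, -, -, rfl⟩ := h.write x v hc
      simp
    · obtain ⟨a, m, r, q, -, -, -, -, -, -, -, -, rfl⟩ := h.fetch c hc hw
      simp

theorem Refines.last {R} (h : Refines A P P' R) {e} (he : e ∈ P'.E) : R (lastEvent A e) e :=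
  (h.block e he).last_mem

/-- The reason for naming an abstract event after the last event of its block: an event common to
both abstract sets would have the same `lastEvent` in both concrete ones. This gives the freshness
that sequencing demands. -/
theorem Refines.disjoint {P₁ P₂ P₁' P₂' : Plain Tid (Call Node Loc Lock SLoc Val Wid Other) Val}
    {R₁ R₂} (h₁ : Refines A P₁ P₁' R₁) (h₂ : Refines A P₂ P₂' R₂) (hd : Disjoint P₁.E P₂.E) :
    Disjoint P₁'.E P₂'.E :=
  Set.disjoint_left.2 fun _ he he' =>
    Set.disjoint_left.1 hd (h₁.left_mem _ _ (h₁.last he)) (h₂.left_mem _ _ (h₂.last he'))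

theorem Refines.empty : Refines (Other := Other) A Plain.empty Plain.empty (fun _ _ => False) := by
  constructor <;> simp [Plain.empty]

theorem Refines.single {e : Rdma.Ev Tid Node Loc Lock SLoc Val Wid Other}
    (he : ∀ c, e.call ≠ .sc c) :
    Refines A (Plain.single e) (Plain.single e) (fun e₁ e₂ => e₁ = e ∧ e₂ = e) where
  left_mem := by simp +contextual [Plain.single]
  right_mem := by simp +contextual [Plain.single]
  total := by simp [Plain.single]
  unique := by simp +contextual
  po_iff := by simp [Plain.single]
  block := by
    rintro _ rfl
    refine ⟨fun _ => by simp, fun x v h => absurd h (he _), fun c h => absurd h (he _)⟩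

theorem Refines.of_block {e : Rdma.Ev Tid Node Loc Lock SLoc Val Wid Other}
    (h : Block A P e P.E) :
    Refines A P (Plain.single e) (fun e₁ e₂ => e₁ ∈ P.E ∧ e₂ = e) where
  left_mem := by simp +contextual
  right_mem := by simp +contextual [Plain.single]
  total := by simp
  unique := by simp +contextual
  po_iff := by
    rintro e₁ e₂ _ _ ⟨-, rfl⟩ ⟨-, rfl⟩ hne
    exact absurd rfl hne
  block := by
    rintro _ rfl
    simpa using h

/-- In the mixed cases of program order, both sides are decided by which component comes first, and
disjointness excludes the rest. -/
theorem Refines.comp {P₁ P₂ P₁' P₂' : Plain Tid (Call Node Loc Lock SLoc Val Wid Other) Val}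
    {R₁ R₂} (h₁ : Refines A P₁ P₁' R₁) (h₂ : Refines A P₂ P₂' R₂) (hd : Disjoint P₁.E P₂.E)
    (p₁ : P₁.IsPlain) (p₂ : P₂.IsPlain) (p₁' : P₁'.IsPlain) (p₂' : P₂'.IsPlain) :
    Refines A (P₁.comp P₂) (P₁'.comp P₂') (fun e e' => R₁ e e' ∨ R₂ e e') := by
  have hd₁ : ∀ e, e ∈ P₁.E → e ∈ P₂.E → False := fun e h h' => Set.disjoint_left.1 hd h h'
  have hd₂ : ∀ e, e ∈ P₁'.E → e ∈ P₂'.E → False :=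
    fun e h h' => Set.disjoint_left.1 (h₁.disjoint h₂ hd) h h'
  constructor
  · rintro e e' (h | h)
    exacts [Or.inl (h₁.left_mem _ _ h), Or.inr (h₂.left_mem _ _ h)]
  · rintro e e' (h | h)
    exacts [Or.inl (h₁.right_mem _ _ h), Or.inr (h₂.right_mem _ _ h)]
  · rintro e (h | h)
    · exact (h₁.total e h).imp fun _ => Or.inl
    · exact (h₂.total e h).imp fun _ => Or.inr
  · rintro e e₁ e₂ (h | h) (k | k)
    · exact h₁.unique _ _ _ h k
    · exact (hd₁ _ (h₁.left_mem _ _ h) (h₂.left_mem _ _ k)).elim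
    · exact (hd₁ _ (h₁.left_mem _ _ k) (h₂.left_mem _ _ h)).elim
    · exact h₂.unique _ _ _ h k
  · rintro e₁ e₂ e₁' e₂' (h | h) (k | k) hne
    · have a := h₁.left_mem _ _ h
      have b := h₁.left_mem _ _ k
      have a' := h₁.right_mem _ _ h
      have b' := h₁.right_mem _ _ k
      have := h₁.po_iff _ _ _ _ h k hne
      constructor
      · rintro (l | l | ⟨-, l⟩)
        exacts [Or.inl (this.1 l), (hd₁ _ a (p₂.left_mem l)).elim, (hd₁ _ b l).elim]
      · rintro (l | l | ⟨-, l⟩)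
        exacts [Or.inl (this.2 l), (hd₂ _ a' (p₂'.left_mem l)).elim, (hd₂ _ b' l).elim]
    · exact iff_of_true (Or.inr (Or.inr ⟨h₁.left_mem _ _ h, h₂.left_mem _ _ k⟩))
        (Or.inr (Or.inr ⟨h₁.right_mem _ _ h, h₂.right_mem _ _ k⟩))
    · have a := h₂.left_mem _ _ h
      have b := h₁.left_mem _ _ k
      have a' := h₂.right_mem _ _ h
      have b' := h₁.right_mem _ _ k
      refine iff_of_false ?_ ?_
      · rintro (l | l | ⟨l, -⟩)
        exacts [hd₁ _ (p₁.left_mem l) a, hd₁ _ b (p₂.right_mem l), hd₁ _ l a]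
      · rintro (l | l | ⟨l, -⟩)
        exacts [hd₂ _ (p₁'.left_mem l) a', hd₂ _ b' (p₂'.right_mem l), hd₂ _ l a']
    · have a := h₂.left_mem _ _ h
      have b := h₂.left_mem _ _ k
      have a' := h₂.right_mem _ _ h
      have b' := h₂.right_mem _ _ k
      have := h₂.po_iff _ _ _ _ h k hne
      constructor
      · rintro (l | l | ⟨l, -⟩)
        exacts [(hd₁ _ (p₁.left_mem l) a).elim, Or.inr (Or.inl (this.1 l)), (hd₁ _ l a).elim]
      · rintro (l | l | ⟨l, -⟩)
        exacts [(hd₂ _ (p₁'.left_mem l) a').elim, Or.inr (Or.inl (this.2 l)), (hd₂ _ l a').elim]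
  · rintro e' (h | h)
    · have : {e | R₁ e e' ∨ R₂ e e'} = {e | R₁ e e'} := by
        ext e
        exact or_iff_left fun k => hd₂ _ h (h₂.right_mem _ _ k)
      rw [this]
      exact (h₁.block e' h).mono fun _ _ => Or.inl
    · have : {e | R₁ e e' ∨ R₂ e e'} = {e | R₂ e e'} := by
        ext e
        exact or_iff_right fun k => hd₂ _ (h₁.right_mem _ _ k) h
      rw [this]
      exact (h₂.block e' h).mono fun _ _ => Or.inr ∘ Or.inl

theorem Refines.par {H H' : Tid → Plain Tid (Call Node Loc Lock SLoc Val Wid Other) Val}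
    {R : Tid → _ → _ → Prop} (h : ∀ t, Refines A (H t) (H' t) (R t))
    (p : ∀ t, (H t).IsPlain) (p' : ∀ t, (H' t).IsPlain)
    (ht : ∀ t, ∀ e ∈ (H t).E, e.thread = t) (ht' : ∀ t, ∀ e ∈ (H' t).E, e.thread = t) :
    Refines A (Plain.par H) (Plain.par H') (fun e e' => ∃ t, R t e e') := by
  have key : ∀ {t t' e e' e''}, R t e e' → R t' e e'' → t = t' := fun {t t' e _ _} k k' => by
    rw [← ht _ _ ((h t).left_mem _ _ k), ← ht _ _ ((h t').left_mem _ _ k')]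
  constructor
  · rintro e e' ⟨t, k⟩
    exact ⟨t, (h t).left_mem _ _ k⟩
  · rintro e e' ⟨t, k⟩
    exact ⟨t, (h t).right_mem _ _ k⟩
  · rintro e ⟨t, k⟩
    obtain ⟨e', k⟩ := (h t).total e k
    exact ⟨e', t, k⟩
  · rintro e e₁ e₂ ⟨t, k⟩ ⟨t', k'⟩
    obtain rfl := key k k'
    exact (h t).unique _ _ _ k k'
  · rintro e₁ e₂ e₁' e₂' ⟨t, k⟩ ⟨t', k'⟩ hne
    constructor
    · rintro ⟨s, l⟩
      obtain rfl : t = s := by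
        rw [← ht _ _ ((h t).left_mem _ _ k), ← ht _ _ ((p s).left_mem l)]
      obtain rfl : t' = t := by
        rw [← ht _ _ ((h t').left_mem _ _ k'), ← ht _ _ ((p t).right_mem l)]
      exact ⟨t', ((h t').po_iff _ _ _ _ k k' hne).1 l⟩
    · rintro ⟨s, l⟩
      obtain rfl : t = s := by
        rw [← ht' _ _ ((h t).right_mem _ _ k), ← ht' _ _ ((p' s).left_mem l)]
      obtain rfl : t' = t := by
        rw [← ht' _ _ ((h t').right_mem _ _ k'), ← ht' _ _ ((p' t).right_mem l)]
      exact ⟨t', ((h t').po_iff _ _ _ _ k k' hne).2 l⟩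
  · rintro e' ⟨t, k⟩
    have : {e | ∃ s, R s e e'} = {e | R t e e'} := by
      ext e
      refine ⟨?_, fun l => ⟨t, l⟩⟩
      rintro ⟨s, l⟩
      obtain rfl : t = s := by
        rw [← ht' _ _ k, ← ht' _ _ ((h s).right_mem _ _ l)]
      exact l
    rw [this]
    exact ((h t).block e' k).mono fun _ _ l => ⟨t, l⟩

/-- Reads and read-modify-writes share all but the access. The abstract event takes its identifier
and output from the final CPU read; as the block consists of calls, it ends with break number `0`,
like the single call it replaces. -/
theorem Sem.fetch_inv {t : Tid} {c : SCall SLoc Val} (hc : ¬ c.IsWrite) {r : Val × ℕ}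
    (h : Sem t (.seq (.call (.nlock (.acq (A.lock c.loc)))) <|
      .seq (.call (.rdma (c.access A t))) <| .seq (.call (.nlock (.rel (A.lock c.loc)))) <|
      .seq (.call (.rdma (.wait (A.wid t)))) <| .call (.rdma (.read (A.res t)))) r P) :
    ∃ i v, r = (v, 0) ∧ Block A P ⟨t, i, .sc c, v⟩ P.E := by
  obtain ⟨i₁, o₁, G₁, h₁, rfl⟩ := h.seq_call_inv
  obtain ⟨i₂, o₂, G₂, h₂, rfl⟩ := h₁.seq_call_inv
  obtain ⟨i₃, o₃, G₃, h₃, rfl⟩ := h₂.seq_call_inv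
  obtain ⟨i₄, o₄, G₄, h₄, rfl⟩ := h₃.seq_call_inv
  obtain ⟨i₅, o₅, rfl, rfl⟩ := h₄.call_inv
  refine ⟨i₅, o₅, rfl, by simp, ?_, ?_⟩
  · rintro x v ⟨⟩
    exact absurd ⟨_, _, rfl⟩ hc
  · rintro c ⟨⟩ -
    have hl : lastEvent A (⟨t, i₅, .sc c, o₅⟩ : Rdma.Ev Tid Node Loc Lock SLoc Val Wid Other) =
        ⟨t, i₅, .rdma (.read (A.res t)), o₅⟩ := by
      cases c <;> first | rfl | exact absurd ⟨_, _, rfl⟩ hc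
    rw [hl]
    refine ⟨_, _, _, _, rfl, rfl, rfl, rfl, ?_, ?_, ?_, ?_, rfl⟩ <;>
      simp [Plain.comp, Plain.single]

theorem Sem.scImpl_inv {t : Tid} {c : SCall SLoc Val} {r : Val × ℕ}
    (h : Sem t (scImpl A t (.sc c : Call Node Loc Lock SLoc Val Wid Other)) r P) :
    ∃ i v, r = (v, 0) ∧ Block A P ⟨t, i, .sc c, v⟩ P.E := by
  cases c with
  | write x v =>
    obtain ⟨i₁, o₁, G₁, h₁, rfl⟩ := Sem.seq_call_inv h
    obtain ⟨i₂, o₂, G₂, h₂, rfl⟩ := h₁.seq_call_inv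
    obtain ⟨i₃, o₃, G₃, h₃, rfl⟩ := h₂.seq_call_inv
    obtain ⟨i₄, o₄, rfl, rfl⟩ := h₃.call_inv
    refine ⟨i₄, o₄, rfl, by simp, ?_, ?_⟩
    · rintro x v ⟨⟩
      refine ⟨_, _, _, rfl, rfl, rfl, ?_, ?_, ?_, rfl⟩ <;>
        simp [Plain.comp, Plain.single, lastEvent]
    · rintro c ⟨⟩ hc
      exact absurd ⟨_, _, rfl⟩ hc
  | read x => exact Sem.fetch_inv (c := .read x) (by rintro ⟨_, _, ⟨⟩⟩) h
  | cas x v₁ v₂ => exact Sem.fetch_inv (c := .cas x v₁ v₂) (by rintro ⟨_, _, ⟨⟩⟩) h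
  | faa x v => exact Sem.fetch_inv (c := .faa x v) (by rintro ⟨_, _, ⟨⟩⟩) h

/-- Replacing calls by their implementations commutes with the control structure, so a derivation
for the implemented program can be replayed rule by rule for `p`, a block becoming one call. -/
theorem Sem.abstract {t : Tid} {p : SeqProg (Call Node Loc Lock SLoc Val Wid Other) Val} :
    ∀ {r : Val × ℕ} {P : Plain Tid (Call Node Loc Lock SLoc Val Wid Other) Val},
    Sem t (p.implement (scImpl A) (Set.range Call.sc) t) r P →
    ∃ P' R, Sem t p r P' ∧ Refines A P P' R := by
  induction p with
  | val v =>
    intro r P h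
    cases h
    exact ⟨_, _, .val v, .empty⟩
  | brk k v =>
    intro r P h
    cases h
    exact ⟨_, _, .brk k v, .empty⟩
  | call c =>
    intro r P h
    rw [SeqProg.implement] at h
    split_ifs at h with hc
    · obtain ⟨c, rfl⟩ := hc
      obtain ⟨i, v, rfl, hb⟩ := h.scImpl_inv
      exact ⟨_, _, .call _ i v, .of_block hb⟩
    · obtain ⟨i, v, rfl, rfl⟩ := h.call_inv
      exact ⟨_, _, .call _ i v, .single fun d hd => hc ⟨d, hd.symm⟩⟩
  | letIn p f ihp ihf =>
    intro r P h
    rw [SeqProg.implement] at h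
    cases h with
    | letIn h₁ h₂ hd =>
      obtain ⟨P₁, R₁, s₁, r₁⟩ := ihp h₁
      obtain ⟨P₂, R₂, s₂, r₂⟩ := ihf _ h₂
      exact ⟨_, _, .letIn s₁ s₂ (r₁.disjoint r₂ hd),
        r₁.comp r₂ hd h₁.isPlain.2 h₂.isPlain.2 s₁.isPlain.2 s₂.isPlain.2⟩
    | letBrk h₁ hk =>
      obtain ⟨P₁, R₁, s₁, r₁⟩ := ihp h₁
      exact ⟨_, _, .letBrk s₁ hk, r₁⟩
  | loop p ih =>
    intro r P h
    rw [SeqProg.implement] at h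
    -- An iteration recurses on the same loop, so the structural induction hypothesis covers only
    -- the body; the number of iterations needs an inner induction on the derivation.
    generalize hq : (p.implement (scImpl A) (Set.range Call.sc) t).loop = q at h
    induction h with
    | loopStep h₁ h₂ hd _ ih₂ =>
      cases hq
      obtain ⟨P₁, R₁, s₁, r₁⟩ := ih h₁
      obtain ⟨P₂, R₂, s₂, r₂⟩ := ih₂ rfl
      exact ⟨_, _, .loopStep s₁ s₂ (r₁.disjoint r₂ hd),
        r₁.comp r₂ hd h₁.isPlain.2 h₂.isPlain.2 s₁.isPlain.2 s₂.isPlain.2⟩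
    | loopExit h₁ _ =>
      cases hq
      obtain ⟨P₁, R₁, s₁, r₁⟩ := ih h₁
      exact ⟨_, _, .loopExit s₁, r₁⟩
    | _ => cases hq

theorem ConcSem.abstract [Zero Val] [Add Val]
    {p : Prog Tid (Call Node Loc Lock SLoc Val Wid Other) Val} {v : Tid → Val}
    (h : ConcSem (Mowgli.implement (scImpl A) (scLib (OLoc := OLoc) N) p) v P) :
    ∃ P' R, ConcSem p v P' ∧ Refines A P P' R := by
  obtain ⟨H, hH, rfl⟩ := h
  choose H' R hs hr using fun t => Sem.abstract (hH t)
  exact ⟨_, _, ⟨H', hs, rfl⟩, .par hr (fun t => (hH t).isPlain.2) (fun t => (hs t).isPlain.2)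
    (fun t => (hH t).isPlain.1) (fun t => (hs t).isPlain.1)⟩

end Refinement

end Mowgli

namespace Mowgli

/-! ## Modification orders -/

section Memory

variable {S ALoc Val : Type*}

/-- A union of strict total orders on the writes to each location. -/
structure IsModOrder (W : Set S) (loc : S → Set ALoc) (mo : S → S → Prop) : Prop where
  mem : ∀ a b, mo a b → a ∈ W ∧ b ∈ W ∧ ∃ x, loc a = {x} ∧ loc b = {x}
  irrefl : ∀ a, ¬ mo a a
  trans : ∀ a b c, mo a b → mo b c → mo a c
  total : ∀ a ∈ W, ∀ b ∈ W, ∀ x, loc a = {x} → loc b = {x} → a ≠ b → mo a b ∨ mo b a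

/-- The family indexed by locations is determined by its union, since a write in the order has a
singleton as its set of locations. Restriction and pullback are easier for the union. -/
theorem isModOrder_iff {W : Set S} {loc : S → Set ALoc} {mo : S → S → Prop} :
    IsModOrder W loc mo ↔ ∃ mox : ALoc → S → S → Prop,
      (∀ x, StrictTotalOn {w | w ∈ W ∧ loc w = {x}} (mox x)) ∧
      (∀ w₁ w₂, mo w₁ w₂ ↔ ∃ x, mox x w₁ w₂) := by
  constructor
  · intro h
    refine ⟨fun x a b => mo a b ∧ loc a = {x}, fun x => ⟨?_, ?_, ?_, ?_⟩, ?_⟩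
    · rintro a b ⟨hab, hx⟩
      obtain ⟨ha, hb, y, hy, hy'⟩ := h.mem _ _ hab
      exact ⟨⟨ha, hx⟩, hb, by rw [hy', ← hy, hx]⟩
    · exact fun a k => h.irrefl a k.1
    · exact fun a b c k l => ⟨h.trans _ _ _ k.1 l.1, k.2⟩
    · rintro a ⟨ha, hx⟩ b ⟨hb, hy⟩ hne
      exact (h.total a ha b hb x hx hy hne).imp (fun k => ⟨k, hx⟩) (fun k => ⟨k, hy⟩)
    · intro a b
      refine ⟨fun k => ?_, fun ⟨_, k⟩ => k.1⟩
      obtain ⟨-, -, x, hx, -⟩ := h.mem _ _ k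
      exact ⟨x, k, hx⟩
  · rintro ⟨mox, h, hmo⟩
    refine ⟨?_, ?_, ?_, ?_⟩
    · intro a b k
      obtain ⟨x, k⟩ := (hmo a b).1 k
      obtain ⟨⟨ha, hx⟩, hb, hy⟩ := (h x).1 _ _ k
      exact ⟨ha, hb, x, hx, hy⟩
    · intro a k
      obtain ⟨x, k⟩ := (hmo a a).1 k
      exact (h x).2.1 _ k
    · intro a b c k l
      obtain ⟨x, k⟩ := (hmo _ _).1 k
      obtain ⟨y, l⟩ := (hmo _ _).1 l
      have h₁ := ((h x).1 _ _ k).2.2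
      have h₂ := ((h y).1 _ _ l).1.2
      -- The middle write belongs to both orders, and its only location identifies them.
      obtain rfl : x = y := Set.singleton_injective (h₁.symm.trans h₂)
      exact (hmo _ _).2 ⟨x, (h x).2.2.1 _ _ _ k l⟩
    · intro a ha b hb x hx hy hne
      exact ((h x).2.2.2 a ⟨ha, hx⟩ b ⟨hb, hy⟩ hne).imp (fun k => (hmo _ _).2 ⟨x, k⟩)
        (fun k => (hmo _ _).2 ⟨x, k⟩)

theorem RfMoWF.isModOrder [Zero Val] {R W : Set S} {loc : S → Set ALoc} {vR vW : S → Val}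
    {rf mo : S → S → Prop} (h : RfMoWF R W loc vR vW rf mo) : IsModOrder W loc mo :=
  isModOrder_iff.2 h.2.2.2

end Memory

/-! ## Restriction of an RDMA execution to some of the locations -/

namespace Rdma

variable {Tid Node Loc Lock SLoc Val Wid Other : Type*}

/-- The locations of a read or write subevent. -/
theorem loc_subset {s : SEv Tid Node Loc Lock SLoc Val Wid Other} {c : RCall Node Loc Val Wid}
    (hc : s.1.call = .rdma c) : loc s ⊆ c.loc := by
  rw [loc, hc]
  obtain ⟨e, a⟩ := s
  cases c <;> cases a <;> simp [RCall.subLoc, RCall.loc]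

/-- `subLoc` is empty on combinations of call and stamp that never occur; validity of the stamps
excludes those with a read stamp. -/
theorem loc_read_nonempty {N : Network Tid Node Loc Lock Val}
    {G : Ex Tid Node Loc Lock SLoc Val Wid Other}
    {s : SEv Tid Node Loc Lock SLoc Val Wid Other} {c : RCall Node Loc Val Wid}
    (hc : s.1.call = .rdma c) (hs : G.stmp s.1 ∈ c.stamps N s.1.out) (hr : s ∈ reads G) :
    (loc s).Nonempty := by
  rw [loc, hc]
  obtain ⟨e, a⟩ := s
  obtain ⟨⟨-, ha⟩, hr⟩ := hr
  dsimp only at *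
  rcases hr with rfl | rfl | ⟨n, rfl | rfl | rfl⟩ <;> cases c <;>
    simp only [RCall.stamps, Set.mem_singleton_iff, Set.mem_insert_iff, Set.mem_ofPred_eq] at hs <;>
    first
    | exact Set.singleton_nonempty _
    | (exfalso; rw [hs] at ha; simp at ha)
    | (exfalso; rcases hs with hs | hs <;> rw [hs] at ha <;> simp at ha)

/-- `G'` is the restriction of `G` to a set of events. -/
structure IsRestriction (G' G : Ex Tid Node Loc Lock SLoc Val Wid Other) : Prop where
  mem : ∀ e ∈ G'.E, e ∈ G.E
  po_iff : ∀ e₁ e₂, G'.po e₁ e₂ ↔ e₁ ∈ G'.E ∧ e₂ ∈ G'.E ∧ G.po e₁ e₂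
  stmp : ∀ e ∈ G'.E, G'.stmp e = G.stmp e

/-- Restriction of the auxiliary relations to the events of an execution. -/
def Witness.restrict (X : Witness Tid Node Loc Lock SLoc Val Wid Other)
    (G : Ex Tid Node Loc Lock SLoc Val Wid Other) :
    Witness Tid Node Loc Lock SLoc Val Wid Other where
  vR := X.vR
  vW := X.vW
  rf s₁ s₂ := X.rf s₁ s₂ ∧ s₁.1 ∈ G.E ∧ s₂.1 ∈ G.E
  mo s₁ s₂ := X.mo s₁ s₂ ∧ s₁.1 ∈ G.E ∧ s₂.1 ∈ G.E
  nfo s₁ s₂ := X.nfo s₁ s₂ ∧ s₁.1 ∈ G.E ∧ s₂.1 ∈ G.E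
  rao s₁ s₂ := X.rao s₁ s₂ ∧ s₁.1 ∈ G.E ∧ s₂.1 ∈ G.E

namespace IsRestriction

variable {G G' : Ex Tid Node Loc Lock SLoc Val Wid Other}
  {X : Witness Tid Node Loc Lock SLoc Val Wid Other}

theorem mem_SE (h : IsRestriction G' G) {s} : s ∈ G'.SE ↔ s ∈ G.SE ∧ s.1 ∈ G'.E := by
  constructor
  · rintro ⟨a, b⟩
    exact ⟨⟨h.mem _ a, h.stmp _ a ▸ b⟩, a⟩
  · rintro ⟨⟨-, b⟩, a⟩
    exact ⟨a, (h.stmp _ a).symm ▸ b⟩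

theorem mem_reads (h : IsRestriction G' G) {s} : s ∈ reads G' ↔ s ∈ reads G ∧ s.1 ∈ G'.E := by
  simp only [reads, Set.mem_ofPred_eq, h.mem_SE]; exact and_right_comm

theorem mem_writes (h : IsRestriction G' G) {s} : s ∈ writes G' ↔ s ∈ writes G ∧ s.1 ∈ G'.E := by
  simp only [writes, Set.mem_ofPred_eq, h.mem_SE]; exact and_right_comm

theorem po (h : IsRestriction G' G) {e₁ e₂} (hp : G'.po e₁ e₂) : G.po e₁ e₂ :=
  ((h.po_iff _ _).1 hp).2.2

theorem ppo (h : IsRestriction G' G) {s₁ s₂} (hp : G'.ppo s₁ s₂) : G.ppo s₁ s₂ :=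
  ⟨(h.mem_SE.1 hp.1).1, (h.mem_SE.1 hp.2.1).1, h.po hp.2.2.1, hp.2.2.2⟩

theorem ippo (h : IsRestriction G' G) {s₁ s₂} (hp : ippo G' s₁ s₂) : Rdma.ippo G s₁ s₂ :=
  hp.imp h.ppo fun k => ⟨(h.mem_SE.1 k.1).1, (h.mem_SE.1 k.2.1).1, h.po k.2.2.1, k.2.2.2⟩

theorem iso (h : IsRestriction G' G) {s₁ s₂} (hp : iso G' s₁ s₂) : Rdma.iso G s₁ s₂ :=
  ⟨(h.mem_SE.1 hp.1).1, (h.mem_SE.1 hp.2.1).1, hp.2.2⟩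

theorem pfg (h : IsRestriction G' G) {s₁ s₂} (hp : pfg G' s₁ s₂) : Rdma.pfg G s₁ s₂ :=
  ⟨(h.mem_SE.1 hp.1).1, (h.mem_SE.1 hp.2.1).1, hp.2.2.1, hp.2.2.2.1, h.po hp.2.2.2.2.1,
    hp.2.2.2.2.2⟩

theorem pfp (h : IsRestriction G' G) {s₁ s₂} (hp : pfp G' s₁ s₂) : Rdma.pfp G s₁ s₂ :=
  ⟨(h.mem_SE.1 hp.1).1, (h.mem_SE.1 hp.2.1).1, hp.2.2.1, hp.2.2.2.1, h.po hp.2.2.2.2.1,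
    hp.2.2.2.2.2⟩

/-- Internal reads-from occurs under a negation, so program order has to be reflected by the
restriction and not merely preserved. -/
theorem rfe (h : IsRestriction G' G) {s₁ s₂} (hp : rfe G' (X.restrict G') s₁ s₂) :
    Rdma.rfe G X s₁ s₂ :=
  ⟨hp.1.1, fun k => hp.2 ⟨k.1, k.2.1, (h.po_iff _ _).2 ⟨hp.1.2.1, hp.1.2.2, k.2.2.1⟩, hp.1⟩⟩

/-- The events of `G` that access a location of an event of `G'` are in `G'`. -/
def Closed (G' G : Ex Tid Node Loc Lock SLoc Val Wid Other) : Prop :=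
  ∀ e₁ ∈ G'.E, ∀ e₂ ∈ G.E, ∀ c₁ c₂ x, e₁.call = .rdma c₁ → e₂.call = .rdma c₂ →
    x ∈ c₁.loc → x ∈ c₂.loc → e₂ ∈ G'.E

variable {N : Network Tid Node Loc Lock Val} [Zero Val] [Add Val]

/-- The source shares the nonempty set of locations of the read, so `Closed` applies. This is what
keeps a read from losing its source under restriction. -/
theorem rf_mem (h : IsRestriction G' G) (hX : X.WF N G) (hcl : Closed G' G)
    (hG : ∀ e ∈ G.E, ∃ c, e.call = .rdma c ∧ G.stmp e ∈ c.stamps N e.out) {w r}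
    (hrf : X.rf w r) (hr : r.1 ∈ G'.E) : w.1 ∈ G'.E := by
  obtain ⟨hw, hr', hl, -⟩ := hX.rf_mo.1 _ _ hrf
  obtain ⟨c, hc, hs⟩ := hG r.1 (h.mem _ hr)
  obtain ⟨d, hd, -⟩ := hG w.1 hw.1.1
  obtain ⟨x, hx⟩ := loc_read_nonempty hc hs hr'
  exact hcl r.1 hr w.1 hw.1.1 c d x hc hd (loc_subset hc hx) (loc_subset hd (hl ▸ hx))

/-- Reads-before is not monotone in reads-from, since a read without a source is before every other
write to its location. `rf_mem` guarantees that a read that has no source after restriction had none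
before. -/
theorem rb (h : IsRestriction G' G) (hX : X.WF N G) (hcl : Closed G' G)
    (hG : ∀ e ∈ G.E, ∃ c, e.call = .rdma c ∧ G.stmp e ∈ c.stamps N e.out) {s₁ s₂}
    (hp : rb G' (X.restrict G') s₁ s₂) : Rdma.rb G X s₁ s₂ := by
  obtain ⟨hr, hw, hrf, hl, hne⟩ := hp
  rw [h.mem_reads] at hr
  refine ⟨hr.1, (h.mem_writes.1 hw).1, ?_, hl, hne⟩
  refine hrf.imp (fun ⟨w, k, l⟩ => ⟨w, k.1, l.1⟩) fun k w l => k w ⟨l, ?_, hr.2⟩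
  exact h.rf_mem hX hcl hG l hr.2

theorem ib (h : IsRestriction G' G) (hX : X.WF N G) (hcl : Closed G' G)
    (hG : ∀ e ∈ G.E, ∃ c, e.call = .rdma c ∧ G.stmp e ∈ c.stamps N e.out) {s₁ s₂}
    (hp : ib G' (X.restrict G') s₁ s₂) : Rdma.ib G X s₁ s₂ := by
  refine Relation.TransGen.mono ?_ _ _ hp
  rintro a b (k | k | k | k | k | k | k)
  · exact Or.inl (h.ippo k)
  · exact Or.inr (Or.inl (h.iso k))
  · exact Or.inr (Or.inr (Or.inl k.1))
  · exact Or.inr (Or.inr (Or.inr (Or.inl (h.pfg k))))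
  · exact Or.inr (Or.inr (Or.inr (Or.inr (Or.inl (h.pfp k)))))
  · exact Or.inr (Or.inr (Or.inr (Or.inr (Or.inr (Or.inl k.1)))))
  · exact Or.inr (Or.inr (Or.inr (Or.inr (Or.inr (Or.inr
      ⟨k.1, k.2.1, k.2.2.1.imp h.po h.po, h.rb hX hcl hG k.2.2.2⟩)))))

theorem soSpec (h : IsRestriction G' G) (hX : X.WF N G) (hcl : Closed G' G)
    (hG : ∀ e ∈ G.E, ∃ c, e.call = .rdma c ∧ G.stmp e ∈ c.stamps N e.out) {s₁ s₂}
    (hp : soSpec G' (X.restrict G') s₁ s₂) : Rdma.soSpec G X s₁ s₂ := by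
  rcases hp with k | k | k | k | k | k | k | ⟨k, s, l, m⟩ | ⟨k, l⟩
  · exact Or.inl (h.iso k)
  · exact Or.inr (Or.inl (h.rfe k))
  · exact Or.inr (Or.inr (Or.inl (h.pfg k)))
  · exact Or.inr (Or.inr (Or.inr (Or.inl k.1)))
  · exact Or.inr (Or.inr (Or.inr (Or.inr (Or.inl (h.rb hX hcl hG k)))))
  · exact Or.inr (Or.inr (Or.inr (Or.inr (Or.inr (Or.inl k.1)))))
  · exact Or.inr (Or.inr (Or.inr (Or.inr (Or.inr (Or.inr (Or.inl k.1))))))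
  · exact Or.inr (Or.inr (Or.inr (Or.inr (Or.inr (Or.inr (Or.inr (Or.inl
      ⟨k, s, h.iso l, m.1⟩)))))))
  · exact Or.inr (Or.inr (Or.inr (Or.inr (Or.inr (Or.inr (Or.inr (Or.inr
      ⟨⟨(h.mem_SE.1 k.1).1, k.2⟩, h.ib hX hcl hG l⟩)))))))

/-- Most clauses are inherited by subsets of events. The initial value of a read without a source is
the exception, and needs `rf_mem` again. -/
theorem witness_wf (h : IsRestriction G' G) (hX : X.WF N G) (hcl : Closed G' G)
    (hG : ∀ e ∈ G.E, ∃ c, e.call = .rdma c ∧ G.stmp e ∈ c.stamps N e.out) :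
    (X.restrict G').WF N G' where
  vR_read s hs := hX.vR_read s (h.mem_reads.1 hs).1
  vR_cas s hs := hX.vR_cas s (h.mem_reads.1 hs).1
  vW_write s hs := hX.vW_write s (h.mem_writes.1 hs).1
  vW_cas s hs := hX.vW_cas s (h.mem_writes.1 hs).1
  copy_put e n h₁ h₂ := hX.copy_put e n (h.mem_SE.1 h₁).1 (h.mem_SE.1 h₂).1
  copy_get e n h₁ h₂ := hX.copy_get e n (h.mem_SE.1 h₁).1 (h.mem_SE.1 h₂).1
  copy_rmw e n h₁ h₂ := hX.copy_rmw e n (h.mem_SE.1 h₁).1 (h.mem_SE.1 h₂).1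
  rf_mo := by
    have hm := hX.rf_mo.isModOrder
    refine ⟨?_, fun w₁ w₂ r k l => hX.rf_mo.2.1 _ _ _ k.1 l.1, ?_, isModOrder_iff.1
      ⟨?_, fun a k => hm.irrefl a k.1,
        fun a b c k l => ⟨hm.trans _ _ _ k.1 l.1, k.2.1, l.2.2⟩, ?_⟩⟩
    · rintro w r ⟨k, hw, hr⟩
      obtain ⟨a, b, c⟩ := hX.rf_mo.1 _ _ k
      exact ⟨h.mem_writes.2 ⟨a, hw⟩, h.mem_reads.2 ⟨b, hr⟩, c⟩
    · intro r hr k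
      rw [h.mem_reads] at hr
      exact hX.rf_mo.2.2.1 r hr.1 fun w l => k w ⟨l, h.rf_mem hX hcl hG l hr.2, hr.2⟩
    · rintro a b ⟨k, ha, hb⟩
      obtain ⟨l, m, o⟩ := hm.mem _ _ k
      exact ⟨h.mem_writes.2 ⟨l, ha⟩, h.mem_writes.2 ⟨m, hb⟩, o⟩
    · intro a ha b hb x hx hy hne
      rw [h.mem_writes] at ha hb
      exact (hm.total a ha.1 b hb.1 x hx hy hne).imp (fun k => ⟨k, ha.2, hb.2⟩)
        (fun k => ⟨k, hb.2, ha.2⟩)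
  nfo_mem s₁ s₂ k :=
    ⟨h.mem_SE.2 ⟨(hX.nfo_mem _ _ k.1).1, k.2.1⟩, h.mem_SE.2 ⟨(hX.nfo_mem _ _ k.1).2, k.2.2⟩⟩
  nfo_local e₁ e₂ n h₁ h₂ ht :=
    (hX.nfo_local e₁ e₂ n (h.mem_SE.1 h₁).1 (h.mem_SE.1 h₂).1 ht).imp
      (fun k => ⟨k, h₁.1, h₂.1⟩) (fun k => ⟨k, h₂.1, h₁.1⟩)
  nfo_remote e₁ e₂ n h₁ h₂ ht :=
    (hX.nfo_remote e₁ e₂ n (h.mem_SE.1 h₁).1 (h.mem_SE.1 h₂).1 ht).imp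
      (fun k => ⟨k, h₁.1, h₂.1⟩) (fun k => ⟨k, h₂.1, h₁.1⟩)
  nfo_atomic e₁ e₂ n h₁ h₂ ht :=
    (hX.nfo_atomic e₁ e₂ n (h.mem_SE.1 h₁).1 (h.mem_SE.1 h₂).1 ht).imp
      (fun k => ⟨k, h₁.1, h₂.1⟩) (fun k => ⟨k, h₂.1, h₁.1⟩)
  rcas_fail e he x y v₁ v₂ d hc hs :=
    hX.rcas_fail e (h.mem e he) x y v₁ v₂ d hc (h.stmp e he ▸ hs)
  rcas_succ e he x y v₁ v₂ d hc hs :=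
    hX.rcas_succ e (h.mem e he) x y v₁ v₂ d hc (h.stmp e he ▸ hs)
  rfaa e he := hX.rfaa e (h.mem e he)
  rao_total := by
    obtain ⟨raon, ht, hr⟩ := hX.rao_total
    refine ⟨fun n s₁ s₂ => raon n s₁ s₂ ∧ s₁.1 ∈ G'.E ∧ s₂.1 ∈ G'.E,
      fun n => ⟨?_, fun a k => (ht n).2.1 a k.1,
        fun a b c k l => ⟨(ht n).2.2.1 _ _ _ k.1 l.1, k.2.1, l.2.2⟩, ?_⟩, ?_⟩
    · rintro a b ⟨k, ha, hb⟩
      obtain ⟨l, m⟩ := (ht n).1 _ _ k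
      exact ⟨⟨h.mem_SE.2 ⟨l.1, ha⟩, l.2⟩, ⟨h.mem_SE.2 ⟨m.1, hb⟩, m.2⟩⟩
    · rintro a ⟨ha, ha'⟩ b ⟨hb, hb'⟩ hne
      rw [h.mem_SE] at ha hb
      exact ((ht n).2.2.2 a ⟨ha.1, ha'⟩ b ⟨hb.1, hb'⟩ hne).imp (fun k => ⟨k, ha.2, hb.2⟩)
        (fun k => ⟨k, hb.2, ha.2⟩)
    · intro s₁ s₂
      simp only [Witness.restrict, hr]
      exact ⟨fun ⟨⟨n, k⟩, l⟩ => ⟨n, k, l⟩, fun ⟨n, k, l⟩ => ⟨⟨n, k⟩, l⟩⟩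

end IsRestriction

end Rdma

end Mowgli

namespace Mowgli

/-! ### Naming the events of a block, and the use of node locks. -/

section Layout

variable {Tid Node Loc Lock SLoc Val Wid Other : Type*}
  {N : Network Tid Node Loc Lock Val} {A : Alloc N SLoc Wid}
  {P P' : Plain Tid (Call Node Loc Lock SLoc Val Wid Other) Val}
  {R : Rdma.Ev Tid Node Loc Lock SLoc Val Wid Other →
    Rdma.Ev Tid Node Loc Lock SLoc Val Wid Other → Prop}
  {acq acc rel aux : Rdma.Ev Tid Node Loc Lock SLoc Val Wid Other →
    Rdma.Ev Tid Node Loc Lock SLoc Val Wid Other}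

/-- The events that implement an abstract event `e` of the sequentially consistent library: the
acquisition and the release of the lock, the access to the data, the write (`aux`) that prepares
the access, or the wait (`aux`) and the read that follow it. -/
structure Layout (A : Alloc N SLoc Wid)
    (P P' : Plain Tid (Call Node Loc Lock SLoc Val Wid Other) Val)
    (R : Rdma.Ev Tid Node Loc Lock SLoc Val Wid Other →
      Rdma.Ev Tid Node Loc Lock SLoc Val Wid Other → Prop)
    (acq acc rel aux : Rdma.Ev Tid Node Loc Lock SLoc Val Wid Other →
      Rdma.Ev Tid Node Loc Lock SLoc Val Wid Other) : Prop
    extends Refines A P P' R where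
  client : ∀ e ∈ P'.E, (∀ c, e.call ≠ .sc c) → ∀ d, R d e ↔ d = e
  acq_call : ∀ e ∈ P'.E, ∀ c, e.call = .sc c → (acq e).call = .nlock (.acq (A.lock c.loc))
  acc_call : ∀ e ∈ P'.E, ∀ c, e.call = .sc c → (acc e).call = .rdma (c.access A e.thread)
  rel_call : ∀ e ∈ P'.E, ∀ c, e.call = .sc c → (rel e).call = .nlock (.rel (A.lock c.loc))
  po_acq_acc : ∀ e ∈ P'.E, ∀ c, e.call = .sc c → P.po (acq e) (acc e)
  po_acc_rel : ∀ e ∈ P'.E, ∀ c, e.call = .sc c → P.po (acc e) (rel e)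
  write : ∀ e ∈ P'.E, ∀ x v, e.call = .sc (.write x v) →
    rel e = lastEvent A e ∧ (aux e).call = .rdma (.write (A.tmp x e.thread) v) ∧
    P.po (acq e) (aux e) ∧ P.po (aux e) (acc e) ∧
    ∀ d, R d e ↔ d = acq e ∨ d = aux e ∨ d = acc e ∨ d = rel e
  fetch : ∀ e ∈ P'.E, ∀ c, e.call = .sc c → ¬ c.IsWrite →
    (aux e).call = .rdma (.wait (A.wid e.thread)) ∧
    P.po (rel e) (aux e) ∧ P.po (aux e) (lastEvent A e) ∧
    ∀ d, R d e ↔ d = acq e ∨ d = acc e ∨ d = rel e ∨ d = aux e ∨ d = lastEvent A e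

/-- Skolemisation of the existentials in `Block`, so that the events of different blocks can be
compared by name. The functions take the dummy value `e` where no SC call is implemented. -/
theorem Refines.exists_layout (h : Refines A P P' R) (hP : P.IsPlain) :
    ∃ acq acc rel aux, Layout A P P' R acq acc rel aux := by
  have key : ∀ e, ∃ a m r q, e ∈ P'.E → ∀ c, e.call = .sc c →
      a.call = .nlock (.acq (A.lock c.loc)) ∧ m.call = .rdma (c.access A e.thread) ∧
      r.call = .nlock (.rel (A.lock c.loc)) ∧ P.po a m ∧ P.po m r ∧
      (∀ x v, c = .write x v → r = lastEvent A e ∧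
        q.call = .rdma (.write (A.tmp x e.thread) v) ∧ P.po a q ∧ P.po q m ∧
        ∀ d, R d e ↔ d = a ∨ d = q ∨ d = m ∨ d = r) ∧
      (¬ c.IsWrite → q.call = .rdma (.wait (A.wid e.thread)) ∧ P.po r q ∧
        P.po q (lastEvent A e) ∧
        ∀ d, R d e ↔ d = a ∨ d = m ∨ d = r ∨ d = q ∨ d = lastEvent A e) := by
    intro e
    by_cases he : e ∈ P'.E
    swap
    · exact ⟨e, e, e, e, fun k => absurd k he⟩
    by_cases hc : ∃ c, e.call = .sc c
    swap
    · exact ⟨e, e, e, e, fun _ c k => absurd ⟨c, k⟩ hc⟩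
    obtain ⟨c, hc⟩ := hc
    by_cases hw : c.IsWrite
    · obtain ⟨x, v, rfl⟩ := hw
      obtain ⟨a, w, m, h₁, h₂, h₃, h₄, h₅, h₆, h₇⟩ := (h.block e he).write x v hc
      refine ⟨a, m, lastEvent A e, w, fun _ c' hc' => ?_⟩
      obtain rfl : SCall.write x v = c' := by rw [hc] at hc'; exact Call.sc.inj hc'
      refine ⟨h₁, h₃, ?_, hP.trans h₄ h₅, h₆, ?_, fun k => absurd ⟨x, v, rfl⟩ k⟩
      · simp [lastEvent, hc, SCall.loc]
      · rintro _ _ ⟨⟩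
        exact ⟨rfl, h₂, h₄, h₅, fun d => Set.ext_iff.1 h₇ d⟩
    · obtain ⟨a, m, r, q, h₁, h₂, h₃, h₄, h₅, h₆, h₇, h₈, h₉⟩ := (h.block e he).fetch c hc hw
      refine ⟨a, m, r, q, fun _ c' hc' => ?_⟩
      obtain rfl : c = c' := by rw [hc] at hc'; exact Call.sc.inj hc'
      refine ⟨h₁, h₂, h₃, h₅, h₆, fun x v k => absurd ⟨x, v, k⟩ hw, fun _ => ?_⟩
      exact ⟨h₄, h₇, h₈, fun d => Set.ext_iff.1 h₉ d⟩
  choose acq acc rel aux hk using key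
  refine ⟨acq, acc, rel, aux, h, ?_, ?_, ?_, ?_, ?_, ?_, ?_, ?_⟩
  · exact fun e he hc d => Set.ext_iff.1 ((h.block e he).client hc) d
  · exact fun e he c hc => (hk e he c hc).1
  · exact fun e he c hc => (hk e he c hc).2.1
  · exact fun e he c hc => (hk e he c hc).2.2.1
  · exact fun e he c hc => (hk e he c hc).2.2.2.1
  · exact fun e he c hc => (hk e he c hc).2.2.2.2.1
  · exact fun e he x v hc => (hk e he _ hc).2.2.2.2.2.1 x v rfl
  · exact fun e he c hc => (hk e he c hc).2.2.2.2.2.2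

/-- The client events access none of the locations of the implementation. -/
structure Separated (A : Alloc N SLoc Wid)
    (P' : Plain Tid (Call Node Loc Lock SLoc Val Wid Other) Val) : Prop where
  acq : ∀ e ∈ P'.E, ∀ x, e.call ≠ .nlock (.acq (A.lock x))
  rel : ∀ e ∈ P'.E, ∀ x, e.call ≠ .nlock (.rel (A.lock x))
  rdma : ∀ e ∈ P'.E, ∀ c, e.call = .rdma c → ∀ y ∈ c.loc, ∀ x t,
    y ≠ A.data x ∧ y ≠ A.res t ∧ y ≠ A.tmp x t

namespace Layout

theorem rel_acq (h : Layout A P P' R acq acc rel aux) {e} (he : e ∈ P'.E) {c}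
    (hc : e.call = .sc c) : R (acq e) e := by
  by_cases hw : c.IsWrite
  · obtain ⟨x, v, rfl⟩ := hw
    exact ((h.write e he x v hc).2.2.2.2 _).2 (Or.inl rfl)
  · exact ((h.fetch e he c hc hw).2.2.2 _).2 (Or.inl rfl)

theorem rel_acc (h : Layout A P P' R acq acc rel aux) {e} (he : e ∈ P'.E) {c}
    (hc : e.call = .sc c) : R (acc e) e := by
  by_cases hw : c.IsWrite
  · obtain ⟨x, v, rfl⟩ := hw
    exact ((h.write e he x v hc).2.2.2.2 _).2 (Or.inr (Or.inr (Or.inl rfl)))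
  · exact ((h.fetch e he c hc hw).2.2.2 _).2 (Or.inr (Or.inl rfl))

theorem rel_rel (h : Layout A P P' R acq acc rel aux) {e} (he : e ∈ P'.E) {c}
    (hc : e.call = .sc c) : R (rel e) e := by
  by_cases hw : c.IsWrite
  · obtain ⟨x, v, rfl⟩ := hw
    exact ((h.write e he x v hc).2.2.2.2 _).2 (Or.inr (Or.inr (Or.inr rfl)))
  · exact ((h.fetch e he c hc hw).2.2.2 _).2 (Or.inr (Or.inr (Or.inl rfl)))

theorem rel_aux (h : Layout A P P' R acq acc rel aux) {e} (he : e ∈ P'.E) {c}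
    (hc : e.call = .sc c) : R (aux e) e := by
  by_cases hw : c.IsWrite
  · obtain ⟨x, v, rfl⟩ := hw
    exact ((h.write e he x v hc).2.2.2.2 _).2 (Or.inr (Or.inl rfl))
  · exact ((h.fetch e he c hc hw).2.2.2 _).2 (Or.inr (Or.inr (Or.inr (Or.inl rfl))))

theorem rel_client (h : Layout A P P' R acq acc rel aux) {e} (he : e ∈ P'.E)
    (hc : ∀ c, e.call ≠ .sc c) : R e e := (h.client e he hc e).2 rfl

/-- No event of the implementation calls the sequentially consistent library. -/
theorem call_ne_sc (h : Layout A P P' R acq acc rel aux) {d} (hd : d ∈ P.E) (c) :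
    d.call ≠ .sc c := by
  obtain ⟨e, hR⟩ := h.total d hd
  have he := h.right_mem _ _ hR
  by_cases hc : ∀ c, e.call ≠ .sc c
  · rw [(h.client e he hc d).1 hR]
    exact hc c
  push Not at hc
  obtain ⟨c', hc⟩ := hc
  by_cases hw : c'.IsWrite
  · obtain ⟨x, v, rfl⟩ := hw
    obtain ⟨-, h₂, -, -, h₅⟩ := h.write e he x v hc
    rcases (h₅ d).1 hR with rfl | rfl | rfl | rfl
    · simp [h.acq_call e he _ hc]
    · simp [h₂]
    · simp [h.acc_call e he _ hc]
    · simp [h.rel_call e he _ hc]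
  · obtain ⟨h₁, -, -, h₅⟩ := h.fetch e he c' hc hw
    rcases (h₅ d).1 hR with rfl | rfl | rfl | rfl | rfl
    · simp [h.acq_call e he _ hc]
    · simp [h.acc_call e he _ hc]
    · simp [h.rel_call e he _ hc]
    · simp [h₁]
    · cases c' with
      | write x v => exact absurd ⟨x, v, rfl⟩ hw
      | _ => simp [lastEvent, hc]

theorem lastEvent_fetch {e : Rdma.Ev Tid Node Loc Lock SLoc Val Wid Other} {c}
    (hc : e.call = .sc c) (hw : ¬ c.IsWrite) :
    lastEvent A e = { e with call := .rdma (.read (A.res e.thread)) } := by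
  cases c with
  | write x v => exact absurd ⟨x, v, rfl⟩ hw
  | _ => simp [lastEvent, hc]

/-- The node lock events of the implementation. -/
theorem nlock_cases (h : Layout A P P' R acq acc rel aux) {d} (hd : d ∈ P.E) {c}
    (hdc : d.call = .nlock c) :
    (d ∈ P'.E ∧ R d d) ∨ ∃ e ∈ P'.E, ∃ c', e.call = .sc c' ∧
      ((d = acq e ∧ c = .acq (A.lock c'.loc)) ∨ (d = rel e ∧ c = .rel (A.lock c'.loc))) := by
  obtain ⟨e, hR⟩ := h.total d hd
  have he := h.right_mem _ _ hR
  by_cases hc : ∀ c, e.call ≠ .sc c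
  · obtain rfl := (h.client e he hc d).1 hR
    exact Or.inl ⟨he, hR⟩
  push Not at hc
  obtain ⟨c', hc⟩ := hc
  refine Or.inr ⟨e, he, c', hc, ?_⟩
  have h₁ := h.acq_call e he _ hc
  have h₂ := h.acc_call e he _ hc
  have h₃ := h.rel_call e he _ hc
  by_cases hw : c'.IsWrite
  · obtain ⟨x, v, rfl⟩ := hw
    obtain ⟨-, h₄, -, -, h₅⟩ := h.write e he x v hc
    rcases (h₅ d).1 hR with rfl | rfl | rfl | rfl <;> simp_all
  · obtain ⟨h₄, -, -, h₅⟩ := h.fetch e he c' hc hw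
    rw [lastEvent_fetch hc hw] at h₅
    rcases (h₅ d).1 hR with rfl | rfl | rfl | rfl | rfl <;> simp_all

theorem client_mem (h : Layout A P P' R acq acc rel aux) {e} (he : e ∈ P'.E)
    (hc : ∀ c, e.call ≠ .sc c) : e ∈ P.E := h.left_mem _ _ (h.rel_client he hc)

theorem client_po_iff (h : Layout A P P' R acq acc rel aux) (hP : P.IsPlain) (hP' : P'.IsPlain)
    {e₁ e₂} (h₁ : e₁ ∈ P'.E) (h₂ : e₂ ∈ P'.E) (hc₁ : ∀ c, e₁.call ≠ .sc c)
    (hc₂ : ∀ c, e₂.call ≠ .sc c) : P.po e₁ e₂ ↔ P'.po e₁ e₂ := by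
  by_cases hne : e₁ = e₂
  · subst hne
    exact iff_of_false (hP.2.1 _) (hP'.2.1 _)
  · exact h.po_iff _ _ _ _ (h.rel_client h₁ hc₁) (h.rel_client h₂ hc₂) hne

/-- The implementation of an abstract event uses its lock without interruption. -/
theorem immPo_block (h : Layout A P P' R acq acc rel aux) (hP : P.IsPlain) (hP' : P'.IsPlain)
    {e} (he : e ∈ P'.E) {c} (hc : e.call = .sc c) :
    NLock.immPo P (A.lock c.loc) (acq e) (rel e) := by
  have ha := h.rel_acq he hc
  have hr := h.rel_rel he hc
  refine ⟨Or.inl ⟨h.left_mem _ _ ha, h.acq_call e he c hc⟩,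
    Or.inr ⟨h.left_mem _ _ hr, h.rel_call e he c hc⟩,
    hP.trans (h.po_acq_acc e he c hc) (h.po_acc_rel e he c hc), ?_⟩
  rintro ⟨d, hd, had, hdr⟩
  have hdP : d ∈ P.E := hP.right_mem had
  obtain ⟨e', hR⟩ := h.total d hdP
  obtain ⟨c', hdc⟩ : ∃ c', d.call = .nlock c' := hd.elim (fun k => ⟨_, k.2⟩) (fun k => ⟨_, k.2⟩)
  -- A lock event of this same block is one of the two endpoints. One of another block would make
  -- program order leave the abstract event `e` and return to it.
  by_cases hne : e = e'
  · subst hne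
    rcases h.nlock_cases hdP hdc with ⟨hd', hR'⟩ | ⟨e', he', c'', hc'', (⟨rfl, -⟩ | ⟨rfl, -⟩)⟩
    · obtain rfl := h.unique _ _ _ hR hR'
      simp [hc] at hdc
    · obtain rfl := h.unique _ _ _ hR (h.rel_acq he' hc'')
      exact hP.2.1 _ had
    · obtain rfl := h.unique _ _ _ hR (h.rel_rel he' hc'')
      exact hP.2.1 _ hdr
  · have k₁ := (h.po_iff _ _ _ _ ha hR hne).1 had
    have k₂ := (h.po_iff _ _ _ _ hR hr (Ne.symm hne)).1 hdr
    exact hP'.2.1 _ (hP'.trans k₁ k₂)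

/-- The client uses only its own locks. -/
theorem client_acqs (h : Layout A P P' R acq acc rel aux) {l} (hl : ∀ x, l ≠ A.lock x) :
    NLock.acqs P l = NLock.acqs P' l := by
  ext d
  constructor
  · rintro ⟨hd, hdc⟩
    rcases h.nlock_cases hd hdc with ⟨hd', -⟩ | ⟨e', he', c'', hc'', (⟨rfl, k⟩ | ⟨rfl, k⟩)⟩
    · exact ⟨hd', hdc⟩
    · exact absurd (NCall.acq.inj k) (hl _)
    · cases k
  · rintro ⟨hd, hdc⟩
    exact ⟨h.client_mem hd (by simp [hdc]), hdc⟩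

theorem client_rels (h : Layout A P P' R acq acc rel aux) {l} (hl : ∀ x, l ≠ A.lock x) :
    NLock.rels P l = NLock.rels P' l := by
  ext d
  constructor
  · rintro ⟨hd, hdc⟩
    rcases h.nlock_cases hd hdc with ⟨hd', -⟩ | ⟨e', he', c'', hc'', (⟨rfl, k⟩ | ⟨rfl, k⟩)⟩
    · exact ⟨hd', hdc⟩
    · cases k
    · exact absurd (NCall.rel.inj k) (hl _)
  · rintro ⟨hd, hdc⟩
    exact ⟨h.client_mem hd (by simp [hdc]), hdc⟩

theorem client_immPo (h : Layout A P P' R acq acc rel aux) (hP : P.IsPlain) (hP' : P'.IsPlain)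
    {l} (hl : ∀ x, l ≠ A.lock x) {e₁ e₂} :
    NLock.immPo P l e₁ e₂ ↔ NLock.immPo P' l e₁ e₂ := by
  have key : ∀ {d}, d ∈ NLock.acqs P' l ∪ NLock.rels P' l → d ∈ P'.E ∧ ∀ c, d.call ≠ .sc c := by
    rintro d (⟨hd, hdc⟩ | ⟨hd, hdc⟩) <;> exact ⟨hd, by simp [hdc]⟩
  have hpo : ∀ {d₁ d₂}, d₁ ∈ NLock.acqs P' l ∪ NLock.rels P' l →
      d₂ ∈ NLock.acqs P' l ∪ NLock.rels P' l → (P.po d₁ d₂ ↔ P'.po d₁ d₂) := fun k₁ k₂ =>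
    h.client_po_iff hP hP' (key k₁).1 (key k₂).1 (key k₁).2 (key k₂).2
  simp only [NLock.immPo, h.client_acqs hl, h.client_rels hl]
  refine and_congr_right fun k₁ => and_congr_right fun k₂ => and_congr (hpo k₁ k₂) (not_congr ?_)
  exact exists_congr fun d => and_congr_right fun k => and_congr (hpo k₁ k) (hpo k k₂)

/-- If the client uses node locks in a well-formed fashion, then so does the implementation. -/
theorem lockWF (h : Layout A P P' R acq acc rel aux) (hP : P.IsPlain) (hP' : P'.IsPlain)
    (hs : Separated A P') (hl : NLock.LockWF P') : NLock.LockWF P := by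
  intro l
  by_cases hx : ∃ x, l = A.lock x
  · obtain ⟨x, rfl⟩ := hx
    constructor
    · rintro a ⟨ha, hac⟩
      rcases h.nlock_cases ha hac with ⟨ha', -⟩ | ⟨e, he, c, hc, (⟨rfl, k⟩ | ⟨rfl, k⟩)⟩
      · exact absurd hac (hs.acq a ha' x)
      · have := h.immPo_block hP hP' he hc
        -- Distinct abstract locations may share a lock, so only the locks are identified here, not
        -- `x` and `c.loc`.
        rw [NCall.acq.inj k]
        exact ⟨rel e, ⟨h.left_mem _ _ (h.rel_rel he hc), h.rel_call e he c hc⟩, this⟩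
      · cases k
    · rintro r ⟨hr, hrc⟩
      rcases h.nlock_cases hr hrc with ⟨hr', -⟩ | ⟨e, he, c, hc, (⟨rfl, k⟩ | ⟨rfl, k⟩)⟩
      · exact absurd hrc (hs.rel r hr' x)
      · cases k
      · have := h.immPo_block hP hP' he hc
        rw [NCall.rel.inj k]
        exact ⟨acq e, ⟨h.left_mem _ _ (h.rel_acq he hc), h.acq_call e he c hc⟩, this⟩
  · push Not at hx
    simp only [h.client_acqs hx, h.client_rels hx, h.client_immPo hP hP' hx]
    exact hl l

end Layout

end Layout

end Mowgli

namespace Mowgli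

theorem Exec.mem_SE_restrict {Tid Call Val Node : Type*} {G : Exec Tid Call Val Node}
    {M : Set Call} {s} : s ∈ (G.restrict M).SE ↔ s ∈ G.SE ∧ s.1.call ∈ M :=
  ⟨fun h => ⟨⟨h.1.1, h.2.1⟩, h.1.2⟩, fun h => ⟨⟨h.1.1, h.2⟩, h.1.2, h.1.1, h.2⟩⟩

/-! ### Happens-before around critical sections, and ownership of the private locations. -/

section Stamps

variable {Node SLoc Val : Type*}

/-- The stamp of the subevent by which the access to the data reads. -/
def SCall.readStamp (c : SCall SLoc Val) (n : Node) : Stamp Node :=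
  match c with
  | .write _ _ => .nlR n
  | .read _ => .nrR n
  | .cas _ _ _ => .narR n
  | .faa _ _ => .narR n

/-- The stamps of the subevents that a node lock protects. -/
def IsProtected (n : Node) (a : Stamp Node) : Prop :=
  a = .nlR n ∨ a = .nrR n ∨ a = .narR n ∨ a = .nrW n

theorem isProtected_readStamp (c : SCall SLoc Val) (n : Node) : IsProtected n (c.readStamp n) := by
  cases c <;> simp [IsProtected, SCall.readStamp]

end Stamps

section Concrete

variable {Tid Node Loc Lock SLoc Val Wid Other : Type*} [Zero Val] [Add Val]
  {N : Network Tid Node Loc Lock Val} {A : Alloc N SLoc Wid}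
  {G : Rdma.Ex Tid Node Loc Lock SLoc Val Wid Other}
  {P' : Plain Tid (Call Node Loc Lock SLoc Val Wid Other) Val}
  {R : Rdma.Ev Tid Node Loc Lock SLoc Val Wid Other →
    Rdma.Ev Tid Node Loc Lock SLoc Val Wid Other → Prop}
  {acq acc rel aux : Rdma.Ev Tid Node Loc Lock SLoc Val Wid Other →
    Rdma.Ev Tid Node Loc Lock SLoc Val Wid Other}
  {X : Rdma.Witness Tid Node Loc Lock SLoc Val Wid Other}

/-- The node of the data and of the lock of an abstract location. -/
abbrev Alloc.node (A : Alloc N SLoc Wid) (x : SLoc) : Node := N.locNode (A.data x)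

/-- The part of an execution that belongs to the RDMA library. -/
abbrev rdmaPart (G : Rdma.Ex Tid Node Loc Lock SLoc Val Wid Other) :
    Rdma.Ex Tid Node Loc Lock SLoc Val Wid Other := G.restrict (Set.range Call.rdma)

/-- A consistent execution of the implementation, with well-formed locks. -/
structure Concrete (A : Alloc N SLoc Wid) (G : Rdma.Ex Tid Node Loc Lock SLoc Val Wid Other)
    (P' : Plain Tid (Call Node Loc Lock SLoc Val Wid Other) Val)
    (R : Rdma.Ev Tid Node Loc Lock SLoc Val Wid Other →
      Rdma.Ev Tid Node Loc Lock SLoc Val Wid Other → Prop)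
    (acq acc rel aux : Rdma.Ev Tid Node Loc Lock SLoc Val Wid Other →
      Rdma.Ev Tid Node Loc Lock SLoc Val Wid Other)
    (X : Rdma.Witness Tid Node Loc Lock SLoc Val Wid Other) : Prop
    extends Layout A G.toPlain P' R acq acc rel aux where
  exec : G.IsExec
  plain' : P'.IsPlain
  sep : Separated A P'
  hb_irrefl : ∀ s, ¬ G.hb s s
  rdma : ∀ e ∈ G.E, ∀ c, e.call = .rdma c → G.stmp e ∈ c.stamps N e.out
  wf : X.WF N (rdmaPart G)
  hb_of_so : ∀ s₁ s₂, Rdma.soSpec (rdmaPart G) X s₁ s₂ → G.hb s₁ s₂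
  acq_stmp : ∀ e ∈ G.E, ∀ l, e.call = .nlock (.acq l) → G.stmp e = {.aMF}
  rel_stmp : ∀ e ∈ G.E, ∀ l, e.call = .nlock (.rel l) →
    G.stmp e = {.nF (N.lockNode l), .nrW (N.lockNode l)}
  nlock_out : ∀ e ∈ G.E, ∀ c, e.call = .nlock c → e.out = N.unit
  hb_release : ∀ e ∈ G.E, ∀ l, e.call = .nlock (.rel l) →
    G.hb (e, .nF (N.lockNode l)) (e, .nrW (N.lockNode l))
  lock_total : ∀ l a₁ a₂ r₁ r₂, a₁ ∈ NLock.acqs G.toPlain l → a₂ ∈ NLock.acqs G.toPlain l →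
    NLock.immPo G.toPlain l a₁ r₁ → NLock.immPo G.toPlain l a₂ r₂ → a₁ ≠ a₂ →
    G.hb (r₁, .nrW (N.lockNode l)) (a₂, .aMF) ∨ G.hb (r₂, .nrW (N.lockNode l)) (a₁, .aMF)

namespace Concrete

theorem plain (h : Concrete A G P' R acq acc rel aux X) : G.toPlain.IsPlain := h.exec.1

theorem hb_trans (h : Concrete A G P' R acq acc rel aux X) {s₁ s₂ s₃} (h₁ : G.hb s₁ s₂)
    (h₂ : G.hb s₂ s₃) : G.hb s₁ s₃ := h.exec.2.2.2.1 _ _ _ h₁ h₂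

theorem hb_of_po (h : Concrete A G P' R acq acc rel aux X) {e₁ e₂} {a₁ a₂ : Stamp Node}
    (h₁ : (e₁, a₁) ∈ G.SE) (h₂ : (e₂, a₂) ∈ G.SE) (hp : G.po e₁ e₂) (hs : a₁.sto a₂) :
    G.hb (e₁, a₁) (e₂, a₂) := h.exec.2.2.2.2.2 _ _ ⟨h₁, h₂, hp, hs⟩

theorem hb_asymm (h : Concrete A G P' R acq acc rel aux X) {s₁ s₂} (h₁ : G.hb s₁ s₂)
    (h₂ : G.hb s₂ s₁) : False := h.hb_irrefl _ (h.hb_trans h₁ h₂)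

section Block

variable {e : Rdma.Ev Tid Node Loc Lock SLoc Val Wid Other} {c : SCall SLoc Val}

theorem acq_mem (h : Concrete A G P' R acq acc rel aux X) (he : e ∈ P'.E)
    (hc : e.call = .sc c) : acq e ∈ G.E := h.left_mem _ _ (h.rel_acq he hc)

theorem acc_mem (h : Concrete A G P' R acq acc rel aux X) (he : e ∈ P'.E)
    (hc : e.call = .sc c) : acc e ∈ G.E := h.left_mem _ _ (h.rel_acc he hc)

theorem rel_mem (h : Concrete A G P' R acq acc rel aux X) (he : e ∈ P'.E)
    (hc : e.call = .sc c) : rel e ∈ G.E := h.left_mem _ _ (h.rel_rel he hc)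

theorem aux_mem (h : Concrete A G P' R acq acc rel aux X) (he : e ∈ P'.E)
    (hc : e.call = .sc c) : aux e ∈ G.E := h.left_mem _ _ (h.rel_aux he hc)

theorem acq_SE (h : Concrete A G P' R acq acc rel aux X) (he : e ∈ P'.E)
    (hc : e.call = .sc c) : (acq e, Stamp.aMF) ∈ G.SE := by
  refine ⟨h.acq_mem he hc, ?_⟩
  rw [h.acq_stmp _ (h.acq_mem he hc) _ (h.acq_call e he c hc)]
  rfl

theorem rel_nF_SE (h : Concrete A G P' R acq acc rel aux X) (he : e ∈ P'.E)
    (hc : e.call = .sc c) : (rel e, Stamp.nF (A.node c.loc)) ∈ G.SE := by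
  refine ⟨h.rel_mem he hc, ?_⟩
  rw [h.rel_stmp _ (h.rel_mem he hc) _ (h.rel_call e he c hc), A.lock_node]
  exact Or.inl rfl

theorem rel_nrW_SE (h : Concrete A G P' R acq acc rel aux X) (he : e ∈ P'.E)
    (hc : e.call = .sc c) : (rel e, Stamp.nrW (A.node c.loc)) ∈ G.SE := by
  refine ⟨h.rel_mem he hc, ?_⟩
  rw [h.rel_stmp _ (h.rel_mem he hc) _ (h.rel_call e he c hc), A.lock_node]
  exact Or.inr rfl

theorem acc_stmp (h : Concrete A G P' R acq acc rel aux X) (he : e ∈ P'.E)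
    (hc : e.call = .sc c) :
    G.stmp (acc e) ∈ (c.access A e.thread).stamps N (acc e).out :=
  h.rdma _ (h.acc_mem he hc) _ (h.acc_call e he c hc)

theorem acc_readStamp_SE (h : Concrete A G P' R acq acc rel aux X) (he : e ∈ P'.E)
    (hc : e.call = .sc c) : (acc e, c.readStamp (A.node c.loc)) ∈ G.SE := by
  refine ⟨h.acc_mem he hc, ?_⟩
  have hs := h.acc_stmp he hc
  cases c <;>
    simp only [SCall.access, RCall.stamps, Set.mem_singleton_iff, Set.mem_insert_iff] at hs
  case cas => rcases hs with hs | hs <;> simp [hs, SCall.readStamp, SCall.loc]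
  all_goals simp [hs, SCall.readStamp, SCall.loc]

theorem acc_nlW_SE (h : Concrete A G P' R acq acc rel aux X) (he : e ∈ P'.E)
    (hc : e.call = .sc c) (hw : ¬ c.IsWrite) :
    (acc e, Stamp.nlW (A.node c.loc)) ∈ G.SE := by
  refine ⟨h.acc_mem he hc, ?_⟩
  have hs := h.acc_stmp he hc
  cases c <;>
    simp only [SCall.access, RCall.stamps, Set.mem_singleton_iff, Set.mem_insert_iff] at hs
  case write => exact absurd ⟨_, _, rfl⟩ hw
  case cas => rcases hs with hs | hs <;> simp [hs, SCall.loc]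
  all_goals simp [hs, SCall.loc]

theorem acc_call_mem (h : Concrete A G P' R acq acc rel aux X) (he : e ∈ P'.E)
    (hc : e.call = .sc c) : (acc e).call ∈ Set.range (Call.rdma :
      _ → Call Node Loc Lock SLoc Val Wid Other) := ⟨_, (h.acc_call e he c hc).symm⟩

theorem acc_part (h : Concrete A G P' R acq acc rel aux X) (he : e ∈ P'.E)
    (hc : e.call = .sc c) {a} (ha : (acc e, a) ∈ G.SE) : (acc e, a) ∈ (rdmaPart G).SE :=
  Exec.mem_SE_restrict.2 ⟨ha, h.acc_call_mem he hc⟩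

/-- The two stamps of a release serve this purpose. Preserved program order puts `nlR`, `narR` and
`nrW` before the `nrW` of the release; `nrR` is only ordered before its `nF`, from which the
internal edge of the release leads to its `nrW`. -/
theorem hb_acc_rel (h : Concrete A G P' R acq acc rel aux X) (he : e ∈ P'.E)
    (hc : e.call = .sc c) {a} (ha : IsProtected (A.node c.loc) a) (hs : (acc e, a) ∈ G.SE) :
    G.hb (acc e, a) (rel e, .nrW (A.node c.loc)) := by
  have hp := h.po_acc_rel e he c hc
  have hr := h.hb_release _ (h.rel_mem he hc) _ (h.rel_call e he c hc)
  rw [A.lock_node] at hr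
  rcases ha with rfl | rfl | rfl | rfl
  · exact h.hb_of_po hs (h.rel_nrW_SE he hc) hp rfl
  · exact h.hb_trans (h.hb_of_po hs (h.rel_nF_SE he hc) hp rfl) hr
  · exact h.hb_of_po hs (h.rel_nrW_SE he hc) hp rfl
  · exact h.hb_of_po hs (h.rel_nrW_SE he hc) hp rfl

theorem hb_acq_acc (h : Concrete A G P' R acq acc rel aux X) (he : e ∈ P'.E)
    (hc : e.call = .sc c) {a} (hs : (acc e, a) ∈ G.SE) : G.hb (acq e, .aMF) (acc e, a) :=
  h.hb_of_po (h.acq_SE he hc) hs (h.po_acq_acc e he c hc) trivial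

theorem hb_acq_rel (h : Concrete A G P' R acq acc rel aux X) (he : e ∈ P'.E)
    (hc : e.call = .sc c) : G.hb (acq e, .aMF) (rel e, .nrW (A.node c.loc)) :=
  h.hb_of_po (h.acq_SE he hc) (h.rel_nrW_SE he hc)
    (h.plain.trans (h.po_acq_acc e he c hc) (h.po_acc_rel e he c hc)) trivial

end Block

section Order

variable {e₁ e₂ : Rdma.Ev Tid Node Loc Lock SLoc Val Wid Other} {c₁ c₂ : SCall SLoc Val}

/-- The critical sections on one abstract location are ordered. -/
theorem before_total (h : Concrete A G P' R acq acc rel aux X) (he₁ : e₁ ∈ P'.E)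
    (he₂ : e₂ ∈ P'.E) (hc₁ : e₁.call = .sc c₁) (hc₂ : e₂.call = .sc c₂) (hl : c₁.loc = c₂.loc)
    (hne : e₁ ≠ e₂) :
    G.hb (rel e₁, .nrW (A.node c₁.loc)) (acq e₂, .aMF) ∨
      G.hb (rel e₂, .nrW (A.node c₂.loc)) (acq e₁, .aMF) := by
  have i₁ := h.immPo_block h.plain h.plain' he₁ hc₁
  have i₂ := h.immPo_block h.plain h.plain' he₂ hc₂
  have hne' : acq e₁ ≠ acq e₂ := fun k =>
    hne (h.unique _ _ _ (h.rel_acq he₁ hc₁) (k ▸ h.rel_acq he₂ hc₂))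
  have := h.lock_total (A.lock c₁.loc) (acq e₁) (acq e₂) (rel e₁) (rel e₂)
    ⟨h.acq_mem he₁ hc₁, h.acq_call _ he₁ _ hc₁⟩
    ⟨h.acq_mem he₂ hc₂, hl ▸ h.acq_call _ he₂ _ hc₂⟩ i₁ (hl ▸ i₂) hne'
  rwa [A.lock_node, hl] at *

theorem hb_acc_of_before (h : Concrete A G P' R acq acc rel aux X) (he₁ : e₁ ∈ P'.E)
    (he₂ : e₂ ∈ P'.E) (hc₁ : e₁.call = .sc c₁) (hc₂ : e₂.call = .sc c₂)
    (hb : G.hb (rel e₁, .nrW (A.node c₁.loc)) (acq e₂, .aMF)) {a₁ a₂}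
    (ha₁ : IsProtected (A.node c₁.loc) a₁) (hs₁ : (acc e₁, a₁) ∈ G.SE)
    (hs₂ : (acc e₂, a₂) ∈ G.SE) : G.hb (acc e₁, a₁) (acc e₂, a₂) :=
  h.hb_trans (h.hb_acc_rel he₁ hc₁ ha₁ hs₁) (h.hb_trans hb (h.hb_acq_acc he₂ hc₂ hs₂))

/-- Happens-before between accesses to one location agrees with the order of the critical
sections. -/
theorem hb_acq_of_hb_acc (h : Concrete A G P' R acq acc rel aux X) (he₁ : e₁ ∈ P'.E)
    (he₂ : e₂ ∈ P'.E) (hc₁ : e₁.call = .sc c₁) (hc₂ : e₂.call = .sc c₂) (hl : c₁.loc = c₂.loc)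
    (hne : e₁ ≠ e₂) {a₁ a₂} (ha₂ : IsProtected (A.node c₂.loc) a₂)
    (hs₁ : (acc e₁, a₁) ∈ G.SE) (hs₂ : (acc e₂, a₂) ∈ G.SE)
    (hb : G.hb (acc e₁, a₁) (acc e₂, a₂)) : G.hb (acq e₁, .aMF) (acq e₂, .aMF) := by
  rcases h.before_total he₁ he₂ hc₁ hc₂ hl hne with k | k
  · exact h.hb_trans (h.hb_acq_rel he₁ hc₁) k
  -- If the second critical section came first, its protected access would precede its release,
  -- hence the first acquisition and the first access: a cycle with `hb`.
  · exact (h.hb_asymm hb (h.hb_acc_of_before he₂ he₁ hc₂ hc₁ k ha₂ hs₂ hs₁)).elim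

/-- Acquisitions in program order are ordered by their `aMF` stamps, so the lock cannot order the
two sections the other way. -/
theorem before_of_po (h : Concrete A G P' R acq acc rel aux X) (he₁ : e₁ ∈ P'.E)
    (he₂ : e₂ ∈ P'.E) (hc₁ : e₁.call = .sc c₁) (hc₂ : e₂.call = .sc c₂) (hl : c₁.loc = c₂.loc)
    (hp : P'.po e₁ e₂) : G.hb (rel e₁, .nrW (A.node c₁.loc)) (acq e₂, .aMF) := by
  have hne := h.plain'.ne hp
  refine (h.before_total he₁ he₂ hc₁ hc₂ hl hne).resolve_right fun k => ?_
  have := (h.po_iff _ _ _ _ (h.rel_acq he₁ hc₁) (h.rel_acq he₂ hc₂) hne).2 hp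
  exact h.hb_asymm (h.hb_trans (h.hb_acq_rel he₂ hc₂) k)
    (h.hb_of_po (h.acq_SE he₁ hc₁) (h.acq_SE he₂ hc₂) this trivial)

end Order

/-- The write subevents of the RDMA library. -/
theorem writes_cases (h : Concrete A G P' R acq acc rel aux X)
    {s : Rdma.SEv Tid Node Loc Lock SLoc Val Wid Other} (hs : s ∈ Rdma.writes (rdmaPart G)) :
    (s.1 ∈ P'.E ∧ ∃ c, s.1.call = .rdma c) ∨ ∃ e ∈ P'.E, ∃ c, e.call = .sc c ∧
      ((s = (acc e, .nrW (A.node c.loc)) ∧ Rdma.loc s = {A.data c.loc}) ∨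
       (¬ c.IsWrite ∧ s = (acc e, .nlW (A.node c.loc)) ∧ Rdma.loc s = {A.res e.thread}) ∨
       (c.IsWrite ∧ s = (aux e, .aCW) ∧ Rdma.loc s = {A.tmp c.loc e.thread})) := by
  obtain ⟨d, a⟩ := s
  obtain ⟨hd, hw⟩ := hs
  rw [Exec.mem_SE_restrict] at hd
  obtain ⟨⟨hd, ha⟩, r, hr⟩ := hd
  dsimp only at hd ha hr hw
  obtain ⟨e, hR⟩ := h.total d hd
  have he := h.right_mem _ _ hR
  by_cases hc : ∀ c, e.call ≠ .sc c
  · obtain rfl := (h.client e he hc d).1 hR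
    exact Or.inl ⟨he, r, hr.symm⟩
  push Not at hc
  obtain ⟨c, hc⟩ := hc
  refine Or.inr ⟨e, he, c, hc, ?_⟩
  have h₁ := h.acq_call e he _ hc
  have h₂ := h.acc_call e he _ hc
  have h₃ := h.rel_call e he _ hc
  have hst := h.acc_stmp he hc
  by_cases hcw : c.IsWrite
  · obtain ⟨x, v, rfl⟩ := hcw
    obtain ⟨-, h₄, -, -, h₅⟩ := h.write e he x v hc
    rcases (h₅ d).1 hR with rfl | rfl | rfl | rfl
    · rw [h₁] at hr; cases hr
    · have := h.rdma _ hd _ h₄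
      simp only [RCall.stamps, Set.mem_singleton_iff] at this
      rw [this] at ha
      obtain rfl := ha
      exact Or.inr (Or.inr ⟨⟨x, v, rfl⟩, rfl, by simp [Rdma.loc, h₄, RCall.subLoc, SCall.loc]⟩)
    · simp only [SCall.access, RCall.stamps, Set.mem_singleton_iff] at hst
      rw [hst] at ha
      rcases ha with rfl | rfl
      · simp at hw
      · exact Or.inl ⟨rfl, by simp [Rdma.loc, h₂, RCall.subLoc, SCall.access, SCall.loc]⟩
    · rw [h₃] at hr; cases hr
  · obtain ⟨h₄, -, -, h₅⟩ := h.fetch e he c hc hcw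
    rw [Layout.lastEvent_fetch hc hcw] at h₅
    rcases (h₅ d).1 hR with rfl | rfl | rfl | rfl | rfl
    · rw [h₁] at hr; cases hr
    · cases c <;> simp only [SCall.access, RCall.stamps, Set.mem_singleton_iff,
        Set.mem_insert_iff] at hst
      case write x v => exact absurd ⟨x, v, rfl⟩ hcw
      -- The only access with two possible sets of stamps: without `nrW` on failure, with it on
      -- success.
      case cas =>
        rcases hst with hst | hst <;> rw [hst] at ha <;>
          simp only [Set.mem_singleton_iff, Set.mem_insert_iff] at ha
        · rcases ha with rfl | rfl
          · simp at hw
          · exact Or.inr (Or.inl ⟨hcw, rfl, by simp [Rdma.loc, h₂, RCall.subLoc, SCall.access]⟩)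
        · rcases ha with rfl | rfl | rfl
          · simp at hw
          · exact Or.inl ⟨rfl, by simp [Rdma.loc, h₂, RCall.subLoc, SCall.access, SCall.loc]⟩
          · exact Or.inr (Or.inl ⟨hcw, rfl, by simp [Rdma.loc, h₂, RCall.subLoc, SCall.access]⟩)
      case read =>
        rw [hst] at ha
        rcases ha with rfl | rfl
        · simp at hw
        · exact Or.inr (Or.inl ⟨hcw, rfl, by simp [Rdma.loc, h₂, RCall.subLoc, SCall.access]⟩)
      case faa =>
        rw [hst] at ha
        rcases ha with rfl | rfl | rfl
        · simp at hw
        · exact Or.inl ⟨rfl, by simp [Rdma.loc, h₂, RCall.subLoc, SCall.access, SCall.loc]⟩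
        · exact Or.inr (Or.inl ⟨hcw, rfl, by simp [Rdma.loc, h₂, RCall.subLoc, SCall.access]⟩)
    · rw [h₃] at hr; cases hr
    · have := h.rdma _ hd _ h₄
      simp only [RCall.stamps, Set.mem_singleton_iff] at this
      rw [this] at ha
      obtain rfl := ha
      simp at hw
    · have := h.rdma _ hd _ rfl
      simp only [RCall.stamps, Set.mem_singleton_iff] at this
      rw [this] at ha
      obtain rfl := ha
      simp at hw

theorem client_loc (h : Concrete A G P' R acq acc rel aux X)
    {s : Rdma.SEv Tid Node Loc Lock SLoc Val Wid Other} (hs : s.1 ∈ P'.E)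
    (hc : ∃ c, s.1.call = .rdma c) {y} (hy : Rdma.loc s = {y}) (x t) :
    y ≠ A.data x ∧ y ≠ A.res t ∧ y ≠ A.tmp x t := by
  obtain ⟨c, hc⟩ := hc
  exact h.sep.rdma _ hs c hc y (Rdma.loc_subset hc (hy ▸ rfl)) x t

/-- Each location of the implementation is written by one kind of subevent only, because all its
locations are distinct and the client avoids them. The thread `t` serves only to instantiate
`Separated.rdma`. -/
theorem write_data (h : Concrete A G P' R acq acc rel aux X)
    {s : Rdma.SEv Tid Node Loc Lock SLoc Val Wid Other} (hs : s ∈ Rdma.writes (rdmaPart G)) {x}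
    (t : Tid) (hx : Rdma.loc s = {A.data x}) :
    ∃ e ∈ P'.E, ∃ c, e.call = .sc c ∧ c.loc = x ∧ s = (acc e, .nrW (A.node c.loc)) := by
  rcases h.writes_cases hs with ⟨k, hc⟩ | ⟨e, he, c, hc, ⟨rfl, k⟩ | ⟨-, -, k⟩ | ⟨-, -, k⟩⟩
  · exact absurd rfl (h.client_loc k hc hx x t).1
  · exact ⟨e, he, c, hc, A.data_inj (Set.singleton_injective (k.symm.trans hx)), rfl⟩
  · exact absurd (Set.singleton_injective (hx.symm.trans k)) (A.data_ne_res _ _)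
  · exact absurd (Set.singleton_injective (hx.symm.trans k)) (A.data_ne_tmp _ _ _)

theorem write_res (h : Concrete A G P' R acq acc rel aux X)
    {s : Rdma.SEv Tid Node Loc Lock SLoc Val Wid Other} (hs : s ∈ Rdma.writes (rdmaPart G)) {t}
    (x : SLoc) (hx : Rdma.loc s = {A.res t}) :
    ∃ e ∈ P'.E, ∃ c, e.call = .sc c ∧ ¬ c.IsWrite ∧ e.thread = t ∧
      s = (acc e, .nlW (A.node c.loc)) := by
  rcases h.writes_cases hs with ⟨k, hc⟩ | ⟨e, he, c, hc, ⟨-, k⟩ | ⟨hw, rfl, k⟩ | ⟨-, -, k⟩⟩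
  · exact absurd rfl (h.client_loc k hc hx x t).2.1
  · exact absurd (Set.singleton_injective (k.symm.trans hx)) (A.data_ne_res _ _)
  · exact ⟨e, he, c, hc, hw, A.res_inj (Set.singleton_injective (k.symm.trans hx)), rfl⟩
  · exact absurd (Set.singleton_injective (hx.symm.trans k)) (A.res_ne_tmp _ _ _)

theorem write_tmp (h : Concrete A G P' R acq acc rel aux X)
    {s : Rdma.SEv Tid Node Loc Lock SLoc Val Wid Other} (hs : s ∈ Rdma.writes (rdmaPart G)) {x t}
    (hx : Rdma.loc s = {A.tmp x t}) :
    ∃ e ∈ P'.E, ∃ c, e.call = .sc c ∧ c.IsWrite ∧ c.loc = x ∧ e.thread = t ∧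
      s = (aux e, .aCW) := by
  rcases h.writes_cases hs with ⟨k, hc⟩ | ⟨e, he, c, hc, ⟨-, k⟩ | ⟨-, -, k⟩ | ⟨hw, rfl, k⟩⟩
  · exact absurd rfl (h.client_loc k hc hx x t).2.2
  · exact absurd (Set.singleton_injective (k.symm.trans hx)) (A.data_ne_tmp _ _ _)
  · exact absurd (Set.singleton_injective (k.symm.trans hx)) (A.res_ne_tmp _ _ _)
  · obtain ⟨h₁, h₂⟩ := A.tmp_inj _ _ _ _ (Set.singleton_injective (k.symm.trans hx))
    exact ⟨e, he, c, hc, hw, h₁, h₂, rfl⟩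

end Concrete

end Concrete

end Mowgli

namespace Mowgli

theorem Exec.stmp_restrict {Tid Call Val Node : Type*} {G : Exec Tid Call Val Node}
    {M : Set Call} {e} (he : e ∈ G.E) (hc : e.call ∈ M) : (G.restrict M).stmp e = G.stmp e :=
  Set.ext fun _ => ⟨fun h => h.1, fun h => ⟨h, he, hc⟩⟩

/-! ### Values read and written by the implementation. -/

section Values

variable {Tid Node Loc Lock SLoc Val Wid Other : Type*} [Zero Val] [Add Val]
  {N : Network Tid Node Loc Lock Val} {A : Alloc N SLoc Wid}
  {G : Rdma.Ex Tid Node Loc Lock SLoc Val Wid Other}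
  {P' : Plain Tid (Call Node Loc Lock SLoc Val Wid Other) Val}
  {R : Rdma.Ev Tid Node Loc Lock SLoc Val Wid Other →
    Rdma.Ev Tid Node Loc Lock SLoc Val Wid Other → Prop}
  {acq acc rel aux : Rdma.Ev Tid Node Loc Lock SLoc Val Wid Other →
    Rdma.Ev Tid Node Loc Lock SLoc Val Wid Other}
  {X : Rdma.Witness Tid Node Loc Lock SLoc Val Wid Other}

namespace Concrete

theorem hb_of_iso (h : Concrete A G P' R acq acc rel aux X) {s₁ s₂}
    (k : Rdma.iso (rdmaPart G) s₁ s₂) : G.hb s₁ s₂ := h.hb_of_so _ _ (Or.inl k)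

theorem hb_of_rf (h : Concrete A G P' R acq acc rel aux X) {w r} (k : X.rf w r)
    (hi : ¬ (w.2 = .aCW ∧ r.2 = .aCR)) : G.hb w r :=
  h.hb_of_so _ _ (Or.inr (Or.inl ⟨k, fun l => hi ⟨l.1, l.2.1⟩⟩))

theorem hb_of_pfg (h : Concrete A G P' R acq acc rel aux X) {s₁ s₂}
    (k : Rdma.pfg (rdmaPart G) s₁ s₂) : G.hb s₁ s₂ :=
  h.hb_of_so _ _ (Or.inr (Or.inr (Or.inl k)))

theorem hb_of_rb (h : Concrete A G P' R acq acc rel aux X) {s₁ s₂}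
    (k : Rdma.rb (rdmaPart G) X s₁ s₂) : G.hb s₁ s₂ :=
  h.hb_of_so _ _ (Or.inr (Or.inr (Or.inr (Or.inr (Or.inl k)))))

theorem hb_of_mo (h : Concrete A G P' R acq acc rel aux X) {s₁ s₂}
    (k : X.mo s₁ s₂) : G.hb s₁ s₂ :=
  h.hb_of_so _ _ (Or.inr (Or.inr (Or.inr (Or.inr (Or.inr (Or.inl k))))))

/-- A read `r` reads from a write `w₀` that happens before it if all other writes to the location
happen before `w₀` or after `r`. -/
theorem rf_of_hb (h : Concrete A G P' R acq acc rel aux X) {w₀ r} {x : Loc}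
    (hw₀ : w₀ ∈ Rdma.writes (rdmaPart G)) (hr : r ∈ Rdma.reads (rdmaPart G))
    (hlw : Rdma.loc w₀ = {x}) (hlr : Rdma.loc r = {x}) (hb : G.hb w₀ r)
    (ho : ∀ w ∈ Rdma.writes (rdmaPart G), Rdma.loc w = {x} → w ≠ w₀ →
      ¬ (w.2 = .aCW ∧ r.2 = .aCR) ∧ (G.hb w w₀ ∨ G.hb r w)) : X.rf w₀ r := by
  have hne : r ≠ w₀ := by
    rintro rfl
    exact h.hb_irrefl _ hb
  by_contra hrf
  -- Otherwise `r` has no source or reads from some `w` other than `w₀`. In the first case `r` is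
  -- reads-before `w₀`. In the second, `w₀` cannot precede `w` in modification order: `w` happens
  -- before `w₀`, or else after `r`, which its external reads-from edge forbids. So `w` precedes
  -- `w₀`, and `r` is again reads-before `w₀`, against `hb`.
  refine h.hb_asymm hb (h.hb_of_rb ⟨hr, hw₀, ?_, hlr.trans hlw.symm, hne⟩)
  by_cases hex : ∃ w, X.rf w r
  swap
  · push Not at hex
    exact Or.inr hex
  obtain ⟨w, hw⟩ := hex
  obtain ⟨hww, -, hl, -⟩ := h.wf.rf_mo.1 _ _ hw
  have hne' : w ≠ w₀ := by
    rintro rfl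
    exact hrf hw
  obtain ⟨hi, k⟩ := ho w hww (hl.trans hlr) hne'
  refine Or.inl ⟨w, hw, ?_⟩
  rcases h.wf.rf_mo.isModOrder.total w hww w₀ hw₀ x (hl.trans hlr) hlw hne' with m | m
  · exact m
  · rcases k with k | k
    · exact (h.hb_asymm k (h.hb_of_mo m)).elim
    · exact (h.hb_asymm k (h.hb_of_rf hw hi)).elim

variable {e : Rdma.Ev Tid Node Loc Lock SLoc Val Wid Other} {c : SCall SLoc Val}

theorem aux_aWT_SE (h : Concrete A G P' R acq acc rel aux X) (he : e ∈ P'.E)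
    (hc : e.call = .sc c) (hw : ¬ c.IsWrite) : (aux e, Stamp.aWT) ∈ G.SE := by
  refine ⟨h.aux_mem he hc, ?_⟩
  have := h.rdma _ (h.aux_mem he hc) _ (h.fetch e he c hc hw).1
  simp only [RCall.stamps, Set.mem_singleton_iff] at this
  rw [this]
  rfl

/-- The shared work identifier is essential: the stamp order puts `nlW` before `nlW` and `gF` only,
so program order alone would not make the result visible to the CPU. -/
theorem hb_nlW_wait (h : Concrete A G P' R acq acc rel aux X) (he : e ∈ P'.E)
    (hc : e.call = .sc c) (hw : ¬ c.IsWrite) :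
    G.hb (acc e, .nlW (A.node c.loc)) (aux e, .aWT) := by
  have ha := h.acc_call e he c hc
  have hx := (h.fetch e he c hc hw).1
  refine h.hb_of_pfg ⟨h.acc_part he hc (h.acc_nlW_SE he hc hw),
    Exec.mem_SE_restrict.2 ⟨h.aux_aWT_SE he hc hw, ⟨_, hx.symm⟩⟩, ⟨_, rfl⟩, rfl,
    ⟨h.plain.trans (h.po_acc_rel e he c hc) (h.fetch e he c hc hw).2.1, ⟨_, ha.symm⟩,
      ⟨_, hx.symm⟩⟩, _, _, A.wid e.thread, ha, hx, ?_, rfl⟩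
  cases c with
  | write x v => exact absurd ⟨x, v, rfl⟩ hw
  | _ => rfl

theorem nlW_mem_writes (h : Concrete A G P' R acq acc rel aux X) (he : e ∈ P'.E)
    (hc : e.call = .sc c) (hw : ¬ c.IsWrite) :
    (acc e, Stamp.nlW (A.node c.loc)) ∈ Rdma.writes (rdmaPart G) :=
  ⟨h.acc_part he hc (h.acc_nlW_SE he hc hw), Or.inr (Or.inr ⟨_, Or.inl rfl⟩)⟩

theorem loc_nlW (h : Concrete A G P' R acq acc rel aux X) (he : e ∈ P'.E)
    (hc : e.call = .sc c) (hw : ¬ c.IsWrite) (n : Node) :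
    Rdma.loc (acc e, Stamp.nlW n) = {A.res e.thread} := by
  simp only [Rdma.loc, h.acc_call e he c hc]
  cases c with
  | write x v => exact absurd ⟨x, v, rfl⟩ hw
  | _ => rfl

theorem vR_acc_eq_vW_nlW (h : Concrete A G P' R acq acc rel aux X) (he : e ∈ P'.E)
    (hc : e.call = .sc c) (hw : ¬ c.IsWrite) :
    X.vR (acc e, c.readStamp (A.node c.loc)) = X.vW (acc e, .nlW (A.node c.loc)) := by
  have h₁ := h.acc_part he hc (h.acc_readStamp_SE he hc)
  have h₂ := h.acc_part he hc (h.acc_nlW_SE he hc hw)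
  cases c with
  | write x v => exact absurd ⟨x, v, rfl⟩ hw
  | read x => exact h.wf.copy_get _ _ h₁ h₂
  | cas x v₁ v₂ => exact h.wf.copy_rmw _ _ h₁ h₂
  | faa x v => exact h.wf.copy_rmw _ _ h₁ h₂

/-- The output of an abstract event is the value read by its access to the data. -/
theorem vR_acc (h : Concrete A G P' R acq acc rel aux X) (he : e ∈ P'.E)
    (hc : e.call = .sc c) (hw : ¬ c.IsWrite) :
    X.vR (acc e, c.readStamp (A.node c.loc)) = e.out := by
  obtain ⟨-, -, hpo, -⟩ := h.fetch e he c hc hw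
  have hRl := h.last he
  have hlE := h.left_mem _ _ hRl
  have hl := Layout.lastEvent_fetch (A := A) hc hw
  have hlc : (lastEvent A e).call = .rdma (.read (A.res e.thread)) := by rw [hl]
  have hlS : (lastEvent A e, Stamp.aCR) ∈ G.SE := by
    refine ⟨hlE, ?_⟩
    have := h.rdma _ hlE _ hlc
    simp only [RCall.stamps, Set.mem_singleton_iff] at this
    rw [this]
    rfl
  have hlr : (lastEvent A e, Stamp.aCR) ∈ Rdma.reads (rdmaPart G) :=
    ⟨Exec.mem_SE_restrict.2 ⟨hlS, ⟨_, hlc.symm⟩⟩, Or.inl rfl⟩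
  have hll : Rdma.loc (lastEvent A e, Stamp.aCR) = {A.res e.thread} := by
    simp [Rdma.loc, hlc, RCall.subLoc]
  have hrf : X.rf (acc e, .nlW (A.node c.loc)) (lastEvent A e, .aCR) := by
    refine h.rf_of_hb (h.nlW_mem_writes he hc hw) hlr (h.loc_nlW he hc hw _) hll
      (h.hb_trans (h.hb_nlW_wait he hc hw) (h.hb_of_po (h.aux_aWT_SE he hc hw) hlS hpo trivial)) ?_
    intro w hww hwl hne
    obtain ⟨e₀, he₀, c₀, hc₀, hw₀, ht, rfl⟩ := h.write_res hww c.loc hwl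
    refine ⟨by simp, ?_⟩
    have hne' : e₀ ≠ e := by
      rintro rfl
      obtain rfl : c₀ = c := by rw [hc₀] at hc; exact Call.sc.inj hc
      exact hne rfl
    rcases h.plain'.2.2.2 e₀ he₀ e he ht hne' with k | k
    · have := (h.po_iff _ _ _ _ (h.rel_aux he₀ hc₀) (h.rel_acc he hc) hne').2 k
      exact Or.inl (h.hb_trans (h.hb_nlW_wait he₀ hc₀ hw₀)
        (h.hb_of_po (h.aux_aWT_SE he₀ hc₀ hw₀) (h.acc_nlW_SE he hc hw) this trivial))
    · have := (h.po_iff _ _ _ _ hRl (h.rel_acc he₀ hc₀) hne'.symm).2 k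
      exact Or.inr (h.hb_of_po hlS (h.acc_nlW_SE he₀ hc₀ hw₀) this trivial)
  rw [h.vR_acc_eq_vW_nlW he hc hw, (h.wf.rf_mo.1 _ _ hrf).2.2.2, h.wf.vR_read _ hlr _ hlc, hl]

theorem acc_nrW_SE_write (h : Concrete A G P' R acq acc rel aux X) (he : e ∈ P'.E)
    (hc : e.call = .sc c) (hw : c.IsWrite) : (acc e, Stamp.nrW (A.node c.loc)) ∈ G.SE := by
  obtain ⟨x, v, rfl⟩ := hw
  refine ⟨h.acc_mem he hc, ?_⟩
  have hs := h.acc_stmp he hc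
  simp only [SCall.access, RCall.stamps, Set.mem_singleton_iff] at hs
  simp [hs, SCall.loc]

theorem aux_aCW_SE (h : Concrete A G P' R acq acc rel aux X) (he : e ∈ P'.E)
    (hc : e.call = .sc c) (hw : c.IsWrite) : (aux e, Stamp.aCW) ∈ G.SE := by
  obtain ⟨x, v, rfl⟩ := hw
  refine ⟨h.aux_mem he hc, ?_⟩
  have := h.rdma _ (h.aux_mem he hc) _ (h.write e he x v hc).2.1
  simp only [RCall.stamps, Set.mem_singleton_iff] at this
  rw [this]
  rfl

/-- The value written by an abstract write is the value put by its access to the data. -/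
theorem vW_acc_write (h : Concrete A G P' R acq acc rel aux X) (he : e ∈ P'.E) {x v}
    (hc : e.call = .sc (.write x v)) : X.vW (acc e, .nrW (A.node x)) = v := by
  obtain ⟨-, hxc, -, hpo, -⟩ := h.write e he x v hc
  have hw : (SCall.write x v).IsWrite := ⟨x, v, rfl⟩
  have hac := h.acc_call e he _ hc
  have hrS : (acc e, Stamp.nlR (A.node x)) ∈ G.SE := h.acc_readStamp_SE he hc
  have hr : (acc e, Stamp.nlR (A.node x)) ∈ Rdma.reads (rdmaPart G) :=
    ⟨h.acc_part he hc hrS, Or.inr (Or.inr ⟨_, Or.inl rfl⟩)⟩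
  have hxS := h.aux_aCW_SE he hc hw
  have hxw : (aux e, Stamp.aCW) ∈ Rdma.writes (rdmaPart G) :=
    ⟨Exec.mem_SE_restrict.2 ⟨hxS, ⟨_, hxc.symm⟩⟩, Or.inl rfl⟩
  have hrf : X.rf (aux e, .aCW) (acc e, .nlR (A.node x)) := by
    refine h.rf_of_hb (x := A.tmp x e.thread) hxw hr (by simp [Rdma.loc, hxc, RCall.subLoc])
      (by simp [Rdma.loc, hac, SCall.access, RCall.subLoc]) (h.hb_of_po hxS hrS hpo trivial) ?_
    -- The competitors are CPU writes of the same thread for the same `x`. Earlier ones are ordered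
    -- by `aCW` before `aCW`. Later ones follow an acquisition of the same lock, hence the present
    -- release, which follows the local read of the put. This is why the staging location depends on
    -- both `x` and the thread.
    intro w hww hwl hne
    obtain ⟨e₀, he₀, c₀, hc₀, hw₀, hl, ht, rfl⟩ := h.write_tmp hww hwl
    refine ⟨by simp, ?_⟩
    have hne' : e₀ ≠ e := by
      rintro rfl
      exact hne rfl
    rcases h.plain'.2.2.2 e₀ he₀ e he ht hne' with k | k
    · have := (h.po_iff _ _ _ _ (h.rel_aux he₀ hc₀) (h.rel_aux he hc) hne').2 k
      exact Or.inl (h.hb_of_po (h.aux_aCW_SE he₀ hc₀ hw₀) hxS this trivial)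
    · have hb := h.before_of_po he he₀ hc hc₀ hl.symm k
      obtain ⟨x₀, v₀, rfl⟩ := hw₀
      exact Or.inr (h.hb_trans (h.hb_acc_rel he hc (Or.inl rfl) hrS) (h.hb_trans hb
        (h.hb_of_po (h.acq_SE he₀ hc₀) (h.aux_aCW_SE he₀ hc₀ ⟨x₀, v₀, rfl⟩)
          (h.write e₀ he₀ _ _ hc₀).2.2.1 trivial)))
  rw [← h.wf.copy_put _ _ (h.acc_part he hc hrS) (h.acc_part he hc (h.acc_nrW_SE_write he hc hw)),
    ← (h.wf.rf_mo.1 _ _ hrf).2.2.2, h.wf.vW_write _ hxw _ _ hxc]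

/-- Concretely, success is a choice of stamps, tied to a comparison with the value of `narR`;
abstractly, it is a comparison with the output. `vR_acc` equates the two values. -/
theorem acc_nrW_cas (h : Concrete A G P' R acq acc rel aux X) (he : e ∈ P'.E) {x v₁ v₂}
    (hc : e.call = .sc (.cas x v₁ v₂)) :
    ((acc e, Stamp.nrW (A.node x)) ∈ G.SE ∧ v₁ = e.out ∧ X.vW (acc e, .nrW (A.node x)) = v₂) ∨
    ((acc e, Stamp.nrW (A.node x)) ∉ G.SE ∧ v₁ ≠ e.out) := by
  have hw : ¬ (SCall.cas x v₁ v₂).IsWrite := by rintro ⟨_, _, ⟨⟩⟩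
  have hv := h.vR_acc he hc hw
  have hac := h.acc_call e he _ hc
  have hs := h.acc_stmp he hc
  have hE := h.acc_mem he hc
  have hst := Exec.stmp_restrict hE (h.acc_call_mem he hc)
  simp only [SCall.access, RCall.stamps, Set.mem_singleton_iff, Set.mem_insert_iff] at hs
  rcases hs with hs | hs
  · refine Or.inr ⟨fun k => ?_, fun k => ?_⟩
    · have := k.2
      rw [hs] at this
      simp at this
    · exact h.wf.rcas_fail _ ⟨hE, h.acc_call_mem he hc⟩ _ _ _ _ _ hac (hst.trans hs)
        (hv.trans k.symm)
  · obtain ⟨k₁, k₂⟩ := h.wf.rcas_succ _ ⟨hE, h.acc_call_mem he hc⟩ _ _ _ _ _ hac (hst.trans hs)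
    refine Or.inl ⟨⟨hE, ?_⟩, k₁.symm.trans hv, k₂⟩
    rw [hs]
    simp

theorem acc_nrW_SE_faa (h : Concrete A G P' R acq acc rel aux X) (he : e ∈ P'.E) {x v}
    (hc : e.call = .sc (.faa x v)) : (acc e, Stamp.nrW (A.node x)) ∈ G.SE := by
  refine ⟨h.acc_mem he hc, ?_⟩
  have hs := h.acc_stmp he hc
  simp only [SCall.access, RCall.stamps, Set.mem_singleton_iff] at hs
  simp [hs]

theorem vW_acc_faa (h : Concrete A G P' R acq acc rel aux X) (he : e ∈ P'.E) {x v}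
    (hc : e.call = .sc (.faa x v)) : X.vW (acc e, .nrW (A.node x)) = e.out + v := by
  have hw : ¬ (SCall.faa x v).IsWrite := by rintro ⟨_, _, ⟨⟩⟩
  rw [h.wf.rfaa _ ⟨h.acc_mem he hc, h.acc_call_mem he hc⟩ _ _ _ _ (h.acc_call e he _ hc),
    ← h.vR_acc he hc hw]
  rfl

/-- The right side is the condition for an abstract write, so abstract writes correspond exactly to
the remote writes of accesses, including the success of compare-and-swaps. -/
theorem acc_nrW_SE_iff (h : Concrete A G P' R acq acc rel aux X) (he : e ∈ P'.E)
    (hc : e.call = .sc c) : (acc e, Stamp.nrW (A.node c.loc)) ∈ G.SE ↔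
      (¬ ∃ x, c = .read x) ∧ ¬ ∃ x v₁ v₂, c = .cas x v₁ v₂ ∧ v₁ ≠ e.out := by
  cases c with
  | write x v => simpa using h.acc_nrW_SE_write he hc ⟨x, v, rfl⟩
  | faa x v => exact iff_of_true (h.acc_nrW_SE_faa he hc) (by simp)
  | cas x v₁ v₂ =>
    rcases h.acc_nrW_cas he hc with ⟨k, l, -⟩ | ⟨k, l⟩
    · exact iff_of_true k (by simpa using l)
    · exact iff_of_false k (by simpa using l)
  | read x =>
    refine iff_of_false (fun k => ?_) (by simp)
    have hs := h.acc_stmp he hc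
    simp only [SCall.access, RCall.stamps, Set.mem_singleton_iff] at hs
    have := k.2
    rw [hs] at this
    simp at this

end Concrete

end Values

end Mowgli

namespace Mowgli

/-! ### Subevents related by the RDMA relations. -/

section Support

variable {Tid Node Loc Lock SLoc Val Wid Other : Type*} [Zero Val] [Add Val]
  {N : Network Tid Node Loc Lock Val} {A : Alloc N SLoc Wid}
  {G : Rdma.Ex Tid Node Loc Lock SLoc Val Wid Other}
  {X : Rdma.Witness Tid Node Loc Lock SLoc Val Wid Other}

theorem Rdma.ib_mem (hX : X.WF N G) {s₁ s₂} (h : Rdma.ib G X s₁ s₂) :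
    s₁ ∈ G.SE ∧ s₂ ∈ G.SE := by
  have key : ∀ a b, (ippo G a b ∨ iso G a b ∨ X.rf a b ∨ pfg G a b ∨ pfp G a b ∨
      X.nfo a b ∨ rbi G X a b) → a ∈ G.SE ∧ b ∈ G.SE := by
    rintro a b ((k | k) | k | k | k | k | k | k)
    · exact ⟨k.1, k.2.1⟩
    · exact ⟨k.1, k.2.1⟩
    · exact ⟨k.1, k.2.1⟩
    · have := hX.rf_mo.1 _ _ k
      exact ⟨this.1.1, this.2.1.1⟩
    · exact ⟨k.1, k.2.1⟩
    · exact ⟨k.1, k.2.1⟩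
    · exact hX.nfo_mem _ _ k
    · exact ⟨k.2.2.2.1.1, k.2.2.2.2.1.1⟩
  induction h with
  | single k => exact key _ _ k
  | tail _ k ih => exact ⟨ih.1, (key _ _ k).2⟩

/-- Locates the endpoints of an edge, and thereby the library it belongs to, when the components of
the abstract synchronisation order are told apart. -/
theorem Rdma.soSpec_mem (hX : X.WF N G) {s₁ s₂} (h : Rdma.soSpec G X s₁ s₂) :
    s₁ ∈ G.SE ∧ s₂ ∈ G.SE := by
  have hrao : ∀ a b, X.rao a b → a ∈ G.SE ∧ b ∈ G.SE := by
    intro a b k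
    obtain ⟨raon, hr, hi⟩ := hX.rao_total
    obtain ⟨n, k⟩ := (hi _ _).1 k
    exact ⟨((hr n).1 _ _ k).1.1, ((hr n).1 _ _ k).2.1⟩
  rcases h with k | k | k | k | k | k | k | ⟨-, s, k, l⟩ | ⟨-, k⟩
  · exact ⟨k.1, k.2.1⟩
  · have := hX.rf_mo.1 _ _ k.1
    exact ⟨this.1.1, this.2.1.1⟩
  · exact ⟨k.1, k.2.1⟩
  · exact hX.nfo_mem _ _ k
  · exact ⟨k.1.1, k.2.1.1⟩
  · have := hX.rf_mo.isModOrder.mem _ _ k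
    exact ⟨this.1.1, this.2.1.1⟩
  · exact hrao _ _ k
  · exact ⟨k.2.1, (hrao _ _ l).2⟩
  · exact Rdma.ib_mem hX k

end Support

/-! ### The abstract execution and its SC relations. -/

section Definitions

variable {Tid Node Loc Lock SLoc Val Wid Other : Type*}
  {N : Network Tid Node Loc Lock Val}

/-- The abstract events with their stamps. -/
def absStamped (G : Rdma.Ex Tid Node Loc Lock SLoc Val Wid Other)
    (P' : Plain Tid (Call Node Loc Lock SLoc Val Wid Other) Val) :
    Rdma.Ex Tid Node Loc Lock SLoc Val Wid Other where
  toPlain := P'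
  stmp e := {a | ((∃ c, e.call = .sc c) ∧ a = .aMF) ∨ ((∀ c, e.call ≠ .sc c) ∧ a ∈ G.stmp e)}
  so _ _ := False
  hb _ _ := False

/-- The part of an execution that belongs to the sequentially consistent library. -/
abbrev scPart (G : Rdma.Ex Tid Node Loc Lock SLoc Val Wid Other) :
    Rdma.Ex Tid Node Loc Lock SLoc Val Wid Other := G.restrict (Set.range Call.sc)

/-- Reads-from between abstract subevents. -/
def scRf (A : Alloc N SLoc Wid) (G₀ : Rdma.Ex Tid Node Loc Lock SLoc Val Wid Other)
    (acc : Rdma.Ev Tid Node Loc Lock SLoc Val Wid Other →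
      Rdma.Ev Tid Node Loc Lock SLoc Val Wid Other)
    (X : Rdma.Witness Tid Node Loc Lock SLoc Val Wid Other)
    (w r : Rdma.SEv Tid Node Loc Lock SLoc Val Wid Other) : Prop :=
  w ∈ SC.writes (scPart G₀) ∧ r ∈ SC.reads (scPart G₀) ∧
    ∃ c c', w.1.call = .sc c ∧ r.1.call = .sc c' ∧
      X.rf (acc w.1, .nrW (A.node c.loc)) (acc r.1, c'.readStamp (A.node c'.loc))

/-- Modification order between abstract subevents. -/
def scMo (A : Alloc N SLoc Wid) (G₀ : Rdma.Ex Tid Node Loc Lock SLoc Val Wid Other)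
    (acc : Rdma.Ev Tid Node Loc Lock SLoc Val Wid Other →
      Rdma.Ev Tid Node Loc Lock SLoc Val Wid Other)
    (X : Rdma.Witness Tid Node Loc Lock SLoc Val Wid Other)
    (w₁ w₂ : Rdma.SEv Tid Node Loc Lock SLoc Val Wid Other) : Prop :=
  w₁ ∈ SC.writes (scPart G₀) ∧ w₂ ∈ SC.writes (scPart G₀) ∧
    ∃ c c', w₁.1.call = .sc c ∧ w₂.1.call = .sc c' ∧
      X.mo (acc w₁.1, .nrW (A.node c.loc)) (acc w₂.1, .nrW (A.node c'.loc))

/-- Synchronisation order between abstract subevents. -/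
def scSo (A : Alloc N SLoc Wid) (G₀ : Rdma.Ex Tid Node Loc Lock SLoc Val Wid Other)
    (acc : Rdma.Ev Tid Node Loc Lock SLoc Val Wid Other →
      Rdma.Ev Tid Node Loc Lock SLoc Val Wid Other)
    (X : Rdma.Witness Tid Node Loc Lock SLoc Val Wid Other)
    (s₁ s₂ : Rdma.SEv Tid Node Loc Lock SLoc Val Wid Other) : Prop :=
  (s₁ ∈ (scPart G₀).SE ∧ s₂ ∈ (scPart G₀).SE ∧ (scPart G₀).po s₁.1 s₂.1) ∨
    scRf A G₀ acc X s₁ s₂ ∨ scMo A G₀ acc X s₁ s₂ ∨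
    readsBefore (SC.reads (scPart G₀)) (SC.writes (scPart G₀)) SC.loc
      (scRf A G₀ acc X) (scMo A G₀ acc X) s₁ s₂

open Classical in
/-- The event that stands for an abstract event: the first one of its implementation. -/
noncomputable def firstEvent
    (acq : Rdma.Ev Tid Node Loc Lock SLoc Val Wid Other →
      Rdma.Ev Tid Node Loc Lock SLoc Val Wid Other)
    (e : Rdma.Ev Tid Node Loc Lock SLoc Val Wid Other) :
    Rdma.Ev Tid Node Loc Lock SLoc Val Wid Other :=
  if ∃ c, e.call = .sc c then acq e else e

/-- The abstract execution. -/
noncomputable def absExec (A : Alloc N SLoc Wid)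
    (G : Rdma.Ex Tid Node Loc Lock SLoc Val Wid Other)
    (P' : Plain Tid (Call Node Loc Lock SLoc Val Wid Other) Val)
    (acq acc : Rdma.Ev Tid Node Loc Lock SLoc Val Wid Other →
      Rdma.Ev Tid Node Loc Lock SLoc Val Wid Other)
    (X : Rdma.Witness Tid Node Loc Lock SLoc Val Wid Other) :
    Rdma.Ex Tid Node Loc Lock SLoc Val Wid Other where
  toPlain := P'
  stmp := (absStamped G P').stmp
  so s₁ s₂ :=
    Rdma.soSpec (rdmaPart (absStamped G P')) (X.restrict (rdmaPart (absStamped G P'))) s₁ s₂ ∨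
    scSo A (absStamped G P') acc X s₁ s₂ ∨
    (s₁.1 ∈ P'.E ∧ s₂.1 ∈ P'.E ∧ (∀ c, s₁.1.call ≠ .sc c) ∧ (∀ c, s₁.1.call ≠ .rdma c) ∧
      G.so s₁ s₂)
  hb s₁ s₂ := s₁ ∈ (absStamped G P').SE ∧ s₂ ∈ (absStamped G P').SE ∧
    G.hb (firstEvent acq s₁.1, s₁.2) (firstEvent acq s₂.1, s₂.2)

variable {G : Rdma.Ex Tid Node Loc Lock SLoc Val Wid Other}
  {P' : Plain Tid (Call Node Loc Lock SLoc Val Wid Other) Val}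
  {acq : Rdma.Ev Tid Node Loc Lock SLoc Val Wid Other →
    Rdma.Ev Tid Node Loc Lock SLoc Val Wid Other}

theorem firstEvent_sc {e : Rdma.Ev Tid Node Loc Lock SLoc Val Wid Other} {c}
    (hc : e.call = .sc c) : firstEvent acq e = acq e := if_pos ⟨c, hc⟩

theorem firstEvent_client {e : Rdma.Ev Tid Node Loc Lock SLoc Val Wid Other}
    (hc : ∀ c, e.call ≠ .sc c) : firstEvent acq e = e := if_neg fun ⟨c, k⟩ => hc c k

theorem stmp_sc {e : Rdma.Ev Tid Node Loc Lock SLoc Val Wid Other} {c}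
    (hc : e.call = .sc c) : (absStamped G P').stmp e = {.aMF} := by
  ext a
  exact ⟨fun k => k.elim (fun k => k.2) fun k => absurd hc (k.1 c), fun k => Or.inl ⟨⟨c, hc⟩, k⟩⟩

theorem stmp_client {e : Rdma.Ev Tid Node Loc Lock SLoc Val Wid Other}
    (hc : ∀ c, e.call ≠ .sc c) : (absStamped G P').stmp e = G.stmp e := by
  ext a
  exact ⟨fun k => k.elim (fun ⟨⟨c, k⟩, _⟩ => absurd k (hc c)) fun k => k.2, fun k => Or.inr ⟨hc, k⟩⟩

theorem mem_scReads (s : Rdma.SEv Tid Node Loc Lock SLoc Val Wid Other) :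
    s ∈ SC.reads (scPart (absStamped G P')) ↔
      s.1 ∈ P'.E ∧ s.2 = .aMF ∧ ∃ c, s.1.call = .sc c ∧ ¬ c.IsWrite := by
  constructor
  · rintro ⟨⟨he, c, hc⟩, ha, hw⟩
    refine ⟨he, ha, c, hc.symm, ?_⟩
    rintro ⟨x, v, rfl⟩
    exact hw ⟨x, v, hc.symm⟩
  · rintro ⟨he, ha, c, hc, hw⟩
    refine ⟨⟨he, c, hc.symm⟩, ha, ?_⟩
    rintro ⟨x, v, k⟩
    exact hw ⟨x, v, Call.sc.inj (hc.symm.trans k)⟩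

end Definitions

/-! ### The SC synchronisation order is contained in happens-before. -/

section Abstract

variable {Tid Node Loc Lock SLoc Val Wid Other : Type*} [Zero Val] [Add Val]
  {N : Network Tid Node Loc Lock Val} {A : Alloc N SLoc Wid}
  {G : Rdma.Ex Tid Node Loc Lock SLoc Val Wid Other}
  {P' : Plain Tid (Call Node Loc Lock SLoc Val Wid Other) Val}
  {R : Rdma.Ev Tid Node Loc Lock SLoc Val Wid Other →
    Rdma.Ev Tid Node Loc Lock SLoc Val Wid Other → Prop}
  {acq acc rel aux : Rdma.Ev Tid Node Loc Lock SLoc Val Wid Other →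
    Rdma.Ev Tid Node Loc Lock SLoc Val Wid Other}
  {X : Rdma.Witness Tid Node Loc Lock SLoc Val Wid Other}

namespace Concrete

theorem firstEvent_rel (h : Concrete A G P' R acq acc rel aux X) {e} (he : e ∈ P'.E) :
    R (firstEvent acq e) e := by
  by_cases hc : ∃ c, e.call = .sc c
  · obtain ⟨c, hc⟩ := hc
    rw [firstEvent_sc hc]
    exact h.rel_acq he hc
  · push Not at hc
    rw [firstEvent_client hc]
    exact h.rel_client he hc

theorem firstEvent_SE (h : Concrete A G P' R acq acc rel aux X) {s}
    (hs : s ∈ (absStamped G P').SE) : (firstEvent acq s.1, s.2) ∈ G.SE := by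
  obtain ⟨he, ha⟩ := hs
  by_cases hc : ∃ c, s.1.call = .sc c
  · obtain ⟨c, hc⟩ := hc
    rw [stmp_sc hc] at ha
    rw [firstEvent_sc hc, Set.mem_singleton_iff.1 ha]
    exact h.acq_SE he hc
  · push Not at hc
    rw [stmp_client hc] at ha
    rw [firstEvent_client hc]
    exact ⟨h.client_mem he hc, ha⟩

/-- `firstEvent` keeps stamps and preserves program order between distinct abstract events, so the
same pair of stamps orders the representatives. -/
theorem firstEvent_hb (h : Concrete A G P' R acq acc rel aux X) {s₁ s₂}
    (hp : (absStamped G P').ppo s₁ s₂) :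
    G.hb (firstEvent acq s₁.1, s₁.2) (firstEvent acq s₂.1, s₂.2) := by
  obtain ⟨h₁, h₂, hp, hs⟩ := hp
  exact h.hb_of_po (h.firstEvent_SE h₁) (h.firstEvent_SE h₂)
    ((h.po_iff _ _ _ _ (h.firstEvent_rel h₁.1) (h.firstEvent_rel h₂.1) (h.plain'.ne hp)).2 hp) hs

theorem mem_scWrites (h : Concrete A G P' R acq acc rel aux X)
    (s : Rdma.SEv Tid Node Loc Lock SLoc Val Wid Other) :
    s ∈ SC.writes (scPart (absStamped G P')) ↔
      s.1 ∈ P'.E ∧ s.2 = .aMF ∧ ∃ c, s.1.call = .sc c ∧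
        (acc s.1, Stamp.nrW (A.node c.loc)) ∈ G.SE := by
  constructor
  · rintro ⟨⟨he, c, hc⟩, ha, hr, hw⟩
    refine ⟨he, ha, c, hc.symm, (h.acc_nrW_SE_iff he hc.symm).2 ⟨?_, ?_⟩⟩
    · rintro ⟨x, rfl⟩
      exact hr ⟨x, hc.symm⟩
    · rintro ⟨x, v₁, v₂, rfl, k⟩
      exact hw ⟨x, v₁, v₂, hc.symm, k⟩
  · rintro ⟨he, ha, c, hc, hw⟩
    obtain ⟨hr, hw⟩ := (h.acc_nrW_SE_iff he hc).1 hw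
    refine ⟨⟨he, c, hc.symm⟩, ha, ?_, ?_⟩
    · rintro ⟨x, k⟩
      exact hr ⟨x, Call.sc.inj (hc.symm.trans k)⟩
    · rintro ⟨x, v₁, v₂, k, l⟩
      exact hw ⟨x, v₁, v₂, Call.sc.inj (hc.symm.trans k), l⟩

/-- Writes are excluded because the read stamp of a put belongs to the staging location, not to the
data. -/
theorem loc_acc_read (h : Concrete A G P' R acq acc rel aux X) {e} (he : e ∈ P'.E) {c}
    (hc : e.call = .sc c) (hw : ¬ c.IsWrite) (n : Node) :
    Rdma.loc (acc e, c.readStamp n) = {A.data c.loc} := by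
  simp only [Rdma.loc, h.acc_call e he c hc]
  cases c with
  | write x v => exact absurd ⟨x, v, rfl⟩ hw
  | _ => rfl

theorem acc_read_mem (h : Concrete A G P' R acq acc rel aux X) {e} (he : e ∈ P'.E) {c}
    (hc : e.call = .sc c) :
    (acc e, c.readStamp (A.node c.loc)) ∈ Rdma.reads (rdmaPart G) := by
  refine ⟨h.acc_part he hc (h.acc_readStamp_SE he hc), Or.inr (Or.inr ⟨A.node c.loc, ?_⟩)⟩
  cases c <;> simp [SCall.readStamp]

/-- The existence of the subevent is needed to exclude a get, which has no location at `nrW`. -/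
theorem loc_acc_write (h : Concrete A G P' R acq acc rel aux X) {e} (he : e ∈ P'.E) {c}
    (hc : e.call = .sc c) (hw : (acc e, Stamp.nrW (A.node c.loc)) ∈ G.SE) (n : Node) :
    Rdma.loc (acc e, Stamp.nrW n) = {A.data c.loc} := by
  simp only [Rdma.loc, h.acc_call e he c hc]
  cases c with
  | read x => exact absurd ⟨x, rfl⟩ ((h.acc_nrW_SE_iff he hc).1 hw).1
  | _ => rfl

theorem acc_write_mem (h : Concrete A G P' R acq acc rel aux X) {e} (he : e ∈ P'.E) {c}
    (hc : e.call = .sc c) (hw : (acc e, Stamp.nrW (A.node c.loc)) ∈ G.SE) :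
    (acc e, Stamp.nrW (A.node c.loc)) ∈ Rdma.writes (rdmaPart G) :=
  ⟨h.acc_part he hc hw, Or.inr (Or.inr ⟨_, Or.inr rfl⟩)⟩

theorem acc_inj (h : Concrete A G P' R acq acc rel aux X) {e₁ e₂} (h₁ : e₁ ∈ P'.E)
    (h₂ : e₂ ∈ P'.E) {c₁ c₂} (hc₁ : e₁.call = .sc c₁) (hc₂ : e₂.call = .sc c₂)
    (he : acc e₁ = acc e₂) : e₁ = e₂ :=
  h.unique _ _ _ (h.rel_acc h₁ hc₁) (he ▸ h.rel_acc h₂ hc₂)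

/-- A write that an abstract read reads from is an abstract write. -/
theorem exists_scRf (h : Concrete A G P' R acq acc rel aux X) {r}
    (hr : r ∈ SC.reads (scPart (absStamped G P'))) {c} (hc : r.1.call = .sc c) {w}
    (hrf : X.rf w (acc r.1, c.readStamp (A.node c.loc))) :
    ∃ w', scRf A (absStamped G P') acc X w' r := by
  obtain ⟨he, -, c', hc', hw⟩ := (mem_scReads r).1 hr
  obtain rfl : c = c' := Call.sc.inj (hc.symm.trans hc')
  obtain ⟨hww, -, hl, -⟩ := h.wf.rf_mo.1 _ _ hrf
  obtain ⟨e₀, he₀, c₀, hc₀, hl₀, rfl⟩ :=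
    h.write_data hww r.1.thread (hl.trans (h.loc_acc_read he hc hw _))
  exact ⟨(e₀, .aMF), (h.mem_scWrites _).2 ⟨he₀, rfl, c₀, hc₀, (Exec.mem_SE_restrict.1 hww.1).1⟩,
    hr, c₀, c, hc₀, hc, hrf⟩

/-- The synchronisation order of the abstract library is respected by the acquisitions. -/
theorem scSo_hb (h : Concrete A G P' R acq acc rel aux X) {s₁ s₂}
    (hs : scSo A (absStamped G P') acc X s₁ s₂) : (absExec A G P' acq acc X).hb s₁ s₂ := by
  have hSE : ∀ {s : Rdma.SEv Tid Node Loc Lock SLoc Val Wid Other} {c}, s.1 ∈ P'.E → s.2 = .aMF →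
      s.1.call = .sc c → s ∈ (absStamped G P').SE := fun {s c} he ha hc =>
    ⟨he, by rw [stmp_sc hc, ha]; rfl⟩
  have key : ∀ {s₁ s₂ : Rdma.SEv Tid Node Loc Lock SLoc Val Wid Other} {c₁ c₂}, s₁.1 ∈ P'.E →
      s₁.2 = .aMF → s₁.1.call = .sc c₁ → s₂.1 ∈ P'.E → s₂.2 = .aMF → s₂.1.call = .sc c₂ →
      G.hb (acq s₁.1, .aMF) (acq s₂.1, .aMF) → (absExec A G P' acq acc X).hb s₁ s₂ := by
    intro s₁ s₂ c₁ c₂ he₁ ha₁ hc₁ he₂ ha₂ hc₂ hb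
    refine ⟨hSE he₁ ha₁ hc₁, hSE he₂ ha₂ hc₂, ?_⟩
    rw [firstEvent_sc hc₁, firstEvent_sc hc₂, ha₁, ha₂]
    exact hb
  rcases hs with ⟨k₁, k₂, hp⟩ | hrf | hmo | hrb
  · rw [Exec.mem_SE_restrict] at k₁ k₂
    refine ⟨k₁.1, k₂.1, h.firstEvent_hb ⟨k₁.1, k₂.1, hp.1, ?_⟩⟩
    obtain ⟨⟨-, a⟩, c, hc⟩ := k₁
    rw [stmp_sc hc.symm] at a
    rw [Set.mem_singleton_iff.1 a]
    trivial
  · obtain ⟨hw, hr, c₁, c₂, hc₁, hc₂, hrf⟩ := hrf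
    obtain ⟨he₁, ha₁, c, hc, hw⟩ := (h.mem_scWrites _).1 hw
    obtain rfl : c = c₁ := Call.sc.inj (hc.symm.trans hc₁)
    obtain ⟨he₂, ha₂, c', hc', hr⟩ := (mem_scReads _).1 hr
    obtain rfl : c' = c₂ := Call.sc.inj (hc'.symm.trans hc₂)
    have hb := h.hb_of_rf hrf (by simp)
    have hl := (h.wf.rf_mo.1 _ _ hrf).2.2.1
    rw [h.loc_acc_write he₁ hc hw, h.loc_acc_read he₂ hc' hr] at hl
    have hl := A.data_inj (Set.singleton_injective hl)
    refine key he₁ ha₁ hc he₂ ha₂ hc' (h.hb_acq_of_hb_acc he₁ he₂ hc hc' hl ?_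
      (isProtected_readStamp _ _) hw (h.acc_readStamp_SE he₂ hc') hb)
    -- A read-modify-write cannot read from its own write: `iso` puts its `narR` before its `nrW`.
    intro heq
    obtain rfl : c = c' := by
      rw [heq, hc'] at hc
      exact (Call.sc.inj hc).symm
    rw [heq] at hb hw
    refine h.hb_asymm hb (h.hb_of_iso ⟨h.acc_part he₂ hc' (h.acc_readStamp_SE he₂ hc'),
      h.acc_part he₂ hc' hw, rfl, Or.inr (Or.inr (Or.inr ?_))⟩)
    have hac := h.acc_call _ he₂ _ hc'
    cases c with
    | write x v => exact absurd ⟨x, v, rfl⟩ hr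
    | read x => exact absurd ⟨x, rfl⟩ ((h.acc_nrW_SE_iff he₂ hc').1 hw).1
    | cas x v₁ v₂ => exact ⟨Or.inl ⟨_, _, _, _, _, hac⟩, _, rfl, Or.inr rfl⟩
    | faa x v => exact ⟨Or.inr ⟨_, _, _, _, hac⟩, _, rfl, Or.inr rfl⟩
  · obtain ⟨hw, hr, c₁, c₂, hc₁, hc₂, hmo⟩ := hmo
    obtain ⟨he₁, ha₁, c, hc, hw⟩ := (h.mem_scWrites _).1 hw
    obtain rfl : c = c₁ := Call.sc.inj (hc.symm.trans hc₁)
    obtain ⟨he₂, ha₂, c', hc', hw'⟩ := (h.mem_scWrites _).1 hr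
    obtain rfl : c' = c₂ := Call.sc.inj (hc'.symm.trans hc₂)
    have hb := h.hb_of_mo hmo
    obtain ⟨-, -, x, hx, hy⟩ := h.wf.rf_mo.isModOrder.mem _ _ hmo
    rw [h.loc_acc_write he₁ hc hw] at hx
    rw [h.loc_acc_write he₂ hc' hw'] at hy
    have hl := A.data_inj (Set.singleton_injective (hx.trans hy.symm))
    refine key he₁ ha₁ hc he₂ ha₂ hc' (h.hb_acq_of_hb_acc he₁ he₂ hc hc' hl ?_
      (Or.inr (Or.inr (Or.inr rfl))) hw hw' hb)
    intro heq
    obtain rfl : c = c' := by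
      rw [heq, hc'] at hc
      exact (Call.sc.inj hc).symm
    rw [heq] at hb
    exact h.hb_irrefl _ hb
  · obtain ⟨hr, hw, hrf, hl, hne⟩ := hrb
    obtain ⟨he₁, ha₁, c, hc, hr'⟩ := (mem_scReads _).1 hr
    obtain ⟨he₂, ha₂, c', hc', hw'⟩ := (h.mem_scWrites _).1 hw
    have hl : c.loc = c'.loc := by
      simp only [SC.loc, hc, hc'] at hl
      exact Set.singleton_injective hl
    have hne' : s₁.1 ≠ s₂.1 := fun k => hne (Prod.ext k (ha₁.trans ha₂.symm))
    refine key he₁ ha₁ hc he₂ ha₂ hc' (h.hb_acq_of_hb_acc he₁ he₂ hc hc' hl hne'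
      (Or.inr (Or.inr (Or.inr rfl))) (h.acc_readStamp_SE he₁ hc) hw' (h.hb_of_rb
        ⟨h.acc_read_mem he₁ hc, h.acc_write_mem he₂ hc' hw', ?_, ?_, ?_⟩))
    · refine hrf.imp ?_ ?_
      · rintro ⟨w, ⟨-, -, c₀, c₁, hc₀, hc₁, k⟩, ⟨-, -, c₂, c₃, hc₂, hc₃, l⟩⟩
        obtain rfl : c = c₁ := Call.sc.inj (hc.symm.trans hc₁)
        obtain rfl : c' = c₃ := Call.sc.inj (hc'.symm.trans hc₃)
        obtain rfl : c₀ = c₂ := Call.sc.inj (hc₀.symm.trans hc₂)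
        exact ⟨_, k, l⟩
      -- A missing abstract source must mean a missing concrete one; by `exists_scRf` a concrete
      -- source would be an abstract write.
      · intro k w l
        obtain ⟨w', l⟩ := h.exists_scRf hr hc l
        exact k w' l
    · rw [h.loc_acc_read he₁ hc hr', h.loc_acc_write he₂ hc' hw', hl]
    · exact fun k => hne' (h.acc_inj he₁ he₂ hc hc' (congrArg Prod.fst k))

end Concrete

end Abstract

end Mowgli

namespace Mowgli

/-! ### Consistency of the abstract execution for each library. -/

section Consistency

variable {Tid Node Loc Lock SLoc Val Wid Other : Type*}

section Restrict

variable {G : Rdma.Ex Tid Node Loc Lock SLoc Val Wid Other}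

/-- The part of an execution that belongs to the node lock library. -/
abbrev nlockPart (G : Rdma.Ex Tid Node Loc Lock SLoc Val Wid Other) :
    Rdma.Ex Tid Node Loc Lock SLoc Val Wid Other := G.restrict (Set.range Call.nlock)

theorem acqs_nlockPart (l : Lock) :
    NLock.acqs (nlockPart G).toPlain l = NLock.acqs G.toPlain l :=
  Set.ext fun _ => ⟨fun h => ⟨h.1.1, h.2⟩, fun h => ⟨⟨h.1, ⟨_, h.2.symm⟩⟩, h.2⟩⟩

theorem rels_nlockPart (l : Lock) :
    NLock.rels (nlockPart G).toPlain l = NLock.rels G.toPlain l :=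
  Set.ext fun _ => ⟨fun h => ⟨h.1.1, h.2⟩, fun h => ⟨⟨h.1, ⟨_, h.2.symm⟩⟩, h.2⟩⟩

theorem immPo_nlockPart (l : Lock) {e₁ e₂} :
    NLock.immPo (nlockPart G).toPlain l e₁ e₂ ↔ NLock.immPo G.toPlain l e₁ e₂ := by
  have key : ∀ {d}, d ∈ NLock.acqs G.toPlain l ∪ NLock.rels G.toPlain l →
      d.call ∈ Set.range (Call.nlock : _ → Call Node Loc Lock SLoc Val Wid Other) := by
    rintro d (⟨-, hd⟩ | ⟨-, hd⟩) <;> exact ⟨_, hd.symm⟩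
  have hpo : ∀ {d₁ d₂}, d₁ ∈ NLock.acqs G.toPlain l ∪ NLock.rels G.toPlain l →
      d₂ ∈ NLock.acqs G.toPlain l ∪ NLock.rels G.toPlain l →
      ((nlockPart G).po d₁ d₂ ↔ G.po d₁ d₂) := fun k₁ k₂ =>
    and_iff_left ⟨key k₁, key k₂⟩
  simp only [NLock.immPo, acqs_nlockPart, rels_nlockPart]
  refine and_congr_right fun k₁ => and_congr_right fun k₂ => and_congr (hpo k₁ k₂) (not_congr ?_)
  exact exists_congr fun d => and_congr_right fun k => and_congr (hpo k₁ k) (hpo k k₂)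

theorem lockWF_nlockPart (h : NLock.LockWF G.toPlain) : NLock.LockWF (nlockPart G).toPlain := by
  intro l
  simp only [acqs_nlockPart, rels_nlockPart, immPo_nlockPart]
  exact h l

end Restrict

variable {N : Network Tid Node Loc Lock Val} {A : Alloc N SLoc Wid}
  {G : Rdma.Ex Tid Node Loc Lock SLoc Val Wid Other}
  {P P' : Plain Tid (Call Node Loc Lock SLoc Val Wid Other) Val}
  {R : Rdma.Ev Tid Node Loc Lock SLoc Val Wid Other →
    Rdma.Ev Tid Node Loc Lock SLoc Val Wid Other → Prop}
  {acq acc rel aux : Rdma.Ev Tid Node Loc Lock SLoc Val Wid Other →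
    Rdma.Ev Tid Node Loc Lock SLoc Val Wid Other}
  {X : Rdma.Witness Tid Node Loc Lock SLoc Val Wid Other}

/-- Events of the implementation access only its locations. -/
theorem Layout.impl_call (h : Layout A P P' R acq acc rel aux) {d} (hd : d ∈ P.E)
    (hd' : d ∉ P'.E) : (∃ c, d.call = .nlock c) ∨ ∃ c, d.call = .rdma c ∧
      ∀ y ∈ c.loc, ∃ x t, y = A.data x ∨ y = A.res t ∨ y = A.tmp x t := by
  obtain ⟨e, hR⟩ := h.total d hd
  have he := h.right_mem _ _ hR
  by_cases hc : ∀ c, e.call ≠ .sc c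
  · obtain rfl := (h.client e he hc d).1 hR
    exact absurd he hd'
  push Not at hc
  obtain ⟨c, hc⟩ := hc
  have h₁ := h.acq_call e he _ hc
  have h₂ := h.acc_call e he _ hc
  have h₃ := h.rel_call e he _ hc
  have hacc : ∀ y ∈ (c.access A e.thread).loc,
      ∃ x t, y = A.data x ∨ y = A.res t ∨ y = A.tmp x t := by
    intro y hy
    refine ⟨c.loc, e.thread, ?_⟩
    cases c <;> rcases hy with rfl | rfl <;> simp [SCall.loc]
  by_cases hw : c.IsWrite
  · obtain ⟨x, v, rfl⟩ := hw
    obtain ⟨-, h₄, -, -, h₅⟩ := h.write e he x v hc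
    rcases (h₅ d).1 hR with rfl | rfl | rfl | rfl
    · exact Or.inl ⟨_, h₁⟩
    · refine Or.inr ⟨_, h₄, ?_⟩
      rintro _ rfl
      exact ⟨x, e.thread, Or.inr (Or.inr rfl)⟩
    · exact Or.inr ⟨_, h₂, hacc⟩
    · exact Or.inl ⟨_, h₃⟩
  · obtain ⟨h₄, -, -, h₅⟩ := h.fetch e he c hc hw
    rw [Layout.lastEvent_fetch hc hw] at h₅
    rcases (h₅ d).1 hR with rfl | rfl | rfl | rfl | rfl
    · exact Or.inl ⟨_, h₁⟩
    · exact Or.inr ⟨_, h₂, hacc⟩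
    · exact Or.inl ⟨_, h₃⟩
    · exact Or.inr ⟨_, h₄, fun y hy => absurd hy (by simp [RCall.loc])⟩
    · refine Or.inr ⟨_, rfl, ?_⟩
      rintro _ rfl
      exact ⟨c.loc, e.thread, Or.inr (Or.inl rfl)⟩

namespace Concrete

theorem scSo_mem {s₁ s₂ : Rdma.SEv Tid Node Loc Lock SLoc Val Wid Other}
    (k : scSo A (absStamped G P') acc X s₁ s₂) :
    (∃ c, s₁.1.call = .sc c) ∧ ∃ c, s₂.1.call = .sc c := by
  have hr : ∀ {s : Rdma.SEv Tid Node Loc Lock SLoc Val Wid Other},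
      s.1.call ∈ Set.range (Call.sc : _ → Call Node Loc Lock SLoc Val Wid Other) →
      ∃ c, s.1.call = .sc c := fun ⟨c, hc⟩ => ⟨c, hc.symm⟩
  rcases k with k | k | k | k
  · exact ⟨hr (Exec.mem_SE_restrict.1 k.1).2, hr (Exec.mem_SE_restrict.1 k.2.1).2⟩
  · exact ⟨hr k.1.1.2, hr k.2.1.1.2⟩
  · exact ⟨hr k.1.1.2, hr k.2.1.1.2⟩
  · exact ⟨hr k.1.1.2, hr k.2.1.1.2⟩

section General

variable [Zero Val] [Add Val]

theorem isRestriction (h : Concrete A G P' R acq acc rel aux X) :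
    Rdma.IsRestriction (rdmaPart (absStamped G P')) (rdmaPart G) := by
  have hn : ∀ {e : Rdma.Ev Tid Node Loc Lock SLoc Val Wid Other},
      e.call ∈ Set.range Call.rdma → ∀ c, e.call ≠ .sc c := by
    rintro e ⟨c, hc⟩ c' hc'
    rw [← hc] at hc'
    cases hc'
  have hm : ∀ e ∈ (rdmaPart (absStamped G P')).E, e ∈ G.E :=
    fun e he => h.client_mem he.1 (hn he.2)
  refine ⟨fun e he => ⟨hm e he, he.2⟩, ?_, ?_⟩
  · intro e₁ e₂
    constructor
    · rintro ⟨hp, h₁, h₂⟩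
      have k₁ := h.plain'.left_mem hp
      have k₂ := h.plain'.right_mem hp
      exact ⟨⟨k₁, h₁⟩, ⟨k₂, h₂⟩,
        (h.client_po_iff h.plain h.plain' k₁ k₂ (hn h₁) (hn h₂)).2 hp, h₁, h₂⟩
    · rintro ⟨⟨k₁, h₁⟩, ⟨k₂, h₂⟩, hp, -⟩
      exact ⟨(h.client_po_iff h.plain h.plain' k₁ k₂ (hn h₁) (hn h₂)).1 hp, h₁, h₂⟩
  · intro e he
    rw [Exec.stmp_restrict he.1 he.2, Exec.stmp_restrict (hm e he) he.2, stmp_client (hn he.2)]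

/-- Any RDMA event that is not a client event touches only locations of the implementation, which
the client avoids. -/
theorem closed (h : Concrete A G P' R acq acc rel aux X) :
    Rdma.IsRestriction.Closed (rdmaPart (absStamped G P')) (rdmaPart G) := by
  intro e₁ he₁ e₂ he₂ c₁ c₂ y hc₁ hc₂ hy₁ hy₂
  refine ⟨?_, he₂.2⟩
  by_contra hn
  rcases h.impl_call he₂.1 hn with ⟨c, hc⟩ | ⟨c, hc, k⟩
  · rw [hc] at hc₂
    cases hc₂
  · obtain rfl : c = c₂ := Call.rdma.inj (hc.symm.trans hc₂)
    obtain ⟨x, t, k⟩ := k y hy₂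
    have := h.sep.rdma e₁ he₁.1 c₁ hc₁ y hy₁ x t
    tauto

theorem stamps (h : Concrete A G P' R acq acc rel aux X) :
    ∀ e ∈ (rdmaPart G).E, ∃ c, e.call = .rdma c ∧ (rdmaPart G).stmp e ∈ c.stamps N e.out := by
  rintro e ⟨he, c, hc⟩
  refine ⟨c, hc.symm, ?_⟩
  rw [Exec.stmp_restrict (M := Set.range Call.rdma) he ⟨c, hc⟩]
  exact h.rdma e he c hc.symm

theorem restrict_wf (h : Concrete A G P' R acq acc rel aux X) :
    (X.restrict (rdmaPart (absStamped G P'))).WF N (rdmaPart (absStamped G P')) :=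
  h.isRestriction.witness_wf h.wf h.closed h.stamps

/-- A pullback of a transitive relation is transitive, so the work lies in synchronisation: client
edges are concrete edges between events fixed by `firstEvent`, and SC edges are handled by
`scSo_hb`. -/
theorem absExec_isExec (h : Concrete A G P' R acq acc rel aux X) :
    (absExec A G P' acq acc X).IsExec := by
  have hcl : ∀ {s₁ s₂ : Rdma.SEv Tid Node Loc Lock SLoc Val Wid Other}, s₁.1 ∈ P'.E →
      s₂.1 ∈ P'.E → (∀ c, s₁.1.call ≠ .sc c) → (∀ c, s₂.1.call ≠ .sc c) → G.hb s₁ s₂ →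
      (absExec A G P' acq acc X).hb s₁ s₂ := by
    intro s₁ s₂ h₁ h₂ hc₁ hc₂ hb
    obtain ⟨k₁, k₂⟩ := h.exec.2.2.1 _ _ hb
    refine ⟨⟨h₁, ?_⟩, ⟨h₂, ?_⟩, ?_⟩
    · rw [stmp_client hc₁]
      exact k₁.2
    · rw [stmp_client hc₂]
      exact k₂.2
    · rw [firstEvent_client hc₁, firstEvent_client hc₂]
      exact hb
  refine ⟨h.plain', ?_, fun s₁ s₂ k => ⟨k.1, k.2.1⟩, fun s₁ s₂ s₃ k l =>
    ⟨k.1, l.2.1, h.hb_trans k.2.2 l.2.2⟩, ?_, fun s₁ s₂ k => ⟨k.1, k.2.1, h.firstEvent_hb k⟩⟩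
  · intro e he
    change ((absStamped G P').stmp e).Nonempty
    by_cases hc : ∃ c, e.call = .sc c
    · obtain ⟨c, hc⟩ := hc
      rw [stmp_sc hc]
      exact Set.singleton_nonempty _
    · push Not at hc
      rw [stmp_client hc]
      exact h.exec.2.1 e (h.client_mem he hc)
  · rintro s₁ s₂ (k | k | ⟨h₁, h₂, hc, -, k⟩)
    · obtain ⟨k₁, k₂⟩ := Rdma.soSpec_mem h.restrict_wf k
      rw [Exec.mem_SE_restrict] at k₁ k₂
      obtain ⟨c₁, hc₁⟩ := k₁.2
      obtain ⟨c₂, hc₂⟩ := k₂.2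
      exact hcl k₁.1.1 k₂.1.1 (by simp [← hc₁]) (by simp [← hc₂])
        (h.hb_of_so _ _ (h.isRestriction.soSpec h.wf h.closed h.stamps k))
    · exact h.scSo_hb k
    · have hb := h.exec.2.2.2.2.1 _ _ k
      exact hcl h₁ h₂ hc (h.call_ne_sc (h.exec.2.2.1 _ _ hb).2.1) hb

theorem rdma_cons (h : Concrete A G P' R acq acc rel aux X)
    (hG : ∀ e ∈ (rdmaPart G).E, ∃ c, e.call = .rdma c ∧ c.addressed N (N.threadNode e.thread) ∧
      c.typed N e.out ∧ (rdmaPart G).stmp e ∈ c.stamps N e.out)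
    (hib : ∀ s, ¬ Rdma.ib (rdmaPart G) X s s) :
    Rdma.Cons N (rdmaPart (absExec A G P' acq acc X)) := by
  -- `absExec` and `absStamped` agree by definition on events, program order and stamps, which is
  -- all that `IsRestriction` mentions.
  have hr : Rdma.IsRestriction (rdmaPart (absExec A G P' acq acc X)) (rdmaPart G) :=
    ⟨h.isRestriction.mem, h.isRestriction.po_iff, h.isRestriction.stmp⟩
  refine ⟨?_, X.restrict (rdmaPart (absExec A G P' acq acc X)),
    hr.witness_wf h.wf h.closed h.stamps,
    fun s k => hib s (hr.ib h.wf h.closed h.stamps k), ?_⟩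
  · intro e he
    obtain ⟨c, h₁, h₂, h₃, h₄⟩ := hG e (hr.mem e he)
    exact ⟨c, h₁, h₂, h₃, (hr.stmp e he).symm ▸ h₄⟩
  · intro s₁ s₂
    constructor
    · rintro ⟨k | k | ⟨-, -, -, k, -⟩, ⟨c, hc⟩, -⟩
      · exact k
      · obtain ⟨c', hc'⟩ := (scSo_mem k).1
        rw [← hc] at hc'
        cases hc'
      · exact absurd hc.symm (k c)
    · intro k
      obtain ⟨k₁, k₂⟩ := Rdma.soSpec_mem h.restrict_wf k
      rw [Exec.mem_SE_restrict] at k₁ k₂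
      exact ⟨Or.inl k, k₁.2, k₂.2⟩

/-- Client locks differ from those of the implementation, so on them immediate program order is the
same in both executions; the lock order is cut down to client acquisitions. -/
theorem nlock_cons (h : Concrete A G P' R acq acc rel aux X) (hl : NLock.LockWF G.toPlain)
    (hG : NLock.Cons N (nlockPart G)) :
    NLock.Cons N (nlockPart (absExec A G P' acq acc X)) := by
  -- Well-formedness of the concrete execution, `hl`, is what unlocks the lock specification; the
  -- abstract premise is discarded.
  intro _
  obtain ⟨hev, lo, hlo, hso⟩ := hG (lockWF_nlockPart hl)
  simp only [acqs_nlockPart] at hlo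
  simp only [rels_nlockPart, immPo_nlockPart] at hso
  have hcm : ∀ {e : Rdma.Ev Tid Node Loc Lock SLoc Val Wid Other}, e ∈ P'.E →
      (∃ c, e.call = .nlock c) → e ∈ G.E := by
    rintro e he ⟨c, hc⟩
    exact h.client_mem he (by simp [hc])
  have hne : ∀ {l e e'}, e' ∈ P'.E → NLock.immPo G.toPlain l e e' → ∀ x, l ≠ A.lock x := by
    rintro l e e' he' ⟨-, ⟨-, k⟩ | ⟨-, k⟩, -⟩ x rfl
    · exact h.sep.acq e' he' x k
    · exact h.sep.rel e' he' x k
  have hne' : ∀ {l e e'}, e' ∈ P'.E → NLock.immPo P' l e e' → ∀ x, l ≠ A.lock x := by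
    rintro l e e' he' ⟨-, ⟨-, k⟩ | ⟨-, k⟩, -⟩ x rfl
    · exact h.sep.acq e' he' x k
    · exact h.sep.rel e' he' x k
  refine ⟨?_, fun l a b => lo l a b ∧ a ∈ P'.E ∧ b ∈ P'.E, ?_, ?_⟩
  · rintro e ⟨he, c, hc⟩
    have heG := hcm he ⟨c, hc.symm⟩
    have := hev e ⟨heG, c, hc⟩
    rwa [Exec.stmp_restrict (M := Set.range Call.nlock) heG ⟨c, hc⟩,
      ← stmp_client (P' := P') (by simp [← hc]),
      ← Exec.stmp_restrict (M := Set.range Call.nlock) (G := absStamped G P') he ⟨c, hc⟩] at this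
  · intro l
    rw [acqs_nlockPart]
    have hacq : ∀ {e}, e ∈ NLock.acqs P' l → e ∈ NLock.acqs G.toPlain l :=
      fun k => ⟨hcm k.1 ⟨_, k.2⟩, k.2⟩
    refine ⟨?_, fun a k => (hlo l).2.1 a k.1,
      fun a b c k m => ⟨(hlo l).2.2.1 _ _ _ k.1 m.1, k.2.1, m.2.2⟩, ?_⟩
    · rintro a b ⟨k, ha, hb⟩
      exact ⟨⟨ha, ((hlo l).1 _ _ k).1.2⟩, ⟨hb, ((hlo l).1 _ _ k).2.2⟩⟩
    · intro a ha b hb hn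
      exact ((hlo l).2.2.2 a (hacq ha) b (hacq hb) hn).imp (fun k => ⟨k, ha.1, hb.1⟩)
        (fun k => ⟨k, hb.1, ha.1⟩)
  · intro s₁ s₂
    simp only [rels_nlockPart, immPo_nlockPart]
    constructor
    · rintro ⟨k | k | ⟨h₁, h₂, -, -, k⟩, ⟨c₁, hc₁⟩, ⟨c₂, hc₂⟩⟩
      · obtain ⟨⟨c, hc⟩, -⟩ := (Rdma.soSpec_mem h.restrict_wf k).imp
          (fun k => (Exec.mem_SE_restrict.1 k).2) id
        rw [← hc₁] at hc
        cases hc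
      · obtain ⟨c, hc⟩ := (scSo_mem k).1
        rw [← hc₁] at hc
        cases hc
      · obtain ⟨l, ⟨m, k⟩ | ⟨m₁, m₂, a, m, k⟩⟩ := (hso s₁ s₂).1 ⟨k, ⟨c₁, hc₁⟩, ⟨c₂, hc₂⟩⟩
        · exact ⟨l, Or.inl ⟨⟨h₁, m.2⟩, k⟩⟩
        · have m' := (h.client_immPo h.plain h.plain' (hne h₁ m)).1 m
          exact ⟨l, Or.inr ⟨m₁, m₂, a, m', k, h.plain'.left_mem m'.2.2.1, h₂⟩⟩
    · have key : ∀ {c₁ c₂}, s₁.1 ∈ P'.E → s₂.1 ∈ P'.E → s₁.1.call = .nlock c₁ →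
          s₂.1.call = .nlock c₂ → (nlockPart G).so s₁ s₂ →
          (nlockPart (absExec A G P' acq acc X)).so s₁ s₂ := fun h₁ h₂ hc₁ hc₂ k =>
        ⟨Or.inr (Or.inr ⟨h₁, h₂, by simp [hc₁], by simp [hc₁], k.1⟩), ⟨_, hc₁.symm⟩,
          ⟨_, hc₂.symm⟩⟩
      rintro ⟨l, ⟨m, k⟩ | ⟨m₁, m₂, a, m, k, ha, hb⟩⟩
      · have hE : s₁.1 ∈ P'.E := m.1
        exact key hE (k.1 ▸ hE) m.2 (k.1 ▸ m.2)
          ((hso _ _).2 ⟨l, Or.inl ⟨⟨hcm hE ⟨_, m.2⟩, m.2⟩, k⟩⟩)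
      · have hE : s₁.1 ∈ P'.E := h.plain'.right_mem m.2.2.1
        have m' := (h.client_immPo h.plain h.plain' (hne' hE m)).2 m
        have hk := (hso s₁ s₂).2 ⟨l, Or.inr ⟨m₁, m₂, a, m', k⟩⟩
        obtain ⟨c₁, hc₁⟩ := hk.2.1
        obtain ⟨c₂, hc₂⟩ := hk.2.2
        exact key hE hb hc₁.symm hc₂.symm hk

/-- The consistency predicate of a further library is arbitrary, so nothing short of equality of
executions will do. It holds because no implementation event calls such a library and `firstEvent`
is the identity on its events, so even happens-before is unchanged. -/
theorem other_restrict (h : Concrete A G P' R acq acc rel aux X)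
    {M : Set (Call Node Loc Lock SLoc Val Wid Other)} (hM : M ⊆ Set.range Call.other) :
    (absExec A G P' acq acc X).restrict M = G.restrict M := by
  have hns : ∀ {e : Rdma.Ev Tid Node Loc Lock SLoc Val Wid Other}, e.call ∈ M →
      (∀ c, e.call ≠ .sc c) ∧ (∀ c, e.call ≠ .rdma c) := by
    intro e he
    obtain ⟨o, ho⟩ := hM he
    simp [← ho]
  have hE : ∀ {e : Rdma.Ev Tid Node Loc Lock SLoc Val Wid Other}, e.call ∈ M →
      (e ∈ P'.E ↔ e ∈ G.E) := by
    intro e he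
    refine ⟨fun k => h.client_mem k (hns he).1, fun k => ?_⟩
    by_contra hn
    obtain ⟨o, ho⟩ := hM he
    rcases h.impl_call k hn with ⟨c, hc⟩ | ⟨c, hc, -⟩ <;> rw [← ho] at hc <;> cases hc
  have hpo : ∀ {e₁ e₂}, e₁.call ∈ M → e₂.call ∈ M → (P'.po e₁ e₂ ↔ G.po e₁ e₂) := by
    intro e₁ e₂ h₁ h₂
    constructor
    · intro k
      exact (h.client_po_iff h.plain h.plain' (h.plain'.left_mem k) (h.plain'.right_mem k)
        (hns h₁).1 (hns h₂).1).2 k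
    · intro k
      exact (h.client_po_iff h.plain h.plain' ((hE h₁).2 (h.plain.left_mem k))
        ((hE h₂).2 (h.plain.right_mem k)) (hns h₁).1 (hns h₂).1).1 k
  have hSE : ∀ {s : Rdma.SEv Tid Node Loc Lock SLoc Val Wid Other}, s.1.call ∈ M →
      s ∈ G.SE → s ∈ (absStamped G P').SE := by
    rintro s hs ⟨k, l⟩
    exact ⟨(hE hs).2 k, (stmp_client (hns hs).1).symm ▸ l⟩
  apply Exec.ext
  · ext e
    exact and_congr_left fun k => hE k
  · funext e₁ e₂
    exact propext (and_congr_left fun k => hpo k.1 k.2)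
  · funext e
    ext a
    constructor
    · rintro ⟨k, he, hc⟩
      exact ⟨stmp_client (P' := P') (hns hc).1 ▸ k, (hE hc).1 he, hc⟩
    · rintro ⟨k, he, hc⟩
      exact ⟨(stmp_client (P' := P') (hns hc).1).symm ▸ k, (hE hc).2 he, hc⟩
  · funext s₁ s₂
    refine propext (and_congr_left fun ⟨h₁, h₂⟩ => ⟨?_, fun k => Or.inr (Or.inr ?_)⟩)
    · rintro (k | k | ⟨-, -, -, -, k⟩)
      · obtain ⟨⟨c, hc⟩, -⟩ := (Rdma.soSpec_mem h.restrict_wf k).imp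
          (fun k => (Exec.mem_SE_restrict.1 k).2) id
        exact absurd hc.symm ((hns h₁).2 c)
      · obtain ⟨c, hc⟩ := (scSo_mem k).1
        exact absurd hc ((hns h₁).1 c)
      · exact k
    · obtain ⟨k₁, k₂⟩ := h.exec.2.2.1 _ _ (h.exec.2.2.2.2.1 _ _ k)
      exact ⟨(hE h₁).2 k₁.1, (hE h₂).2 k₂.1, (hns h₁).1, (hns h₁).2, k⟩
  · funext s₁ s₂
    refine propext (and_congr_left fun ⟨h₁, h₂⟩ => ?_)
    change (_ ∧ _ ∧ _) ↔ _
    rw [firstEvent_client (hns h₁).1, firstEvent_client (hns h₂).1]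
    refine ⟨fun k => k.2.2, fun k => ?_⟩
    obtain ⟨k₁, k₂⟩ := h.exec.2.2.1 _ _ k
    exact ⟨hSE h₁ k₁, hSE h₂ k₂, k⟩

end General

/-- The value written by an abstract subevent. -/
def scVal (A : Alloc N SLoc Wid)
    (acc : Rdma.Ev Tid Node Loc Lock SLoc Val Wid Other →
      Rdma.Ev Tid Node Loc Lock SLoc Val Wid Other)
    (X : Rdma.Witness Tid Node Loc Lock SLoc Val Wid Other)
    (s : Rdma.SEv Tid Node Loc Lock SLoc Val Wid Other) : Val :=
  match s.1.call with
  | .sc c => X.vW (acc s.1, .nrW (A.node c.loc))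
  | _ => s.1.out

theorem scVal_eq {s : Rdma.SEv Tid Node Loc Lock SLoc Val Wid Other} {c} (hc : s.1.call = .sc c) :
    scVal A acc X s = X.vW (acc s.1, .nrW (A.node c.loc)) := by
  rw [scVal, hc]

/-- The witness is pulled back from the accesses along the injective map `acc`. Abstract reads
return their output by definition; agreement with reads-from is `vR_acc`. -/
theorem sc_cons [Zero Val] [AddCommMagma Val] (h : Concrete A G P' R acq acc rel aux X) :
    SC.Cons N (scPart (absExec A G P' acq acc X)) := by
  have hm := h.wf.rf_mo.isModOrder
  refine ⟨?_, fun s => s.1.out, scVal A acc X, scRf A (absStamped G P') acc X,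
    scMo A (absStamped G P') acc X, fun _ _ => rfl, ?_, ⟨?_, ?_, ?_, isModOrder_iff.1 ?_⟩, ?_⟩
  · rintro e ⟨he, c, hc⟩
    refine ⟨⟨c, hc.symm⟩, ?_, ?_⟩
    · refine (Exec.stmp_restrict (M := Set.range Call.sc) (G := absStamped G P') he ⟨c, hc⟩).trans ?_
      rw [stmp_sc hc.symm]
    · intro x v hc
      -- An abstract write takes its output from its release, which returns the unit value.
      have := h.nlock_out _ (h.rel_mem he hc) _ (h.rel_call e he _ hc)
      rw [(h.write e he x v hc).1, lastEvent, hc] at this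
      exact this
  · intro s hs
    obtain ⟨he, ha, c, hc, hw⟩ := (h.mem_scWrites s).1 hs
    rw [scVal_eq hc]
    refine ⟨fun x v k => ?_, fun x v k => ?_, fun x v k => ?_⟩
    · obtain rfl := Call.sc.inj (hc.symm.trans k)
      exact h.vW_acc_write he hc
    · obtain rfl := Call.sc.inj (hc.symm.trans k)
      rcases h.acc_nrW_cas he hc with ⟨-, -, k⟩ | ⟨-, k⟩
      · exact k
      · exact absurd rfl k
    · obtain rfl := Call.sc.inj (hc.symm.trans k)
      -- The two libraries add the operands in opposite orders; commutativity is used here.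
      exact (h.vW_acc_faa he hc).trans (add_comm _ _)
  · rintro w r ⟨hw, hr, c, c', hc, hc', k⟩
    refine ⟨hw, hr, ?_⟩
    obtain ⟨he, -, c₀, hc₀, hw⟩ := (h.mem_scWrites w).1 hw
    obtain rfl : c = c₀ := Call.sc.inj (hc.symm.trans hc₀)
    obtain ⟨he', -, c₁, hc₁, hr⟩ := (mem_scReads r).1 hr
    obtain rfl : c' = c₁ := Call.sc.inj (hc'.symm.trans hc₁)
    obtain ⟨-, -, hl, hv⟩ := h.wf.rf_mo.1 _ _ k
    rw [h.loc_acc_write he hc hw, h.loc_acc_read he' hc' hr] at hl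
    rw [h.vR_acc he' hc' hr] at hv
    refine ⟨?_, (scVal_eq hc).trans hv⟩
    simp only [SC.loc, hc, hc', A.data_inj (Set.singleton_injective hl)]
  · rintro w₁ w₂ r ⟨hw₁, -, c₁, c, hc₁, hc, k₁⟩ ⟨hw₂, -, c₂, c', hc₂, hc', k₂⟩
    obtain rfl : c = c' := Call.sc.inj (hc.symm.trans hc')
    obtain ⟨he₁, ha₁, -⟩ := (h.mem_scWrites _).1 hw₁
    obtain ⟨he₂, ha₂, -⟩ := (h.mem_scWrites _).1 hw₂
    have := h.wf.rf_mo.2.1 _ _ _ k₁ k₂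
    exact Prod.ext (h.acc_inj he₁ he₂ hc₁ hc₂ (congrArg Prod.fst this)) (ha₁.trans ha₂.symm)
  · intro r hr hn
    obtain ⟨he, -, c, hc, hw⟩ := (mem_scReads (G := G) r).1 hr
    refine (h.vR_acc he hc hw).symm.trans ?_
    refine h.wf.rf_mo.2.2.1 _ (h.acc_read_mem he hc) fun w k => ?_
    obtain ⟨w', k⟩ := h.exists_scRf hr hc k
    exact hn w' k
  · refine ⟨?_, ?_, ?_, ?_⟩
    · rintro w₁ w₂ ⟨hw₁, hw₂, c₁, c₂, hc₁, hc₂, k⟩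
      refine ⟨hw₁, hw₂, c₁.loc, by simp [SC.loc, hc₁], ?_⟩
      obtain ⟨he₁, -, c, hc, hw₁⟩ := (h.mem_scWrites _).1 hw₁
      obtain rfl : c = c₁ := Call.sc.inj (hc.symm.trans hc₁)
      obtain ⟨he₂, -, c', hc', hw₂⟩ := (h.mem_scWrites _).1 hw₂
      obtain rfl : c' = c₂ := Call.sc.inj (hc'.symm.trans hc₂)
      obtain ⟨-, -, x, hx, hy⟩ := hm.mem _ _ k
      rw [h.loc_acc_write he₁ hc₁ hw₁] at hx
      rw [h.loc_acc_write he₂ hc₂ hw₂] at hy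
      simp [SC.loc, hc₂, A.data_inj (Set.singleton_injective (hx.trans hy.symm))]
    · rintro w ⟨-, -, c, c', hc, hc', k⟩
      obtain rfl : c = c' := Call.sc.inj (hc.symm.trans hc')
      exact hm.irrefl _ k
    · rintro w₁ w₂ w₃ ⟨hw₁, -, c₁, c, hc₁, hc, k₁⟩ ⟨-, hw₃, c', c₃, hc', hc₃, k₂⟩
      obtain rfl : c = c' := Call.sc.inj (hc.symm.trans hc')
      exact ⟨hw₁, hw₃, c₁, c₃, hc₁, hc₃, hm.trans _ _ _ k₁ k₂⟩
    · intro w₁ hw₁ w₂ hw₂ x hx hy hne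
      obtain ⟨he₁, ha₁, c₁, hc₁, k₁⟩ := (h.mem_scWrites _).1 hw₁
      obtain ⟨he₂, ha₂, c₂, hc₂, k₂⟩ := (h.mem_scWrites _).1 hw₂
      simp only [SC.loc, hc₁, hc₂] at hx hy
      have hx := Set.singleton_injective hx
      have hy := Set.singleton_injective hy
      have hne' : acc w₁.1 ≠ acc w₂.1 := fun k =>
        hne (Prod.ext (h.acc_inj he₁ he₂ hc₁ hc₂ k) (ha₁.trans ha₂.symm))
      refine (hm.total _ (h.acc_write_mem he₁ hc₁ k₁) _ (h.acc_write_mem he₂ hc₂ k₂) (A.data x)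
        (by rw [h.loc_acc_write he₁ hc₁ k₁, hx]) (by rw [h.loc_acc_write he₂ hc₂ k₂, hy])
        fun k => hne' (congrArg Prod.fst k)).imp
        (fun k => ⟨hw₁, hw₂, c₁, c₂, hc₁, hc₂, k⟩) (fun k => ⟨hw₂, hw₁, c₂, c₁, hc₂, hc₁, k⟩)
  · intro s₁ s₂
    constructor
    · rintro ⟨k | k | ⟨-, -, k, -⟩, ⟨c, hc⟩, -⟩
      · obtain ⟨⟨c', hc'⟩, -⟩ := (Rdma.soSpec_mem h.restrict_wf k).imp
          (fun k => (Exec.mem_SE_restrict.1 k).2) id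
        rw [← hc'] at hc
        cases hc
      · exact k.imp_left fun k => ⟨k.1, k.2.1, k.2.2⟩
      · exact absurd hc.symm (k c)
    · intro k
      have k' : scSo A (absStamped G P') acc X s₁ s₂ := k
      obtain ⟨⟨c₁, hc₁⟩, ⟨c₂, hc₂⟩⟩ := scSo_mem k'
      exact ⟨Or.inr (Or.inl k'), ⟨c₁, hc₁.symm⟩, ⟨c₂, hc₂.symm⟩⟩

end Concrete

end Consistency

end Mowgli

namespace Mowgli

section Soundness

variable {Tid Node Loc Lock SLoc Val Wid Other OLoc : Type*}

theorem Sem.seq_call {Call : Type*} {t : Tid} {c : Call} {q : SeqProg Call Val} {r : Val × ℕ}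
    {G : Plain Tid Call Val} (i : ℕ) (v : Val) (h : Sem t q r G)
    (hn : (⟨t, i, c, v⟩ : Event Tid Call Val) ∉ G.E) :
    Sem t (.seq (.call c) q) r ((Plain.single ⟨t, i, c, v⟩).comp G) :=
  .letIn (.call c i v) h (Set.disjoint_singleton_left.2 hn)

variable [Zero Val] {N : Network Tid Node Loc Lock Val} {A : Alloc N SLoc Wid}
  {Λ₀ Λ : Set (Library Tid (Call Node Loc Lock SLoc Val Wid Other) Val Node
    (ALoc Loc Lock SLoc OLoc))}

/-- `implLoc` collects what actual runs access, so to exploit disjointness one must exhibit runs: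
one write and one read reach all the resources. -/
theorem mem_implLoc [Add Val] (hΛ : Λ = {rdmaLib N, nlockLib N} ∪ Λ₀) (x : SLoc) (t : Tid) :
    .lock (A.lock x) ∈ implLoc Λ (scLib N) (scImpl A) ∧
    .rdma (A.data x) ∈ implLoc Λ (scLib N) (scImpl A) ∧
    .rdma (A.tmp x t) ∈ implLoc Λ (scLib N) (scImpl A) ∧
    .rdma (A.res t) ∈ implLoc Λ (scLib N) (scImpl A) := by
  have hr : rdmaLib N ∈ Λ := by simp [hΛ]
  have hn : nlockLib N ∈ Λ := by simp [hΛ]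
  -- The identifiers are consecutive to make the events distinct; the outputs, here `0`, are
  -- arbitrary in the plain semantics.
  have hw : Sem t (scImpl (Other := Other) A t (.sc (.write x 0))) (0, 0) _ :=
    Sem.seq_call 0 0 (Sem.seq_call 1 0 (Sem.seq_call 2 0 (.call _ 3 0) (by simp [Plain.single]))
      (by simp [Plain.single, Plain.comp])) (by simp [Plain.single, Plain.comp])
  have hf : Sem t (scImpl (Other := Other) A t (.sc (.read x))) (0, 0) _ :=
    Sem.seq_call 0 0 (Sem.seq_call 1 0 (Sem.seq_call 2 0 (Sem.seq_call 3 0 (.call _ 4 0)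
      (by simp [Plain.single])) (by simp [Plain.single, Plain.comp]))
      (by simp [Plain.single, Plain.comp])) (by simp [Plain.single, Plain.comp])
  refine ⟨⟨t, _, ⟨_, rfl⟩, _, _, hw, _, Or.inl rfl, _, hn, ⟨_, rfl⟩, rfl⟩,
    ⟨t, _, ⟨_, rfl⟩, _, _, hw, _, Or.inr (Or.inr (Or.inl rfl)), _, hr, ⟨_, rfl⟩, _, Or.inl rfl, rfl⟩,
    ⟨t, _, ⟨_, rfl⟩, _, _, hw, _, Or.inr (Or.inl rfl), _, hr, ⟨_, rfl⟩, _, rfl, rfl⟩,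
    ⟨t, _, ⟨_, rfl⟩, _, _, hf, _, Or.inr (Or.inl rfl), _, hr, ⟨_, rfl⟩, _, Or.inl rfl, rfl⟩⟩

/-- An offending client event would put one of the resources found by `mem_implLoc` into `progLoc`.
-/
theorem separated [Add Val] (hΛ : Λ = {rdmaLib N, nlockLib N} ∪ Λ₀)
    {p : Prog Tid (Call Node Loc Lock SLoc Val Wid Other) Val}
    (hloc : Disjoint (implLoc Λ (scLib N) (scImpl A)) (progLoc (insert (scLib N) Λ) p))
    {v : Tid → Val} {P' : Plain Tid (Call Node Loc Lock SLoc Val Wid Other) Val}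
    (hp : ConcSem p v P') : Separated A P' := by
  have hr : rdmaLib N ∈ insert (scLib N) Λ := by simp [hΛ]
  have hn : nlockLib N ∈ insert (scLib N) Λ := by simp [hΛ]
  have key : ∀ {y}, y ∈ implLoc Λ (scLib N) (scImpl A) → ∀ {e}, e ∈ P'.E →
      ∀ {L}, L ∈ insert (scLib N) Λ → e.call ∈ L.methods → y ∈ L.loc e.call → False :=
    fun hy e he L hL hc hx => Set.disjoint_left.1 hloc hy ⟨v, P', hp, e, he, L, hL, hc, hx⟩
  refine ⟨fun e he x hc => ?_, fun e he x hc => ?_, fun e he c hc y hy x t => ?_⟩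
  · exact key (mem_implLoc hΛ x e.thread).1 he hn ⟨_, hc.symm⟩ (by rw [hc]; rfl)
  · exact key (mem_implLoc hΛ x e.thread).1 he hn ⟨_, hc.symm⟩ (by rw [hc]; rfl)
  · obtain ⟨-, h₁, h₂, h₃⟩ := mem_implLoc (A := A) hΛ x t
    have hm : ALoc.rdma y ∈ (rdmaLib (OLoc := OLoc) N).loc e.call := by
      rw [hc]
      exact ⟨y, hy, rfl⟩
    refine ⟨?_, ?_, ?_⟩ <;> rintro rfl
    · exact key h₁ he hr ⟨c, hc.symm⟩ hm
    · exact key h₃ he hr ⟨c, hc.symm⟩ hm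
    · exact key h₂ he hr ⟨c, hc.symm⟩ hm

/-- The common core of both claims: well-formedness is assumed for the locks of the concrete
execution only, and the final values are carried by the abstract plain execution. -/
theorem mem_outcome [AddCommMagma Val]
    (hother : ∀ L ∈ Λ₀, L.methods ⊆ Set.range Call.other)
    (hΛ : Λ = {rdmaLib N, nlockLib N} ∪ Λ₀)
    {p : Prog Tid (Call Node Loc Lock SLoc Val Wid Other) Val}
    (hloc : Disjoint (implLoc Λ (scLib N) (scImpl A)) (progLoc (insert (scLib N) Λ) p))
    {v : Tid → Val} {G : Rdma.Ex Tid Node Loc Lock SLoc Val Wid Other} (hG : Consistent Λ G)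
    {P' R} (hp : ConcSem p v P') (hR : Refines A G.toPlain P' R)
    (hl : NLock.LockWF G.toPlain) : v ∈ outcome (insert (scLib N) Λ) p := by
  obtain ⟨hex, hcons, hmeth, hso, hirr⟩ := hG
  obtain ⟨acq, acc, rel, aux, hL⟩ := hR.exists_layout hex.1
  have hsep := separated hΛ hloc hp
  obtain ⟨hrE, X, hX, hib, hrso⟩ : Rdma.Cons N (rdmaPart G) := hcons (rdmaLib N) (by simp [hΛ])
  have hnl : NLock.Cons N (nlockPart G) := hcons (nlockLib N) (by simp [hΛ])
  obtain ⟨hnE, lo, hlo, hnso⟩ := hnl (lockWF_nlockPart hl)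
  simp only [acqs_nlockPart] at hlo
  simp only [rels_nlockPart, immPo_nlockPart] at hnso
  have hnst : ∀ e ∈ G.E, ∀ c, e.call = .nlock c → e.out = N.unit ∧ ∃ l,
      (e.call = .nlock (.acq l) ∧ G.stmp e = {.aMF}) ∨
      (e.call = .nlock (.rel l) ∧ G.stmp e = {.nF (N.lockNode l), .nrW (N.lockNode l)}) := by
    intro e he c hc
    have := hnE e ⟨he, c, hc.symm⟩
    rwa [Exec.stmp_restrict (M := Set.range Call.nlock) he ⟨c, hc.symm⟩] at this
  have hhb : ∀ {s₁ s₂}, (nlockPart G).so s₁ s₂ → G.hb s₁ s₂ :=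
    fun k => hex.2.2.2.2.1 _ _ k.1
  have h : Concrete A G P' R acq acc rel aux X := by
    refine { hL with
      exec := hex, plain' := hp.isPlain, sep := hsep, hb_irrefl := hirr, rdma := ?_, wf := hX,
      hb_of_so := fun s₁ s₂ k => hex.2.2.2.2.1 _ _ ((hrso s₁ s₂).2 k).1,
      acq_stmp := ?_, rel_stmp := ?_, nlock_out := fun e he c hc => (hnst e he c hc).1,
      hb_release := ?_, lock_total := ?_ }
    · intro e he c hc
      obtain ⟨c', hc', -, -, hs⟩ := hrE e ⟨he, c, hc.symm⟩
      obtain rfl : c = c' := Call.rdma.inj (hc.symm.trans hc')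
      rwa [Exec.stmp_restrict (M := Set.range Call.rdma) he ⟨c, hc.symm⟩] at hs
    · intro e he l hc
      obtain ⟨-, l', ⟨-, k⟩ | ⟨k, -⟩⟩ := hnst e he _ hc
      · exact k
      · rw [hc] at k
        cases k
    · intro e he l hc
      obtain ⟨-, l', ⟨k, -⟩ | ⟨k, m⟩⟩ := hnst e he _ hc
      · rw [hc] at k
        cases k
      · rw [hc] at k
        cases k
        exact m
    · exact fun e he l hc => hhb ((hnso _ _).2 ⟨l, Or.inl ⟨⟨he, hc⟩, rfl, rfl, rfl⟩⟩)
    · intro l a₁ a₂ r₁ r₂ h₁ h₂ i₁ i₂ hne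
      exact ((hlo l).2.2.2 a₁ h₁ a₂ h₂ hne).imp
        (fun k => hhb ((hnso _ _).2 ⟨l, Or.inr ⟨rfl, rfl, a₁, i₁, k⟩⟩))
        (fun k => hhb ((hnso _ _).2 ⟨l, Or.inr ⟨rfl, rfl, a₂, i₂, k⟩⟩))
  refine ⟨absExec A G P' acq acc X, ⟨h.absExec_isExec, ?_, ?_, ?_, ?_⟩, hp⟩
  · rintro L (rfl | hL)
    · exact h.sc_cons
    · rw [hΛ] at hL
      rcases hL with (rfl | rfl) | hL
      · exact h.rdma_cons hrE hib
      · exact h.nlock_cons hl hnl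
      · rw [h.other_restrict (hother L hL)]
        exact hcons L (by simp [hΛ, hL])
  · intro e he
    by_cases hc : ∃ c, e.call = .sc c
    · obtain ⟨c, hc⟩ := hc
      exact ⟨scLib N, Set.mem_insert _ _, ⟨c, hc.symm⟩⟩
    · push Not at hc
      obtain ⟨L, hL, k⟩ := hmeth e (h.client_mem he hc)
      exact ⟨L, Set.mem_insert_of_mem _ hL, k⟩
  · intro s₁ s₂
    refine ⟨fun k => ?_, fun ⟨L, _, k⟩ => k.1⟩
    have k' := k
    rcases k' with m | m | ⟨-, -, -, -, m⟩
    · obtain ⟨k₁, k₂⟩ := Rdma.soSpec_mem h.restrict_wf m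
      exact ⟨rdmaLib N, by simp [hΛ], k, (Exec.mem_SE_restrict.1 k₁).2,
        (Exec.mem_SE_restrict.1 k₂).2⟩
    · obtain ⟨⟨c₁, k₁⟩, ⟨c₂, k₂⟩⟩ := Concrete.scSo_mem m
      exact ⟨scLib N, Set.mem_insert _ _, k, ⟨c₁, k₁.symm⟩, ⟨c₂, k₂.symm⟩⟩
    -- A remaining edge keeps the library that accounts for it in the concrete execution, membership
    -- in its methods being a condition on calls alone.
    · obtain ⟨L, hL, m⟩ := (hso s₁ s₂).1 m
      exact ⟨L, Set.mem_insert_of_mem _ hL, k, m.2⟩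
  · exact fun s k => hirr _ k.2.2

end Soundness

end Mowgli

theorem mainTheorem1 {Tid Node Loc Lock SLoc Val Wid Other OLoc : Type*}
    [Finite Tid] [Zero Val] [AddCommMagma Val]
    (N : Network Tid Node Loc Lock Val) (A : Alloc N SLoc Wid)
    (Λ₀ Λ : Set (Library Tid (Call Node Loc Lock SLoc Val Wid Other) Val Node
      (ALoc Loc Lock SLoc OLoc)))
    (hother : ∀ L ∈ Λ₀, L.methods ⊆ Set.range Call.other)
    (hdisj : Λ₀.PairwiseDisjoint Library.methods)
    (hΛ : Λ = {rdmaLib N, nlockLib N} ∪ Λ₀)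
    (p : Prog Tid (Call Node Loc Lock SLoc Val Wid Other) Val)
    (hloc : Disjoint (implLoc Λ (scLib N) (scImpl A)) (progLoc (insert (scLib N) Λ) p)) :
    ((∀ v G, ConcSem p v G → NLock.LockWF G) →
      outcome Λ (implement (scImpl A) (scLib (OLoc := OLoc) N) p) ⊆
        outcome (insert (scLib N) Λ) p) ∧
    (∀ v G, Consistent Λ G →
      ConcSem (implement (scImpl A) (scLib (OLoc := OLoc) N) p) v G.toPlain →
      NLock.LockWF G.toPlain → v ∈ outcome (insert (scLib N) Λ) p) := by
  constructor
  -- The hypothesis speaks of plain executions of `p`, so it is applied to the abstraction, and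
  -- `lockWF` carries it back to the execution of the implementation.
  · rintro hwf v ⟨G, hG, hv⟩
    obtain ⟨P', R, hp, hR⟩ := hv.abstract
    obtain ⟨acq, acc, rel, aux, hL⟩ := hR.exists_layout hG.1.1
    exact mem_outcome hother hΛ hloc hG hp hR
      (hL.lockWF hG.1.1 hp.isPlain (separated hΛ hloc hp) (hwf v P' hp))
  · intro v G hG hv hl
    obtain ⟨P', R, hp, hR⟩ := hv.abstract
    exact mem_outcome hother hΛ hloc hG hp hR hl
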